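/- Let $I=(0,\infty)$, $dm=2x^{2}\,dx$ on $I$, and let $\mathcal E$ be the Bessel Dirichlet form in dimension $n=3$ on $L^2(I,m)$: $$\mathcal E[u]=\int_0^\infty u'(x)^2x^2\,dx,\qquad \mathcal D=\Big\{u\in L^2(I,m):\ u \text{ locally absolutely continuous on } I,\ \int_0^\infty u'(x)^2x^2\,dx<\infty\Big\}.$$ For $\lambda>0$ put $\mathcal E_\lambda=\mathcal E+\lambda(\cdot,\cdot)_{L^2(I,m)}$. Let $\mathbb N=\{1,2,\dots\}$ and $\mu=\sum_{k\ge1}a_k\delta_k$ with $a_k>0$ for all $k$. Let $J$ be the restriction operator $Ju=u|_{\mathbb N}$ with $D(J)=\{u\in\mathcal D:\ \sum_k a_ku(k)^2<\infty\}$ and values in $\ell^2(\mathbb N,\mu)$, let $P_\lambda$ be the orthogonal projection in the Hilbert space $(\mathcal D,\mathcal E_\lambda)$ onto the orthogonal complement of $\ker J$, and let $\check{\mathcal E}_\lambda[Ju]=\mathcal E_\lambda[P_\lambda u]$ for $u\in D(J)$ (with value $+\infty$ off the range of $J$). The trace $\check{\mathcal E}$ of $\mathcal E$ on $\mathbb N$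 with respect to $\mu$ is the Mosco limit of $\check{\mathcal E}_\lambda$ in $\ell^2(\mathbb N,\mu)$ as $\lambda\downarrow0$. Let $T_t=e^{-t\check H}$, $t\geq 0$, where $\check H$ is the positive self-adjoint operator in $\ell^2(\mathbb N,\mu)$ associated with $\check{\mathcal E}$. The form $\check{\mathcal E}$ is called conservative if the extension of $T_t$ to $L^\infty$ satisfies $T_t1=1$ for every $t>0$. Then $\check{\mathcal E}$ and $(T_t)_{t\ge0}$ exist and are unique, and: 1. If $\mu(\mathbb N)<\infty$, then $\check{\mathcal E}$ is not conservative. 2. If $\mu(\mathbb N)=\infty$, then $\check{\mathcal E}$ is conservative if and only if $\displaystyle\sum_{k=1}^\infty \frac{a_k}{k}=\infty$. -/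

import Mathlib

open MeasureTheory Filter Topology Set
open scoped ENNReal NNReal

noncomputable section

namespace BesselTrace

/-! ### The Bessel Dirichlet form on `(0, ∞)` -/

/-- The measure `dm = 2 x ^ (n - 1) dx` on `(0, ∞)` (for a dimension `n ≥ 1`), as a measure on `ℝ`
carried by `(0, ∞)`. -/
def besselMeasure (n : ℕ) : Measure ℝ :=
  (volume.restrict (Ioi (0 : ℝ))).withDensity fun x => ENNReal.ofReal (2 * x ^ (n - 1))

/-- The domain of the Bessel form: functions that are (locally) absolutely continuous on `(0, ∞)`,
have finite energy and lie in `L²(m)`. Only the values of `u` on `(0, ∞)` matter. -/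
def besselDomain (n : ℕ) : Set (ℝ → ℝ) :=
  {u | (∀ x y : ℝ, 0 < x → x ≤ y → AbsolutelyContinuousOnInterval u x y) ∧
    IntegrableOn (fun x => deriv u x ^ 2 * x ^ (n - 1)) (Ioi 0) ∧
    MemLp u 2 (besselMeasure n)}

/-- The Bessel form `ℰ(u, v) = ∫₀^∞ u'(x) v'(x) x ^ (n - 1) dx`. -/
def besselForm (n : ℕ) (u v : ℝ → ℝ) : ℝ :=
  ∫ x in Ioi (0 : ℝ), deriv u x * deriv v x * x ^ (n - 1)

/-- The form `ℰ_lam(u, v) = ℰ(u, v) + lam (u, v)_{L²(m)}`. -/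
def besselFormShift (n : ℕ) (lam : ℝ) (u v : ℝ → ℝ) : ℝ :=
  besselForm n u v + lam * ∫ x, u x * v x ∂(besselMeasure n)

/-! ### The trace on the positive integers -/

/-- The positive integers are equipped with the discrete σ-algebra. -/
instance : MeasurableSpace ℕ+ := ⊤

instance : DiscreteMeasurableSpace ℕ+ := ⟨fun _ => trivial⟩

/-- The measure `∑ₖ aₖ δₖ` on the positive integers. -/
def discreteMeasure (a : ℕ+ → ℝ) : Measure ℕ+ :=
  Measure.sum fun k => ENNReal.ofReal (a k) • Measure.dirac k

/-- `IsRestriction n μ u f`: `u` lies in the domain of the restriction operator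
`J : 𝒟 ⊇ D(J) → L²(ℕ, μ)`, and `J u = f`. -/
def IsRestriction (n : ℕ) (μ : Measure ℕ+) (u : ℝ → ℝ) (f : Lp ℝ 2 μ) : Prop :=
  u ∈ besselDomain n ∧ ∃ hu : MemLp (fun k : ℕ+ => u (k : ℝ)) 2 μ, hu.toLp _ = f

/-- The kernel of `J` (for a measure charging every positive integer). -/
def kerRestriction (n : ℕ) : Set (ℝ → ℝ) :=
  {w | w ∈ besselDomain n ∧ ∀ k : ℕ+, w (k : ℝ) = 0}

/-- `p` is the `ℰ_lam`-orthogonal projection of `u` onto the orthogonal complement of `ker J` in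
the Hilbert space `(𝒟, ℰ_lam)`. -/
def IsProjection (n : ℕ) (lam : ℝ) (u p : ℝ → ℝ) : Prop :=
  p ∈ besselDomain n ∧ (∀ w ∈ kerRestriction n, besselFormShift n lam p w = 0) ∧
    u - p ∈ kerRestriction n

/-- The approximating form `J u ↦ ℰ_lam[P_lam u]` on `L²(ℕ, μ)`, with value `∞` off the range
of `J`. (All the pairs `(u, p)` in the infimum give the same value.) -/
def traceApprox (n : ℕ) (μ : Measure ℕ+) (lam : ℝ) (f : Lp ℝ 2 μ) : ℝ≥0∞ :=
  ⨅ (u : ℝ → ℝ) (p : ℝ → ℝ) (_ : IsRestriction n μ u f) (_ : IsProjection n lam u p),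
    ENNReal.ofReal (besselFormShift n lam p p)

/-- `F₀` is the Mosco limit of the functionals `F lam` as `lam ↓ 0`. -/
structure IsMoscoLimit {H : Type*} [NormedAddCommGroup H] [InnerProductSpace ℝ H]
    (F : ℝ → H → ℝ≥0∞) (F₀ : H → ℝ≥0∞) : Prop where
  /-- The lower bound along weakly convergent sequences. -/
  liminf_le : ∀ (l : ℕ → ℝ) (x : ℕ → H) (y : H), Tendsto l atTop (𝓝[>] 0) →
    (∀ z : H, Tendsto (fun i => inner ℝ (x i) z) atTop (𝓝 (inner ℝ y z))) →
    F₀ y ≤ liminf (fun i => F (l i) (x i)) atTop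
  /-- The existence of strongly convergent recovery sequences. -/
  recovery : ∀ (l : ℕ → ℝ) (y : H), Tendsto l atTop (𝓝[>] 0) →
    ∃ x : ℕ → H, Tendsto x atTop (𝓝 y) ∧ limsup (fun i => F (l i) (x i)) atTop ≤ F₀ y

/-- `E` is the trace of the Bessel form with respect to `μ`. A quadratic form `E` on `L²(ℕ, μ)` is
encoded as the functional `f ↦ E[f]` with value `∞` off its domain. -/
def IsTraceForm (n : ℕ) (μ : Measure ℕ+) (E : Lp ℝ 2 μ → ℝ≥0∞) : Prop :=
  IsMoscoLimit (traceApprox n μ) E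

/-! ### The semigroup of a form, and conservativeness -/

section Semigroup

variable {H : Type*} [NormedAddCommGroup H] [InnerProductSpace ℝ H]

/-- The bilinear form of the quadratic form `E`, by polarization (used on the domain of `E`). -/
def polarization (E : H → ℝ≥0∞) (u v : H) : ℝ :=
  ((E (u + v)).toReal - (E (u - v)).toReal) / 4

/-- The graph of the operator `A` associated with the form `E`: `u ∈ D(A)` and `A u = f` means that
`u ∈ D(E)` and `E(u, v) = (f, v)` for all `v ∈ D(E)`. -/
def IsFormOperator (E : H → ℝ≥0∞) (u f : H) : Prop :=
  E u ≠ ∞ ∧ ∀ v : H, E v ≠ ∞ → polarization E u v = inner ℝ f v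

/-- `T` is the semigroup `(e^{-tA})_{t ≥ 0}` of the form `E`: the strongly continuous semigroup of
symmetric contractions whose generator is `-A`, with `A` the operator associated with `E`. -/
structure IsFormSemigroup (E : H → ℝ≥0∞) (T : ℝ≥0 → H →L[ℝ] H) : Prop where
  zero : T 0 = ContinuousLinearMap.id ℝ H
  add : ∀ s t, T (s + t) = (T s).comp (T t)
  continuous : ∀ f, Continuous fun t => T t f
  contraction : ∀ t f, ‖T t f‖ ≤ ‖f‖
  symmetric : ∀ t f g, inner ℝ (T t f) g = inner ℝ f (T t g)
  generator : ∀ u f, Tendsto (fun t : ℝ≥0 => (t : ℝ)⁻¹ • (u - T t u)) (𝓝[>] 0) (𝓝 f) ↔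
    IsFormOperator E u f

end Semigroup

section Conservative

variable {Ω : Type*} [MeasurableSpace Ω] {μ : Measure Ω}

/-- The extension of the positivity preserving operator `S` on `L²(μ)` to nonnegative functions in
`L^∞` (by monotone limits of `L²` functions) maps the constant function `1` to itself. -/
def FixesOne (S : Lp ℝ 2 μ →L[ℝ] Lp ℝ 2 μ) : Prop :=
  ∀ f : ℕ → Lp ℝ 2 μ, (∀ i, 0 ≤ f i) → Monotone f →
    (∀ᵐ x ∂μ, Tendsto (fun i => f i x) atTop (𝓝 1)) →
    ∀ᵐ x ∂μ, Tendsto (fun i => S (f i) x) atTop (𝓝 1)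

/-- The form `E` is conservative: its `L^∞`-semigroup satisfies `T_t 1 = 1` for every `t > 0`. -/
def IsConservative (E : Lp ℝ 2 μ → ℝ≥0∞) : Prop :=
  ∃ T : ℝ≥0 → Lp ℝ 2 μ →L[ℝ] Lp ℝ 2 μ, IsFormSemigroup E T ∧ ∀ t, 0 < t → FixesOne (T t)

end Conservative

end BesselTrace

end

/-! The trace is computed explicitly. Off the integers, a function minimising `∫ u'² x²` has
constant flux `x² u'`. The edge `{k, k + 1}` therefore has resistance `∫ x⁻² = 1 / (k (k + 1))`, and
`(0, 1)` contributes no energy. This gives `∑ k (k + 1) (f (k + 1) - f k)²`. Every function in the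
domain of the Bessel form tends to `0` along the integers, and because the resistance from `k` to
infinity is finite (it equals `1 / k`) this condition survives the limit. `traceForm` is this sum on
functions vanishing at infinity, and `∞` elsewhere.

Mosco convergence is `isTraceForm_traceForm`. The lower bound combines `traceForm_le_traceApprox`,
valid for each `lam`, with weak lower semicontinuity (`traceForm_le_liminf`). For the upper bound,
the projection of a finitely supported function is an explicit combination of `sinh (κ (x - b)) / x`
with `κ² = 2 lam`. Its energy follows by parts (`besselFormShift_hat`) and tends to the trace form.
Soft thresholding and a diagonal choice extend this to all functions of finite energy. Mosco limits
are unique (`IsMoscoLimit.le`).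

The form is `‖d u‖²` for a closed operator `d` with graph `gradGraph`. Its operator is nonnegative
and self-adjoint, and Yosida approximation generates the unique semigroup. This semigroup is
sub-Markovian because normal contractions do not increase the form.

If `μ` is finite, conservativeness would put `1` in the form domain, although it does not vanish at
infinity. If `∑ a k / k` converges, the Green function `1 / max k j` has potential bounded by this
sum; the potential dominates `∫₀ᵗ T s 1 ds`, which would be `t` under conservativeness
(`not_isConservative_of_summable`). If the sum diverges, a loss of mass would be a flux to infinity.
Such a flux forces the time-integrated kernel to be at least a constant times `1 / k`, and its
finite mass would then bound `∑ a k / k` (`exists_lt_semigroup_indicator`). -/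

noncomputable section

namespace BesselTrace

/-! ### Semigroups of nonnegative self-adjoint linear relations -/

section LinearRelation

variable {H : Type*} [NormedAddCommGroup H] [InnerProductSpace ℝ H]

/-- A densely defined nonnegative self-adjoint operator, given by its graph `A`. -/
structure IsNonnegSelfAdjoint (A : Submodule ℝ (H × H)) : Prop where
  symm : ∀ x ∈ A, ∀ y ∈ A, inner ℝ x.1 y.2 = inner ℝ x.2 y.1
  nonneg : ∀ x ∈ A, 0 ≤ inner ℝ x.2 x.1
  -- `A u = c (f - u)` says `(c + A) u = c f`, so this is surjectivity of `c + A` in the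
  -- normalization that makes resolvents contractions.
  surj : ∀ c : ℝ, 0 < c → ∀ f, ∃ u, (u, c • (f - u)) ∈ A
  dense : ∀ f, (∀ x ∈ A, inner ℝ f x.1 = 0) → f = 0

/-- `J` is the normalized resolvent `c (c + A)⁻¹`. -/
def IsResolvent (A : Submodule ℝ (H × H)) (c : ℝ) (J : H →L[ℝ] H) : Prop :=
  ∀ f, (J f, c • (f - J f)) ∈ A

namespace IsNonnegSelfAdjoint

variable {A : Submodule ℝ (H × H)} {c d : ℝ} {J K : H →L[ℝ] H}

/-- The difference `w` of two solutions satisfies `A w = -c w`, so nonnegativity gives `-c ‖w‖² ≥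
0`. -/
theorem resolvent_unique (hA : IsNonnegSelfAdjoint A) (hc : 0 < c) {f u v : H}
    (hu : (u, c • (f - u)) ∈ A) (hv : (v, c • (f - v)) ∈ A) : u = v := by
  have h := hA.nonneg _ (A.sub_mem hu hv)
  have e : c • (f - u) - c • (f - v) = (-c) • (u - v) := by module
  simp only [Prod.mk_sub_mk, e, inner_smul_left, real_inner_self_eq_norm_sq] at h
  have : ‖u - v‖ ^ 2 ≤ 0 := by
    simp only [conj_trivial] at h
    nlinarith
  rw [← sub_eq_zero, ← norm_eq_zero]
  exact pow_eq_zero_iff two_ne_zero |>.1 (le_antisymm this (sq_nonneg _))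

theorem norm_resolvent_le (hA : IsNonnegSelfAdjoint A) (hc : 0 < c) {f u : H}
    (hu : (u, c • (f - u)) ∈ A) : ‖u‖ ≤ ‖f‖ := by
  have h := hA.nonneg _ hu
  simp only [inner_smul_left, inner_sub_left, real_inner_self_eq_norm_sq, conj_trivial] at h
  have h1 : 0 ≤ inner ℝ f u - ‖u‖ ^ 2 := nonneg_of_mul_nonneg_right h hc
  have h2 := real_inner_le_norm f u
  by_contra! h3
  nlinarith [norm_nonneg f, norm_nonneg u]

theorem exists_resolvent (hA : IsNonnegSelfAdjoint A) (hc : 0 < c) :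
    ∃ J : H →L[ℝ] H, IsResolvent A c J := by
  choose R hR using hA.surj c hc
  refine ⟨LinearMap.mkContinuous
    { toFun := R
      map_add' := fun x y => ?_
      map_smul' := fun r x => ?_ } 1 fun x => ?_, fun f => hR f⟩
  · refine hA.resolvent_unique hc (hR _) ?_
    have := A.add_mem (hR x) (hR y)
    rw [Prod.mk_add_mk] at this
    convert this using 2
    module
  · change R (r • x) = r • R x
    refine hA.resolvent_unique hc (hR _) ?_
    have := A.smul_mem r (hR x)
    rw [Prod.smul_mk] at this
    convert this using 2
    module
  · simpa using hA.norm_resolvent_le hc (hR x)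

theorem symm_resolvent (hA : IsNonnegSelfAdjoint A) (hc : 0 < c) (hJ : IsResolvent A c J)
    (f g : H) : inner ℝ (J f) g = inner ℝ f (J g) := by
  have h := hA.symm _ (hJ f) _ (hJ g)
  simp only [inner_smul_left, inner_smul_right, inner_sub_left, inner_sub_right,
    conj_trivial] at h
  have := mul_left_cancel₀ hc.ne' h
  linarith

/-- For `c ≠ d` the resolvent identity `d J + (c - d) J K = c K` is compared with the one where the
roles are exchanged. -/
theorem resolvent_commute (hA : IsNonnegSelfAdjoint A) (hc : 0 < c) (hd : 0 < d)
    (hJ : IsResolvent A c J) (hK : IsResolvent A d K) : Commute J K := by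
  have key : ∀ {c d : ℝ} {J K : H →L[ℝ] H}, 0 < c → IsResolvent A c J → IsResolvent A d K →
      ∀ f, d • J f + (c - d) • J (K f) = c • K f := by
    intro c d J K hc hJ hK f
    -- The argument of `J` is `c⁻¹ (c + A) (K f)`, computed from `A (K f) = d (f - K f)`.
    have h1 : J ((d / c) • f + ((c - d) / c) • K f) = K f := by
      refine hA.resolvent_unique hc (hJ _) ?_
      convert hK f using 2
      rw [smul_sub, smul_add, smul_smul, smul_smul, mul_div_cancel₀ _ hc.ne',
        mul_div_cancel₀ _ hc.ne']
      module
    rw [map_add, map_smul, map_smul] at h1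
    conv_rhs => rw [← h1, smul_add, smul_smul, smul_smul, mul_div_cancel₀ _ hc.ne',
      mul_div_cancel₀ _ hc.ne']
  rcases eq_or_ne c d with rfl | hcd
  · have : J = K := by
      ext f
      exact hA.resolvent_unique hc (hJ f) (hK f)
    exact this ▸ Commute.refl J
  · ext f
    have h1 := key hc hJ hK f
    have h2 := key hd hK hJ f
    have h3 : (c - d) • (J (K f) - K (J f)) = 0 := by
      have e1 : (c - d) • J (K f) = c • K f - d • J f := by rw [← h1]; abel
      have e2 : (d - c) • K (J f) = d • J f - c • K f := by rw [← h2]; abel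
      have e3 : (c - d) • K (J f) = -((d - c) • K (J f)) := by module
      rw [smul_sub, e3, e1, e2]
      abel
    have h4 := (smul_eq_zero.1 h3).resolve_left (sub_ne_zero.2 hcd)
    exact sub_eq_zero.1 h4

/-- On the domain, the bounded approximation `c (1 - J)` of `A` acts as `J A`. Convergence of the
approximations thus reduces to `J g → g`. -/
theorem smul_sub_resolvent (hA : IsNonnegSelfAdjoint A) (hc : 0 < c) (hJ : IsResolvent A c J)
    {f g : H} (hfg : (f, g) ∈ A) : c • (f - J f) = J g := by
  refine hA.resolvent_unique hc ?_ (hJ g)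
  have h := A.smul_mem c (A.sub_mem hfg (hJ f))
  rwa [Prod.mk_sub_mk, Prod.smul_mk] at h

theorem exists_mem_norm_sub_lt [CompleteSpace H] (hA : IsNonnegSelfAdjoint A) (f : H) {ε : ℝ}
    (hε : 0 < ε) : ∃ x ∈ A, ‖f - x.1‖ < ε := by
  set D : Submodule ℝ H := A.map (LinearMap.fst ℝ H H)
  have hD : D.topologicalClosure = ⊤ := by
    rw [Submodule.topologicalClosure_eq_top_iff, Submodule.eq_bot_iff]
    intro g hg
    refine hA.dense g fun x hx => ?_
    rw [real_inner_comm]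
    exact (Submodule.mem_orthogonal _ _).1 hg x.1 ⟨x, hx, rfl⟩
  have hf : f ∈ closure (D : Set H) := by
    rw [← Submodule.topologicalClosure_coe, hD]
    trivial
  obtain ⟨_, ⟨x, hx, rfl⟩, h⟩ := Metric.mem_closure_iff.1 hf ε hε
  exact ⟨x, hx, by simpa [dist_eq_norm] using h⟩

end IsNonnegSelfAdjoint

/-- The Yosida approximation `e^{-tc(1 - J)}` of the semigroup. -/
def yosida (J : H →L[ℝ] H) (c t : ℝ) : H →L[ℝ] H :=
  Real.exp (-(t * c)) • NormedSpace.exp (t • (c • J))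

variable {A : Submodule ℝ (H × H)} {c d s t : ℝ} {J K : H →L[ℝ] H}

/-- The approximate semigroup is a Poisson average, of mean `t c`, of the powers of `J`;
contractivity, symmetry and linear bounds pass from those powers to it. -/
theorem hasSum_yosida [CompleteSpace H] (J : H →L[ℝ] H) (c t : ℝ) (f : H) :
    HasSum (fun k : ℕ => (Real.exp (-(t * c)) * ((t * c) ^ k / k.factorial)) • (J ^ k) f)
      (yosida J c t f) := by
  have h := (NormedSpace.exp_series_hasSum_exp' (𝕂 := ℝ) (t • (c • J))).mapL
    (ContinuousLinearMap.apply ℝ H f)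
  convert h.const_smul (Real.exp (-(t * c))) using 1
  · ext k
    simp only [smul_smul, smul_pow, ContinuousLinearMap.apply_apply, _root_.smul_apply]
    ring_nf
  · rfl

theorem hasSum_exp_weights (x : ℝ) :
    HasSum (fun k : ℕ => Real.exp (-x) * (x ^ k / k.factorial)) 1 := by
  have h := (NormedSpace.expSeries_div_hasSum_exp x).mul_left (Real.exp (-x))
  rwa [← Real.exp_eq_exp_ℝ, ← Real.exp_add, neg_add_cancel, Real.exp_zero] at h

theorem yosida_le [CompleteSpace H] (hc : 0 ≤ c) (ht : 0 ≤ t) (l : H →L[ℝ] ℝ) {b : ℝ} {f : H}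
    (h : ∀ k, l ((J ^ k) f) ≤ b) : l (yosida J c t f) ≤ b := by
  have h1 := (hasSum_yosida J c t f).mapL l
  have h2 := (hasSum_exp_weights (t * c)).mul_right b
  rw [one_mul] at h2
  refine hasSum_le (fun k => ?_) h1 h2
  rw [map_smul, smul_eq_mul]
  exact mul_le_mul_of_nonneg_left (h k) (by positivity)

theorem norm_yosida_le [CompleteSpace H] (hc : 0 ≤ c) (ht : 0 ≤ t) (hJ : ∀ f, ‖J f‖ ≤ ‖f‖)
    (f : H) : ‖yosida J c t f‖ ≤ ‖f‖ := by
  have h2 := (hasSum_exp_weights (t * c)).mul_right ‖f‖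
  rw [one_mul] at h2
  have hk : ∀ k : ℕ, ‖(J ^ k) f‖ ≤ ‖f‖ := by
    intro k
    induction k with
    | zero => simp
    | succ k ih =>
      rw [pow_succ', mul_apply_eq_comp]
      exact (hJ _).trans ih
  refine (hasSum_yosida J c t f).norm_le_of_bounded h2 fun k => ?_
  rw [norm_smul, Real.norm_of_nonneg (by positivity)]
  exact mul_le_mul_of_nonneg_left (hk k) (by positivity)

theorem inner_yosida [CompleteSpace H] (hJ : ∀ f g, inner ℝ (J f) g = inner ℝ f (J g))
    (f g : H) : inner ℝ (yosida J c t f) g = inner ℝ f (yosida J c t g) := by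
  have hk : ∀ k : ℕ, ∀ f g, inner ℝ ((J ^ k) f) g = inner ℝ f ((J ^ k) g) := by
    intro k
    induction k with
    | zero => simp
    | succ k ih =>
      intro f g
      rw [pow_succ', mul_apply_eq_comp, hJ, ih, ← mul_apply_eq_comp,
        ← pow_succ]
      rw [pow_succ']
  have h1 := (hasSum_yosida J c t f).mapL (innerSL ℝ g)
  have h2 := (hasSum_yosida J c t g).mapL (innerSL ℝ f)
  rw [real_inner_comm]
  refine h1.unique ?_
  convert h2 using 2 with k
  · simp only [innerSL_apply_apply, inner_smul_right]
    rw [real_inner_comm, hk]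
  · rfl

theorem yosida_zero (J : H →L[ℝ] H) (c : ℝ) : yosida J c 0 = 1 := by
  simp [yosida, NormedSpace.exp_zero]

theorem yosida_add [CompleteSpace H] (J : H →L[ℝ] H) (c s t : ℝ) :
    yosida J c (s + t) = yosida J c s * yosida J c t := by
  let _ : NormedAlgebra ℚ (H →L[ℝ] H) := NormedAlgebra.restrictScalars ℚ ℝ (H →L[ℝ] H)
  have hcomm : Commute (s • (c • J)) (t • (c • J)) :=
    ((Commute.refl _).smul_left _).smul_right _
  rw [yosida, yosida, yosida, add_smul, NormedSpace.exp_add_of_commute hcomm, smul_mul_smul_comm,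
    ← Real.exp_add]
  ring_nf

theorem hasDerivAt_yosida [CompleteSpace H] (J : H →L[ℝ] H) (c t : ℝ) :
    HasDerivAt (yosida J c) (-(yosida J c t * (c • (1 - J)))) t := by
  have h1 : HasDerivAt (fun t : ℝ => Real.exp (-(t * c))) (Real.exp (-(t * c)) * (-c)) t := by
    have := ((hasDerivAt_id t).mul_const c).neg.exp
    simpa using this
  have h := h1.smul (hasDerivAt_exp_smul_const (𝕂 := ℝ) (c • J) t)
  have e : -(yosida J c t * (c • (1 - J))) =
      Real.exp (-(t * c)) • (NormedSpace.exp (t • c • J) * c • J) +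
        (Real.exp (-(t * c)) * -c) • NormedSpace.exp (t • c • J) := by
    simp only [yosida, mul_smul_comm, smul_mul_assoc, mul_sub, mul_one, smul_sub]
    module
  rw [e]
  exact h

theorem hasDerivAt_yosida_apply [CompleteSpace H] (J : H →L[ℝ] H) (c t : ℝ) (f : H) :
    HasDerivAt (fun s => yosida J c s f) (-(yosida J c t (c • (f - J f)))) t :=
  (ContinuousLinearMap.apply ℝ H f).hasFDerivAt.comp_hasDerivAt t (hasDerivAt_yosida J c t)

theorem norm_yosida_sub_self_le [CompleteSpace H] (hc : 0 ≤ c) (ht : 0 ≤ t)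
    (hJ : ∀ f, ‖J f‖ ≤ ‖f‖) (f : H) : ‖yosida J c t f - f‖ ≤ ‖c • (f - J f)‖ * t := by
  have h := norm_image_sub_le_of_norm_deriv_le_segment' (a := 0) (b := t)
    (f := fun s => yosida J c s f) (C := ‖c • (f - J f)‖)
    (fun x _ => (hasDerivAt_yosida_apply J c x f).hasDerivWithinAt)
    (fun x hx => by rw [norm_neg]; exact norm_yosida_le hc hx.1 hJ _) t ⟨ht, le_rfl⟩
  simpa [yosida_zero] using h

/-- Interpolate by `s ↦ e^{-(t-s) d (1-K)} e^{-s c (1-J)} f`. Since `J` and `K` commute, its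
derivative is a product of contractions applied to the difference of the two approximate generators
at `f`. -/
theorem norm_yosida_sub_yosida_le [CompleteSpace H] (hc : 0 ≤ c) (hd : 0 ≤ d) (ht : 0 ≤ t)
    (hJ : ∀ f, ‖J f‖ ≤ ‖f‖) (hK : ∀ f, ‖K f‖ ≤ ‖f‖) (hJK : Commute J K) (f : H) :
    ‖yosida J c t f - yosida K d t f‖ ≤ ‖c • (f - J f) - d • (f - K f)‖ * t := by
  set φ : ℝ → H := fun s => (yosida K d (t - s) * yosida J c s) f
  have hφ : ∀ s, HasDerivAt φ ((yosida K d (t - s) * yosida J c s)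
      (d • (f - K f) - c • (f - J f))) s := by
    intro s
    have h1 : HasDerivAt (fun s => yosida K d (t - s))
        (yosida K d (t - s) * (d • (1 - K))) s := by
      have := (hasDerivAt_yosida K d (t - s)).scomp s ((hasDerivAt_id s).const_sub t)
      simpa [Function.comp_def] using this
    have h2 := h1.mul (hasDerivAt_yosida J c s)
    have h3 := (ContinuousLinearMap.apply ℝ H f).hasFDerivAt.comp_hasDerivAt s h2
    have hcomm : Commute (d • (1 - K)) (yosida J c s) := by
      have : Commute K (yosida J c s) := by
        let _ : NormedAlgebra ℚ (H →L[ℝ] H) := NormedAlgebra.restrictScalars ℚ ℝ (H →L[ℝ] H)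
        have h : Commute K (s • (c • J)) := (hJK.symm.smul_right _).smul_right _
        exact (h.exp_right).smul_right _
      exact ((Commute.one_left _).sub_left this).smul_left _
    have e : yosida K d (t - s) * d • (1 - K) * yosida J c s +
        yosida K d (t - s) * -(yosida J c s * c • (1 - J)) =
        (yosida K d (t - s) * yosida J c s) * (d • (1 - K) - c • (1 - J)) := by
      rw [mul_assoc, hcomm.eq]
      noncomm_ring
    rw [e] at h3
    exact h3
  have h := norm_image_sub_le_of_norm_deriv_le_segment' (a := 0) (b := t) (f := φ)
    (C := ‖c • (f - J f) - d • (f - K f)‖)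
    (fun x _ => (hφ x).hasDerivWithinAt)
    (fun x hx => by
      rw [mul_apply_eq_comp, norm_sub_rev (c • (f - J f))]
      exact (norm_yosida_le hd (sub_nonneg.2 hx.2.le) hK _).trans
        (norm_yosida_le hc hx.1 hJ _)) t ⟨ht, le_rfl⟩
  simpa [φ, yosida_zero] using h

/-- A first-order expansion in `t` whose only dependence on `c` is through `‖J g - g‖`. As `g = A f`
need not lie in the domain, a nearby domain element `f'` is used to control how far the orbit of `g`
moves. -/
theorem norm_yosida_sub_add_le [CompleteSpace H] (hA : IsNonnegSelfAdjoint A) (hc : 0 < c)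
    (ht : 0 ≤ t) (hJ : IsResolvent A c J) {f g f' g' : H} (h : (f, g) ∈ A) (h' : (f', g') ∈ A) :
    ‖yosida J c t f - f + t • g‖ ≤ (‖J g - g‖ + 2 * ‖g - f'‖ + ‖g'‖ * t) * t := by
  have hJ1 : ∀ f, ‖J f‖ ≤ ‖f‖ := fun f => hA.norm_resolvent_le hc (hJ f)
  have h1 : ∀ s ∈ Ico 0 t, ‖-(yosida J c s (c • (f - J f))) + g‖ ≤
      ‖J g - g‖ + 2 * ‖g - f'‖ + ‖g'‖ * t := by
    intro s hs
    rw [hA.smul_sub_resolvent hc hJ h]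
    have e : -(yosida J c s (J g)) + g = -(yosida J c s (J g - g)) - yosida J c s (g - f') -
        (yosida J c s f' - f') + (g - f') := by
      rw [map_sub, map_sub]
      abel
    have h2 := norm_yosida_sub_self_le hc.le hs.1 hJ1 f'
    rw [hA.smul_sub_resolvent hc hJ h'] at h2
    have h3 := norm_yosida_le hc.le hs.1 hJ1 (J g - g)
    have h4 := norm_yosida_le hc.le hs.1 hJ1 (g - f')
    have h5 : ‖J g'‖ * s ≤ ‖g'‖ * t := mul_le_mul (hJ1 _) hs.2.le hs.1 (norm_nonneg _)
    rw [e]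
    calc _ ≤ ‖yosida J c s (J g - g)‖ + ‖yosida J c s (g - f')‖ + ‖yosida J c s f' - f'‖ +
          ‖g - f'‖ := by
          refine (norm_add_le _ _).trans ?_
          gcongr
          refine (norm_sub_le _ _).trans ?_
          gcongr
          refine (norm_sub_le _ _).trans ?_
          rw [norm_neg]
      _ ≤ _ := by linarith
  have h6 := norm_image_sub_le_of_norm_deriv_le_segment' (a := 0) (b := t)
    (f := fun s => yosida J c s f + s • g) (f' := fun s => -(yosida J c s (c • (f - J f))) + g)
    (fun x _ => by
      have := (hasDerivAt_yosida_apply J c x f).add ((hasDerivAt_id x).smul_const g)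
      rw [one_smul] at this
      exact this.hasDerivWithinAt)
    h1 t ⟨ht, le_rfl⟩
  simp only [yosida_zero, one_apply_eq_self, zero_smul, add_zero, sub_zero] at h6
  convert h6 using 2
  abel

end LinearRelation

/-! ### Generation of the semigroup by Yosida approximation -/

section Generation

variable {H : Type*} [NormedAddCommGroup H] [InnerProductSpace ℝ H]

theorem cauchySeq_of_norm_sub_le {F : Type*} [SeminormedAddCommGroup F] {u : ℕ → F}
    (h : ∀ ε > 0, ∃ v : ℕ → F, CauchySeq v ∧ ∀ n, ‖u n - v n‖ ≤ ε) : CauchySeq u := by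
  rw [Metric.cauchySeq_iff]
  intro ε hε
  obtain ⟨v, hv, huv⟩ := h (ε / 4) (by positivity)
  obtain ⟨N, hN⟩ := Metric.cauchySeq_iff.1 hv (ε / 4) (by positivity)
  refine ⟨N, fun m hm n hn => ?_⟩
  have h1 := huv m
  have h2 := huv n
  have h3 := hN m hm n hn
  rw [dist_eq_norm] at h3 ⊢
  have e : u m - u n = (u m - v m) + (v m - v n) - (u n - v n) := by abel
  rw [e]
  have := norm_sub_le ((u m - v m) + (v m - v n)) (u n - v n)
  have := norm_add_le (u m - v m) (v m - v n)
  linarith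

variable {A : Submodule ℝ (H × H)}

namespace IsNonnegSelfAdjoint

/-- On the domain `f - J f = c⁻¹ J (A f)` is `O (1 / c)`; density and contractivity do the rest. -/
theorem tendsto_resolvent [CompleteSpace H] (hA : IsNonnegSelfAdjoint A) {J : ℕ → H →L[ℝ] H}
    (hJ : ∀ n : ℕ, IsResolvent A (n + 1) (J n)) (f : H) :
    Tendsto (fun n => J n f) atTop (𝓝 f) := by
  rw [Metric.tendsto_atTop]
  intro ε hε
  obtain ⟨⟨x, g⟩, hx, hfx⟩ := hA.exists_mem_norm_sub_lt f (ε := ε / 3) (by positivity)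
  obtain ⟨N, hN⟩ := exists_nat_gt (‖g‖ / (ε / 3))
  refine ⟨N, fun n hn => ?_⟩
  have hn1 : (0 : ℝ) < n + 1 := by positivity
  have h1 := hA.smul_sub_resolvent hn1 (hJ n) hx
  have h2 := hA.norm_resolvent_le hn1 (hJ n g)
  rw [← h1, norm_smul, Real.norm_of_nonneg hn1.le] at h2
  have h3 : ‖x - J n x‖ < ε / 3 := by
    have : (N : ℝ) ≤ n := by exact_mod_cast hn
    rw [div_lt_iff₀ (by positivity)] at hN
    by_contra! h
    nlinarith
  have h4 := hA.norm_resolvent_le hn1 (hJ n (f - x))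
  have e : J n f - f = J n (f - x) - (x - J n x) - (f - x) := by
    rw [map_sub]
    abel
  rw [dist_eq_norm, e]
  have := norm_sub_le (J n (f - x) - (x - J n x)) (f - x)
  have := norm_sub_le (J n (f - x)) (x - J n x)
  linarith

/-- The semigroup of a nonnegative self-adjoint operator is the limit of its Yosida
approximations. -/
theorem exists_tendsto_yosida [CompleteSpace H] (hA : IsNonnegSelfAdjoint A)
    {J : ℕ → H →L[ℝ] H} (hJ : ∀ n : ℕ, IsResolvent A (n + 1) (J n)) {t : ℝ} (ht : 0 ≤ t) :
    ∃ T : H →L[ℝ] H, ∀ f, Tendsto (fun n : ℕ => yosida (J n) (n + 1) t f) atTop (𝓝 (T f)) := by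
  have hn1 : ∀ n : ℕ, (0 : ℝ) < n + 1 := fun n => by positivity
  have hJ1 : ∀ n f, ‖J n f‖ ≤ ‖f‖ := fun n f => hA.norm_resolvent_le (hn1 n) (hJ n f)
  have hU : ∀ (n : ℕ) f, ‖yosida (J n) (n + 1) t f‖ ≤ ‖f‖ := fun n f =>
    norm_yosida_le (hn1 n).le ht (hJ1 n) f
  have hdom : ∀ x ∈ A, CauchySeq (fun n : ℕ => yosida (J n) (n + 1) t x.1) := by
    intro x hx
    rw [Metric.cauchySeq_iff]
    intro ε hε
    obtain ⟨N, hN⟩ := Metric.cauchySeq_iff.1 (hA.tendsto_resolvent hJ x.2).cauchySeq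
      (ε / (t + 1)) (by positivity)
    refine ⟨N, fun m hm n hn => ?_⟩
    have h1 := hN m hm n hn
    have h2 := norm_yosida_sub_yosida_le (hn1 m).le (hn1 n).le ht (hJ1 m) (hJ1 n)
      (hA.resolvent_commute (hn1 m) (hn1 n) (hJ m) (hJ n)) x.1
    rw [hA.smul_sub_resolvent (hn1 m) (hJ m) hx, hA.smul_sub_resolvent (hn1 n) (hJ n) hx] at h2
    rw [dist_eq_norm] at h1 ⊢
    rw [lt_div_iff₀ (by positivity)] at h1
    nlinarith [norm_nonneg (J m x.2 - J n x.2)]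
  have hcau : ∀ f, CauchySeq (fun n : ℕ => yosida (J n) (n + 1) t f) := by
    intro f
    refine cauchySeq_of_norm_sub_le fun ε hε => ?_
    obtain ⟨x, hx, hfx⟩ := hA.exists_mem_norm_sub_lt f hε
    refine ⟨_, hdom x hx, fun n => ?_⟩
    rw [← map_sub]
    exact (hU n _).trans hfx.le
  choose T hT using fun f => cauchySeq_tendsto_of_complete (hcau f)
  refine ⟨LinearMap.mkContinuous
    { toFun := T
      map_add' := fun x y => tendsto_nhds_unique (hT (x + y)) ?_
      map_smul' := fun r x => tendsto_nhds_unique (hT (r • x)) ?_ } 1 fun x => ?_, hT⟩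
  · simpa using (hT x).add (hT y)
  · simpa using (hT x).const_smul r
  · rw [one_mul]
    exact le_of_tendsto (hT x).norm (Eventually.of_forall fun n => hU n x)

end IsNonnegSelfAdjoint

/-- `T` maps every set that is stable under the resolvents of `A` into each closed half-space
containing this set. -/
def PreservesStable (A : Submodule ℝ (H × H)) (T : H →L[ℝ] H) : Prop :=
  ∀ (C : Set H) (l : H →L[ℝ] ℝ) (b : ℝ),
    (∀ c : ℝ, 0 < c → ∀ f ∈ C, ∀ u, (u, c • (f - u)) ∈ A → u ∈ C) → (∀ g ∈ C, l g ≤ b) →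
    ∀ f ∈ C, l (T f) ≤ b

/-- The Hille–Yosida construction. Lines and half-spaces stable under all resolvents control the
semigroup because each Yosida approximation averages powers of a resolvent. -/
theorem exists_isFormSemigroup [CompleteSpace H] {E : H → ℝ≥0∞} (hA : IsNonnegSelfAdjoint A)
    (hE : ∀ u f, IsFormOperator E u f ↔ (u, f) ∈ A) :
    ∃ T : ℝ≥0 → H →L[ℝ] H, IsFormSemigroup E T ∧ ∀ t, PreservesStable A (T t) := by
  have hn1 : ∀ n : ℕ, (0 : ℝ) < n + 1 := fun n => by positivity
  choose J hJ using fun n : ℕ => hA.exists_resolvent (hn1 n)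
  have hJ1 : ∀ n f, ‖J n f‖ ≤ ‖f‖ := fun n f => hA.norm_resolvent_le (hn1 n) (hJ n f)
  choose T hT using fun t : ℝ≥0 => hA.exists_tendsto_yosida hJ t.coe_nonneg
  have hcontr : ∀ t f, ‖T t f‖ ≤ ‖f‖ := fun t f =>
    le_of_tendsto (hT t f).norm
      (Eventually.of_forall fun n => norm_yosida_le (hn1 n).le t.2 (hJ1 n) f)
  have hadd : ∀ s t, T (s + t) = (T s).comp (T t) := by
    intro s t
    ext f
    refine tendsto_nhds_unique (hT (s + t) f) ?_
    have h1 := hT s (T t f)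
    have h2 : Tendsto (fun n : ℕ => yosida (J n) (n + 1) s
        (yosida (J n) (n + 1) t f - T t f)) atTop (𝓝 0) := by
      refine squeeze_zero_norm (fun n => norm_yosida_le (hn1 n).le s.2 (hJ1 n) _) ?_
      rw [← tendsto_zero_iff_norm_tendsto_zero]
      simpa using (hT t f).sub_const (T t f)
    have h3 := h2.add h1
    rw [zero_add] at h3
    refine h3.congr fun n => ?_
    rw [← map_add, sub_add_cancel, NNReal.coe_add, yosida_add]
    rfl
  have hzero : T 0 = ContinuousLinearMap.id ℝ H := by
    ext f
    refine tendsto_nhds_unique (hT 0 f) ?_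
    simp [yosida_zero]
  have hest : ∀ (t : ℝ≥0), ∀ x ∈ A, ∀ y ∈ A,
      ‖T t x.1 - x.1 + (t : ℝ) • x.2‖ ≤ (2 * ‖x.2 - y.1‖ + ‖y.2‖ * t) * t := by
    intro t x hx y hy
    have h1 := (((hT t x.1).sub_const x.1).add_const ((t : ℝ) • x.2)).norm
    have h2 := ((((((hA.tendsto_resolvent hJ x.2).sub_const x.2).norm).add_const
      (2 * ‖x.2 - y.1‖)).add_const (‖y.2‖ * t)).mul_const (t : ℝ))
    rw [sub_self, norm_zero, zero_add] at h2
    exact le_of_tendsto_of_tendsto' h1 h2 fun n =>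
      norm_yosida_sub_add_le hA (hn1 n) t.2 (hJ n) hx hy
  have hgen : ∀ x ∈ A, Tendsto (fun t : ℝ≥0 => (t : ℝ)⁻¹ • (x.1 - T t x.1)) (𝓝[>] 0)
      (𝓝 x.2) := by
    intro x hx
    rw [Metric.tendsto_nhds]
    intro ε hε
    obtain ⟨y, hy, hxy⟩ := hA.exists_mem_norm_sub_lt x.2 (ε := ε / 4) (by positivity)
    have hlim : Tendsto (fun t : ℝ≥0 => ‖y.2‖ * (t : ℝ)) (𝓝[>] 0) (𝓝 0) := by
      have : Continuous fun t : ℝ≥0 => ‖y.2‖ * (t : ℝ) := by fun_prop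
      simpa using (this.tendsto 0).mono_left (nhdsWithin_le_nhds (s := Ioi 0))
    filter_upwards [self_mem_nhdsWithin, hlim.eventually_lt_const (u := ε / 2)
      (by positivity)] with t ht hty
    have ht' : (0 : ℝ) < t := NNReal.coe_pos.2 ht
    have h1 := hest t x hx y hy
    have e : (t : ℝ)⁻¹ • (x.1 - T t x.1) - x.2 =
        -((t : ℝ)⁻¹ • (T t x.1 - x.1 + (t : ℝ) • x.2)) := by
      rw [smul_add, smul_smul, inv_mul_cancel₀ ht'.ne', one_smul, smul_sub, smul_sub]
      abel
    rw [dist_eq_norm, e, norm_neg, norm_smul, norm_inv, Real.norm_of_nonneg ht'.le,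
      inv_mul_lt_iff₀ ht']
    refine h1.trans_lt ?_
    rw [mul_comm]
    exact mul_lt_mul_of_pos_left (by linarith) ht'
  refine ⟨T, ⟨hzero, hadd, ?_, hcontr, ?_, ?_⟩, ?_⟩
  · have hdom : ∀ x ∈ A, Continuous fun t => T t x.1 := by
      intro x hx
      have hlip : ∀ s t : ℝ≥0, ‖T (s + t) x.1 - T s x.1‖ ≤ ‖x.2‖ * t := by
        intro s t
        have h0 : ‖T t x.1 - x.1‖ ≤ ‖x.2‖ * t := by
          refine le_of_tendsto ((hT t x.1).sub_const x.1).norm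
            (Eventually.of_forall fun n => ?_)
          refine (norm_yosida_sub_self_le (hn1 n).le t.2 (hJ1 n) x.1).trans ?_
          rw [hA.smul_sub_resolvent (hn1 n) (hJ n) hx]
          exact mul_le_mul_of_nonneg_right (hJ1 n _) t.2
        rw [hadd, ContinuousLinearMap.comp_apply, ← map_sub]
        exact (hcontr s _).trans h0
      refine (LipschitzWith.of_dist_le_mul (K := ‖x.2‖₊) fun s t => ?_).continuous
      rcases le_total s t with h | h
      · have := hlip s (t - s)
        rwa [add_tsub_cancel_of_le h, NNReal.coe_sub h, ← dist_eq_norm, dist_comm,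
          ← abs_of_nonneg (sub_nonneg.2 (NNReal.coe_le_coe.2 h)), ← Real.dist_eq, dist_comm (t : ℝ),
          ← coe_nnnorm] at this
      · have := hlip t (s - t)
        rwa [add_tsub_cancel_of_le h, NNReal.coe_sub h, ← dist_eq_norm,
          ← abs_of_nonneg (sub_nonneg.2 (NNReal.coe_le_coe.2 h)), ← Real.dist_eq,
          ← coe_nnnorm] at this
    intro f
    refine continuous_iff_continuousAt.2 fun s => Metric.tendsto_nhds.2 fun ε hε => ?_
    obtain ⟨x, hx, hfx⟩ := hA.exists_mem_norm_sub_lt f (ε := ε / 3) (by positivity)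
    filter_upwards [Metric.tendsto_nhds.1 ((hdom x hx).tendsto s) (ε / 3) (by positivity)] with t ht
    have h1 := hcontr t (f - x.1)
    have h2 := hcontr s (f - x.1)
    rw [dist_eq_norm] at ht ⊢
    have e : T t f - T s f = T t (f - x.1) + (T t x.1 - T s x.1) - T s (f - x.1) := by
      rw [map_sub, map_sub]
      abel
    rw [e]
    have := norm_sub_le (T t (f - x.1) + (T t x.1 - T s x.1)) (T s (f - x.1))
    have := norm_add_le (T t (f - x.1)) (T t x.1 - T s x.1)
    linarith
  · intro t f g
    have h1 := ((hT t f).inner (tendsto_const_nhds (x := g)) : Tendsto _ _ (𝓝 (inner ℝ _ _)))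
    have h2 := ((tendsto_const_nhds (x := f)).inner (hT t g) : Tendsto _ _ (𝓝 (inner ℝ _ _)))
    refine tendsto_nhds_unique h1 (h2.congr fun n => ?_)
    exact (inner_yosida (hA.symm_resolvent (hn1 n) (hJ n)) f g).symm
  · intro u f
    rw [hE]
    refine ⟨fun h => ?_, fun h => hgen _ h⟩
    -- Maximality: the negative of the generator is monotone and extends `A`. Solving `v + A v = u +
    -- f` within `A` and pairing the difference with `u - v` forces `u = v`.
    obtain ⟨v, hv⟩ := hA.surj 1 one_pos (u + f)
    have h1 := h.sub (hgen _ hv)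
    have h2 : 0 ≤ inner ℝ (f - (1 : ℝ) • (u + f - v)) (u - v) := by
      refine ge_of_tendsto (h1.inner (tendsto_const_nhds (x := u - v)))
        (Eventually.of_forall fun t => ?_)
      rw [← smul_sub, inner_smul_left]
      refine mul_nonneg (by simp) ?_
      have h3 := real_inner_le_norm (T t (u - v)) (u - v)
      have h4 := hcontr t (u - v)
      have e : u - T t u - (v - T t v) = (u - v) - T t (u - v) := by
        rw [map_sub]
        abel
      rw [e, inner_sub_left, real_inner_self_eq_norm_sq]
      nlinarith [norm_nonneg (u - v)]
    have e : f - (1 : ℝ) • (u + f - v) = -(u - v) := by module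
    rw [e, inner_neg_left, real_inner_self_eq_norm_sq] at h2
    have h5 : u - v = 0 := by
      rw [← norm_eq_zero]
      exact pow_eq_zero_iff two_ne_zero |>.1 (le_antisymm (by linarith) (sq_nonneg _))
    rw [sub_eq_zero] at h5
    subst h5
    simpa using hv
  · intro t C l b hC hl f hf
    refine le_of_tendsto ((l.continuous.tendsto _).comp (hT t f)) (Eventually.of_forall fun n => ?_)
    refine yosida_le (hn1 n).le t.2 l fun k => hl _ ?_
    induction k with
    | zero => simpa using hf
    | succ k ih =>
      rw [pow_succ', mul_apply_eq_comp]
      exact hC _ (hn1 n) _ ih _ (hJ n _)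

namespace IsFormSemigroup

variable {E : H → ℝ≥0∞} {T S : ℝ≥0 → H →L[ℝ] H}

theorem apply_mem (hT : IsFormSemigroup E T) {u f : H} (h : IsFormOperator E u f) (t : ℝ≥0) :
    IsFormOperator E (T t u) (T t f) := by
  rw [← hT.generator] at h ⊢
  refine (((T t).continuous.tendsto f).comp h).congr fun s => ?_
  have : T t (T s u) = T s (T t u) := by
    rw [← ContinuousLinearMap.comp_apply, ← ContinuousLinearMap.comp_apply, ← hT.add, ← hT.add,
      add_comm]
  simp [this]

/-- The right derivative of an orbit of the semigroup. -/
theorem hasDerivWithinAt (hT : IsFormSemigroup E T) {u f : H} (h : IsFormOperator E u f) {r : ℝ}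
    (hr : 0 ≤ r) :
    HasDerivWithinAt (fun r : ℝ => T r.toNNReal u) (-(T r.toNNReal f)) (Ioi r) r := by
  have h1 := (hT.generator _ _).2 (hT.apply_mem h r.toNNReal)
  have h2 : Tendsto (fun s : ℝ => (s - r).toNNReal) (𝓝[>] r) (𝓝[>] 0) := by
    refine tendsto_nhdsWithin_iff.2 ⟨?_, ?_⟩
    · have : Continuous fun s : ℝ => (s - r).toNNReal := by fun_prop
      simpa using (this.tendsto r).mono_left (nhdsWithin_le_nhds (s := Ioi r))
    · filter_upwards [self_mem_nhdsWithin] with s hs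
      exact Real.toNNReal_pos.2 (sub_pos.2 hs)
  rw [hasDerivWithinAt_iff_tendsto_slope' (by simp)]
  refine (h1.comp h2).neg.congr' ?_
  filter_upwards [self_mem_nhdsWithin] with s hs
  have hs' : 0 ≤ s - r := (sub_pos.2 hs).le
  have e : T s.toNNReal u = T (s - r).toNNReal (T r.toNNReal u) := by
    rw [← ContinuousLinearMap.comp_apply, ← hT.add, ← Real.toNNReal_add hs' hr, sub_add_cancel]
  rw [slope_def_module, e]
  simp only [Function.comp_apply, Real.coe_toNNReal _ hs']
  rw [← smul_neg, neg_sub]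

theorem continuous_real (hT : IsFormSemigroup E T) (u : H) :
    Continuous fun r : ℝ => T r.toNNReal u :=
  (hT.continuous u).comp continuous_real_toNNReal

/-- Both orbits of a domain element stay in the domain, so by nonnegativity of `A` the squared
distance between them has nonpositive right derivative. Density finishes. -/
theorem unique [CompleteSpace H] (hA : IsNonnegSelfAdjoint A)
    (hE : ∀ u f, IsFormOperator E u f ↔ (u, f) ∈ A)
    (hT : IsFormSemigroup E T) (hS : IsFormSemigroup E S) : T = S := by
  have hdom : ∀ x ∈ A, ∀ t, T t x.1 = S t x.1 := by
    intro x hx t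
    have hx' := (hE x.1 x.2).2 hx
    set φ : ℝ → H := fun r => T r.toNNReal x.1 - S r.toNNReal x.1
    have hφ : ∀ r, 0 ≤ r → HasDerivWithinAt (fun r => inner ℝ (φ r) (φ r))
        (-2 * inner ℝ (T r.toNNReal x.2 - S r.toNNReal x.2) (φ r)) (Ici r) r := by
      intro r hr
      have h1 : HasDerivWithinAt φ (-(T r.toNNReal x.2) - -(S r.toNNReal x.2)) (Ici r) r :=
        ((hT.hasDerivWithinAt hx' hr).sub (hS.hasDerivWithinAt hx' hr)).Ici_of_Ioi
      have e : -2 * inner ℝ (T r.toNNReal x.2 - S r.toNNReal x.2) (φ r) =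
          inner ℝ (φ r) (-(T r.toNNReal x.2) - -(S r.toNNReal x.2)) +
            inner ℝ (-(T r.toNNReal x.2) - -(S r.toNNReal x.2)) (φ r) := by
        rw [← neg_sub', inner_neg_left, inner_neg_right, real_inner_comm (φ r)]
        ring
      rw [e]
      exact h1.inner ℝ h1
    have h2 := image_le_of_deriv_right_le_deriv_boundary (a := 0) (b := (t : ℝ))
      (f := fun r => inner ℝ (φ r) (φ r)) (B := fun _ => 0) (B' := fun _ => 0)
      (by
        have : Continuous φ := (hT.continuous_real _).sub (hS.continuous_real _)
        exact (this.inner this).continuousOn)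
      (fun r hr => hφ r hr.1) (by simp [φ, hT.zero, hS.zero]) continuousOn_const
      (fun r _ => hasDerivWithinAt_const _ _ _)
      (fun r hr => by
        have h3 := A.sub_mem ((hE _ _).1 (hT.apply_mem hx' r.toNNReal))
          ((hE _ _).1 (hS.apply_mem hx' r.toNNReal))
        have := hA.nonneg _ h3
        simp only [Prod.mk_sub_mk] at this
        simp only [φ]
        linarith) (x := (t : ℝ)) ⟨t.2, le_rfl⟩
    simp only [φ, Real.toNNReal_coe] at h2
    exact sub_eq_zero.1 (real_inner_self_nonpos.1 h2)
  funext t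
  ext f
  by_contra hne
  have hpos : 0 < ‖T t f - S t f‖ := norm_pos_iff.2 (sub_ne_zero.2 hne)
  obtain ⟨x, hx, hfx⟩ := hA.exists_mem_norm_sub_lt f (ε := ‖T t f - S t f‖ / 2) (by positivity)
  have e : T t f - S t f = T t (f - x.1) - S t (f - x.1) := by
    rw [map_sub, map_sub, hdom x hx t]
    abel
  have h1 := norm_sub_le (T t (f - x.1)) (S t (f - x.1))
  have h2 := hT.contraction t (f - x.1)
  have h3 := hS.contraction t (f - x.1)
  rw [← e] at h1
  linarith

end IsFormSemigroup

end Generation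

/-! ### The operator of a closed form -/

section FormGraph

variable {H K : Type*} [NormedAddCommGroup H] [InnerProductSpace ℝ H]
  [NormedAddCommGroup K] [InnerProductSpace ℝ K]

/-- The quadratic form `E` is `u ↦ ‖d u‖²`, where `d` is the closed operator with graph `Γ`. -/
structure IsFormGraph (E : H → ℝ≥0∞) (Γ : Submodule ℝ (WithLp 2 (H × K))) : Prop where
  isClosed : IsClosed (Γ : Set (WithLp 2 (H × K)))
  eq_norm_sq : ∀ x ∈ Γ, E x.fst = ENNReal.ofReal (‖x.snd‖ ^ 2)
  exists_mem : ∀ u, E u ≠ ∞ → ∃ x ∈ Γ, x.fst = u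

/-- The graph of the operator associated with the form with graph `Γ`. -/
def formOperator (Γ : Submodule ℝ (WithLp 2 (H × K))) : Submodule ℝ (H × H) where
  carrier := {p | ∃ x ∈ Γ, x.fst = p.1 ∧ ∀ y ∈ Γ, inner ℝ x.snd y.snd = inner ℝ p.2 y.fst}
  zero_mem' := ⟨0, Γ.zero_mem, by simp, by simp⟩
  add_mem' := by
    rintro p q ⟨x, hx, hxp, hp⟩ ⟨y, hy, hyq, hq⟩
    refine ⟨x + y, Γ.add_mem hx hy, by simp [hxp, hyq], fun z hz => ?_⟩
    simp [inner_add_left, hp z hz, hq z hz]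
  smul_mem' := by
    rintro r p ⟨x, hx, hxp, hp⟩
    refine ⟨r • x, Γ.smul_mem r hx, by simp [hxp], fun z hz => ?_⟩
    simp [inner_smul_left, hp z hz]

theorem mem_formOperator {Γ : Submodule ℝ (WithLp 2 (H × K))} {u f : H} :
    (u, f) ∈ formOperator Γ ↔
      ∃ x ∈ Γ, x.fst = u ∧ ∀ y ∈ Γ, inner ℝ x.snd y.snd = inner ℝ f y.fst :=
  Iff.rfl

namespace IsFormGraph

variable {E : H → ℝ≥0∞} {Γ : Submodule ℝ (WithLp 2 (H × K))}

theorem ne_top (hΓ : IsFormGraph E Γ) {x : WithLp 2 (H × K)} (hx : x ∈ Γ) : E x.fst ≠ ∞ := by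
  rw [hΓ.eq_norm_sq x hx]
  exact ENNReal.ofReal_ne_top

theorem polarization_eq (hΓ : IsFormGraph E Γ) {x y : WithLp 2 (H × K)} (hx : x ∈ Γ)
    (hy : y ∈ Γ) : polarization E x.fst y.fst = inner ℝ x.snd y.snd := by
  have h1 := hΓ.eq_norm_sq _ (Γ.add_mem hx hy)
  have h2 := hΓ.eq_norm_sq _ (Γ.sub_mem hx hy)
  simp only [WithLp.add_fst, WithLp.add_snd, WithLp.sub_fst, WithLp.sub_snd] at h1 h2
  rw [polarization, h1, h2, ENNReal.toReal_ofReal (sq_nonneg _),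
    ENNReal.toReal_ofReal (sq_nonneg _), norm_add_sq_real, norm_sub_sq_real]
  ring

theorem isFormOperator_iff (hΓ : IsFormGraph E Γ) (u f : H) :
    IsFormOperator E u f ↔ (u, f) ∈ formOperator Γ := by
  rw [mem_formOperator]
  constructor
  · rintro ⟨hu, h⟩
    obtain ⟨x, hx, rfl⟩ := hΓ.exists_mem u hu
    exact ⟨x, hx, rfl, fun y hy => (hΓ.polarization_eq hx hy).symm.trans (h _ (hΓ.ne_top hy))⟩
  · rintro ⟨x, hx, rfl, h⟩
    refine ⟨hΓ.ne_top hx, fun v hv => ?_⟩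
    obtain ⟨y, hy, rfl⟩ := hΓ.exists_mem v hv
    rw [hΓ.polarization_eq hx hy, h y hy]

/-- The resolvent minimises `‖f - u‖² + c⁻¹ ‖d u‖²`. This is the orthogonal projection of `(f, 0)`
onto the closed graph with its second coordinate divided by `√c`. -/
theorem exists_resolvent [CompleteSpace H] [CompleteSpace K] (hΓ : IsFormGraph E Γ) {c : ℝ}
    (hc : 0 < c) (f : H) : ∃ u, (u, c • (f - u)) ∈ formOperator Γ := by
  set r := √c
  have hr : 0 < r := Real.sqrt_pos.2 hc
  let M : WithLp 2 (H × K) →ₗ[ℝ] WithLp 2 (H × K) :=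
    { toFun := fun x => WithLp.toLp 2 (x.fst, r • x.snd)
      map_add' := fun x y => by apply WithLp.ofLp_injective; ext <;> simp
      map_smul' := fun s x => by apply WithLp.ofLp_injective; ext <;> simp [smul_comm r s] }
  have hM : Continuous M := by
    refine (WithLp.prod_continuous_toLp 2 H K).comp ?_
    have := WithLp.prod_continuous_ofLp 2 H K
    exact (continuous_fst.comp this).prodMk ((continuous_snd.comp this).const_smul r)
  set Δ := Γ.comap M
  have hΔ : IsClosed (Δ : Set (WithLp 2 (H × K))) := hΓ.isClosed.preimage hM
  have : CompleteSpace Δ := hΔ.completeSpace_coe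
  set p : WithLp 2 (H × K) := WithLp.toLp 2 (f, 0)
  set q := Δ.starProjection p
  have hq : M q ∈ Γ := Δ.starProjection_apply_mem p
  refine ⟨q.fst, M q, hq, rfl, fun y hy => ?_⟩
  have hy' : WithLp.toLp 2 (y.fst, r⁻¹ • y.snd) ∈ Δ := by
    change M _ ∈ Γ
    have : M (WithLp.toLp 2 (y.fst, r⁻¹ • y.snd)) = y := by
      apply WithLp.ofLp_injective
      ext <;> simp [M, smul_smul, mul_inv_cancel₀ hr.ne']
    rwa [this]
  have h := Δ.starProjection_inner_eq_zero p _ hy'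
  rw [WithLp.prod_inner_apply] at h
  have h1 : inner ℝ (f - q.fst) y.fst + inner ℝ (-q.snd) (r⁻¹ • y.snd) = 0 := by
    simpa [p, q] using h
  rw [inner_neg_left, inner_smul_right] at h1
  have h2 : inner ℝ (M q).snd y.snd = r * inner ℝ q.snd y.snd := by
    simp [M, inner_smul_left]
  rw [h2, inner_smul_left, conj_trivial]
  have h3 : inner ℝ (f - q.fst) y.fst = r⁻¹ * inner ℝ q.snd y.snd := by linarith
  rw [h3, ← mul_assoc]
  congr 1
  rw [← Real.mul_self_sqrt hc.le, mul_assoc]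
  change r = r * (r * r⁻¹)
  rw [mul_inv_cancel₀ hr.ne', mul_one]

theorem isNonnegSelfAdjoint [CompleteSpace H] [CompleteSpace K] (hΓ : IsFormGraph E Γ)
    (hdense : ∀ f, (∀ x ∈ formOperator Γ, inner ℝ f x.1 = 0) → f = 0) :
    IsNonnegSelfAdjoint (formOperator Γ) where
  symm := by
    rintro ⟨u, f⟩ ⟨x, hx, rfl, h⟩ ⟨v, g⟩ ⟨y, hy, rfl, h'⟩
    rw [real_inner_comm, ← h' x hx, real_inner_comm, h y hy]
  nonneg := by
    rintro ⟨u, f⟩ ⟨x, hx, rfl, h⟩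
    rw [← h x hx]
    exact real_inner_self_nonneg
  surj := fun _ hc f => hΓ.exists_resolvent hc f
  dense := hdense

/-- The resolvent is the unique minimizer of `E v + c ‖f - v‖²`. -/
theorem eq_of_le (hΓ : IsFormGraph E Γ) {c : ℝ} (hc : 0 < c) {u v f : H}
    (hu : (u, c • (f - u)) ∈ formOperator Γ) (hE : E v ≤ E u) (hv : ‖f - v‖ ≤ ‖f - u‖) :
    v = u := by
  obtain ⟨x, hx, rfl, h⟩ := mem_formOperator.1 hu
  obtain ⟨y, hy, rfl⟩ := hΓ.exists_mem v (ne_top_of_le_ne_top (hΓ.ne_top hx) hE)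
  rw [hΓ.eq_norm_sq x hx, hΓ.eq_norm_sq y hy, ENNReal.ofReal_le_ofReal_iff (sq_nonneg _)] at hE
  have h1 := h _ (Γ.sub_mem hy hx)
  rw [WithLp.sub_snd, WithLp.sub_fst, inner_smul_left, conj_trivial] at h1
  have h2 := norm_add_sq_real x.snd (y.snd - x.snd)
  have h3 := norm_sub_sq_real (f - x.fst) (y.fst - x.fst)
  rw [add_sub_cancel] at h2
  rw [sub_sub_sub_cancel_right] at h3
  have h4 : ‖f - y.fst‖ ^ 2 ≤ ‖f - x.fst‖ ^ 2 := pow_le_pow_left₀ (norm_nonneg _) hv 2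
  have h5 : c * ‖y.fst - x.fst‖ ^ 2 ≤ 0 := by
    have := mul_le_mul_of_nonneg_left h4 hc.le
    rw [h3] at this
    nlinarith [sq_nonneg ‖y.snd - x.snd‖]
  have h6 : ‖y.fst - x.fst‖ ^ 2 ≤ 0 := by
    by_contra! h
    nlinarith
  rw [← sub_eq_zero, ← norm_eq_zero]
  exact pow_eq_zero_iff two_ne_zero |>.1 (le_antisymm h6 (sq_nonneg _))

end IsFormGraph

end FormGraph

/-! ### Square integrable functions on the positive integers -/

section Discrete

variable {a : ℕ+ → ℝ}

theorem ae_discreteMeasure_iff (ha : ∀ k, 0 < a k) {p : ℕ+ → Prop} :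
    (∀ᵐ k ∂discreteMeasure a, p k) ↔ ∀ k, p k := by
  refine ⟨fun h k => ?_, fun h => Eventually.of_forall h⟩
  by_contra hk
  have h1 : discreteMeasure a {k | ¬ p k} = 0 := h
  have h2 : discreteMeasure a {k} = 0 :=
    measure_mono_null (by simpa using hk) h1
  rw [discreteMeasure, Measure.sum_apply _ (MeasurableSet.singleton k), ENNReal.tsum_eq_zero] at h2
  have := h2 k
  simp [(ha k).not_ge] at this

theorem lintegral_discreteMeasure (a : ℕ+ → ℝ) (f : ℕ+ → ℝ≥0∞) :
    ∫⁻ k, f k ∂discreteMeasure a = ∑' k, ENNReal.ofReal (a k) * f k := by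
  rw [discreteMeasure, lintegral_sum_measure]
  simp [lintegral_smul_measure, lintegral_dirac]

theorem memLp_discreteMeasure_iff (ha : ∀ k, 0 < a k) {f : ℕ+ → ℝ} :
    MemLp f 2 (discreteMeasure a) ↔ Summable fun k => a k * f k ^ 2 := by
  have hf : AEStronglyMeasurable f (discreteMeasure a) :=
    (measurable_of_countable f).aestronglyMeasurable
  rw [memLp_two_iff_integrable_sq hf, Integrable, and_iff_right (by exact hf.pow 2),
    hasFiniteIntegral_iff_ofReal (Eventually.of_forall fun k => sq_nonneg _),
    lintegral_discreteMeasure]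
  have e : ∀ k, ENNReal.ofReal (a k) * ENNReal.ofReal (f k ^ 2) =
      ENNReal.ofReal (a k * f k ^ 2) := fun k => (ENNReal.ofReal_mul (ha k).le).symm
  have h0 : ∀ k, 0 ≤ a k * f k ^ 2 := fun k => mul_nonneg (ha k).le (sq_nonneg _)
  simp_rw [e]
  constructor
  · intro h
    have h1 := ENNReal.summable_toReal h.ne
    exact h1.congr fun k => ENNReal.toReal_ofReal (h0 k)
  · intro h
    rw [← ENNReal.ofReal_tsum_of_nonneg h0 h]
    exact ENNReal.ofReal_lt_top

theorem hasSum_inner_discreteMeasure (ha : ∀ k, 0 < a k) (f g : Lp ℝ 2 (discreteMeasure a)) :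
    HasSum (fun k => a k * (f k * g k)) (inner ℝ f g) := by
  rw [L2.inner_def]
  have h1 := L2.integrable_inner (𝕜 := ℝ) f g
  have h2 := hasSum_integral_measure (μ := fun k => ENNReal.ofReal (a k) • Measure.dirac k) h1
  refine h2.congr_fun fun k => ?_
  rw [integral_smul_measure, integral_dirac, ENNReal.toReal_ofReal (ha k).le, smul_eq_mul]
  simp [mul_comm]

theorem hasSum_norm_sq_discreteMeasure (ha : ∀ k, 0 < a k) (f : Lp ℝ 2 (discreteMeasure a)) :
    HasSum (fun k => a k * f k ^ 2) (‖f‖ ^ 2) := by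
  have h := hasSum_inner_discreteMeasure ha f f
  rw [real_inner_self_eq_norm_sq] at h
  simpa only [sq] using h

theorem discrete_add_apply (ha : ∀ k, 0 < a k) (f g : Lp ℝ 2 (discreteMeasure a)) (k : ℕ+) :
    (f + g) k = f k + g k :=
  (ae_discreteMeasure_iff ha).1 (Lp.coeFn_add f g) k

theorem discrete_sub_apply (ha : ∀ k, 0 < a k) (f g : Lp ℝ 2 (discreteMeasure a)) (k : ℕ+) :
    (f - g) k = f k - g k :=
  (ae_discreteMeasure_iff ha).1 (Lp.coeFn_sub f g) k

theorem discrete_smul_apply (ha : ∀ k, 0 < a k) (r : ℝ) (f : Lp ℝ 2 (discreteMeasure a))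
    (k : ℕ+) : (r • f) k = r * f k :=
  (ae_discreteMeasure_iff ha).1 (Lp.coeFn_smul r f) k

theorem discrete_zero_apply (ha : ∀ k, 0 < a k) (k : ℕ+) :
    (0 : Lp ℝ 2 (discreteMeasure a)) k = 0 :=
  (ae_discreteMeasure_iff ha).1 (Lp.coeFn_zero ℝ 2 (discreteMeasure a)) k

theorem discrete_toLp_apply (ha : ∀ k, 0 < a k) {f : ℕ+ → ℝ}
    (hf : MemLp f 2 (discreteMeasure a)) (k : ℕ+) : hf.toLp f k = f k :=
  (ae_discreteMeasure_iff ha).1 hf.coeFn_toLp k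

theorem discrete_ext (ha : ∀ k, 0 < a k) {f g : Lp ℝ 2 (discreteMeasure a)}
    (h : ∀ k, f k = g k) : f = g :=
  Lp.ext ((ae_discreteMeasure_iff ha).2 h)

theorem discrete_le_iff (ha : ∀ k, 0 < a k) {f g : Lp ℝ 2 (discreteMeasure a)} :
    f ≤ g ↔ ∀ k, f k ≤ g k := by
  rw [← Lp.coeFn_le, EventuallyLE, ae_discreteMeasure_iff ha]

theorem discrete_nonneg_iff (ha : ∀ k, 0 < a k) {f : Lp ℝ 2 (discreteMeasure a)} :
    0 ≤ f ↔ ∀ k, 0 ≤ f k := by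
  simp_rw [discrete_le_iff ha, discrete_zero_apply ha]

theorem exists_discrete_eq (ha : ∀ k, 0 < a k) {f : ℕ+ → ℝ}
    (hf : Summable fun k => a k * f k ^ 2) :
    ∃ g : Lp ℝ 2 (discreteMeasure a), ∀ k, g k = f k :=
  ⟨((memLp_discreteMeasure_iff ha).2 hf).toLp f, discrete_toLp_apply ha _⟩

theorem exists_discrete_eq_of_finite (ha : ∀ k, 0 < a k) {f : ℕ+ → ℝ} (s : Finset ℕ+)
    (hf : ∀ k ∉ s, f k = 0) : ∃ g : Lp ℝ 2 (discreteMeasure a), ∀ k, g k = f k :=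
  exists_discrete_eq ha (summable_of_ne_finset_zero (s := s) fun k hk => by simp [hf k hk])

/-- The evaluation functional at `k`. -/
theorem exists_eval (ha : ∀ k, 0 < a k) (k : ℕ+) :
    ∃ l : Lp ℝ 2 (discreteMeasure a) →L[ℝ] ℝ, ∀ f, l f = f k := by
  obtain ⟨d, hd⟩ := exists_discrete_eq_of_finite ha (f := Pi.single k 1) {k} fun j hj => by
    simp at hj
    simp [hj]
  refine ⟨(a k)⁻¹ • innerSL ℝ d, fun f => ?_⟩
  have h1 := hasSum_inner_discreteMeasure ha d f
  have h2 : HasSum (fun j => a j * (d j * f j)) (a k * (d k * f k)) :=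
    hasSum_single k fun j hj => by simp [hd, hj]
  have h3 := h1.unique h2
  rw [hd, Pi.single_eq_same, one_mul] at h3
  change (a k)⁻¹ * inner ℝ d f = f k
  rw [h3, inv_mul_cancel_left₀ (ha k).ne']

theorem tendsto_discrete_apply (ha : ∀ k, 0 < a k) {ι : Type*} {l : Filter ι}
    {x : ι → Lp ℝ 2 (discreteMeasure a)} {y : Lp ℝ 2 (discreteMeasure a)}
    (h : ∀ z, Tendsto (fun i => inner ℝ (x i) z) l (𝓝 (inner ℝ y z))) (k : ℕ+) :
    Tendsto (fun i => x i k) l (𝓝 (y k)) := by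
  obtain ⟨e, he⟩ := exists_eval ha k
  have h1 := h ((InnerProductSpace.toDual ℝ _).symm e)
  have h2 : ∀ f, inner ℝ f ((InnerProductSpace.toDual ℝ _).symm e) = f k := fun f => by
    rw [real_inner_comm, InnerProductSpace.toDual_symm_apply, he]
  simpa only [h2] using h1

theorem norm_sub_le_of_forall_abs_le (ha : ∀ k, 0 < a k) {f g h : Lp ℝ 2 (discreteMeasure a)}
    (hfg : ∀ k, |f k - g k| ≤ |f k - h k|) : ‖f - g‖ ≤ ‖f - h‖ := by
  refine Lp.norm_le_norm_of_ae_le ((ae_discreteMeasure_iff ha).2 fun k => ?_)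
  rw [discrete_sub_apply ha, discrete_sub_apply ha]
  exact hfg k

/-- Sums over the positive integers as limits of sums over initial segments. -/
theorem tendsto_sum_range_succPNat {f : ℕ+ → ℝ} {s : ℝ} (h : HasSum f s) :
    Tendsto (fun N => ∑ i ∈ Finset.range N, f i.succPNat) atTop (𝓝 s) :=
  ((Equiv.pnatEquivNat.symm.hasSum_iff (f := f) (a := s)).2 h).tendsto_sum_nat

theorem tendsto_pnat_iff {α : Type*} {l : Filter α} {f : ℕ+ → α} :
    Tendsto f atTop l ↔ Tendsto (fun n : ℕ => f n.succPNat) atTop l := by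
  conv_lhs => rw [← OrderIso.pnatIsoNat.symm.map_atTop, tendsto_map'_iff]
  rfl

theorem sum_range_telescope (f : ℕ+ → ℝ) (k : ℕ+) (N : ℕ) :
    ∑ i ∈ Finset.range (k.natPred + N),
      (if k ≤ i.succPNat then f (i.succPNat + 1) - f i.succPNat else 0) =
      f (k.natPred + N).succPNat - f k := by
  induction N with
  | zero =>
    rw [add_zero, PNat.succPNat_natPred, sub_self]
    refine Finset.sum_eq_zero fun i hi => if_neg ?_
    rw [Finset.mem_range] at hi
    rw [not_le, ← PNat.coe_lt_coe, Nat.succPNat_coe, ← PNat.natPred_add_one k]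
    omega
  | succ N ih =>
    rw [← add_assoc, Finset.sum_range_succ, ih, if_pos]
    · have : (k.natPred + N + 1).succPNat = (k.natPred + N).succPNat + 1 := rfl
      rw [this]
      ring
    · rw [← PNat.coe_le_coe, Nat.succPNat_coe, ← PNat.natPred_add_one k]
      omega

theorem hasSum_telescope {f : ℕ+ → ℝ} (hf : Tendsto f atTop (𝓝 0)) (k : ℕ+)
    (hs : Summable fun j => if k ≤ j then f (j + 1) - f j else 0) :
    HasSum (fun j => if k ≤ j then f (j + 1) - f j else 0) (-(f k)) := by
  have h1 := tendsto_sum_range_succPNat hs.hasSum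
  have h2 := (tendsto_pnat_iff.1 hf).sub_const (f k)
  have h3 : Tendsto (fun N => k.natPred + N) atTop atTop := 
    tendsto_atTop_mono (fun N => Nat.le_add_left _ _) tendsto_id
  have h4 := tendsto_nhds_unique (h1.comp h3)
    ((h2.comp h3).congr fun N => (sum_range_telescope f k N).symm)
  rw [zero_sub] at h4
  exact h4 ▸ hs.hasSum

end Discrete

/-! ### The trace form on the positive integers -/

section TraceForm

/-- The conductance between `k` and `k + 1`. -/
def conductance (k : ℕ+) : ℝ := k * (k + 1)

theorem conductance_pos (k : ℕ+) : 0 < conductance k := by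
  have : (0 : ℝ) < k := by exact_mod_cast k.pos
  unfold conductance
  positivity

theorem inv_conductance (k : ℕ+) :
    (conductance k)⁻¹ = -(((k + 1 : ℕ+) : ℝ)⁻¹) - -((k : ℝ)⁻¹) := by
  have : (0 : ℝ) < k := by exact_mod_cast k.pos
  unfold conductance
  push_cast
  field_simp
  ring

theorem tendsto_inv_pnat : Tendsto (fun k : ℕ+ => (k : ℝ)⁻¹) atTop (𝓝 0) := by
  rw [tendsto_pnat_iff]
  simpa using tendsto_one_div_add_atTop_nhds_zero_nat (𝕜 := ℝ)

/-- The resistances telescope as `1 / j - 1 / (j + 1)`. The total is the effective resistance from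
`k` to infinity; its finiteness is transience. -/
theorem hasSum_inv_conductance (k : ℕ+) :
    HasSum (fun j => if k ≤ j then (conductance j)⁻¹ else 0) (k : ℝ)⁻¹ := by
  have hlim : Tendsto (fun k : ℕ+ => -(k : ℝ)⁻¹) atTop (𝓝 0) := by simpa using tendsto_inv_pnat.neg
  have hs : Summable fun j => if k ≤ j then -(((j + 1 : ℕ+) : ℝ)⁻¹) - -((j : ℝ)⁻¹) else 0 := by
    simp_rw [← inv_conductance]
    rw [← Equiv.pnatEquivNat.symm.summable_iff]
    have h0 : ∀ j, 0 ≤ if k ≤ j then (conductance j)⁻¹ else 0 := fun j => by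
      split_ifs
      · exact (inv_pos.2 (conductance_pos j)).le
      · exact le_rfl
    refine summable_of_sum_range_le (c := (k : ℝ)⁻¹) (fun n => h0 _) fun N => ?_
    calc _ ≤ ∑ i ∈ Finset.range (k.natPred + N),
          (if k ≤ i.succPNat then (conductance i.succPNat)⁻¹ else 0) :=
          Finset.sum_le_sum_of_subset_of_nonneg
            (Finset.range_subset_range.2 (Nat.le_add_left _ _)) fun _ _ _ => h0 _
      _ = -(((k.natPred + N).succPNat : ℝ)⁻¹) - -((k : ℝ)⁻¹) := by
          rw [← sum_range_telescope (fun k => -(k : ℝ)⁻¹) k N]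
          simp_rw [inv_conductance]
      _ ≤ _ := by
          have : 0 ≤ (((k.natPred + N).succPNat : ℕ) : ℝ)⁻¹ := by positivity
          linarith
  have h := hasSum_telescope hlim k hs
  simp_rw [← inv_conductance, neg_neg] at h
  exact h

/-- `L²` over the edges `{k, k + 1}`, weighted by the conductances. -/
abbrev EdgeSpace : Type := Lp ℝ 2 (discreteMeasure conductance)

theorem exists_tailVector (k : ℕ+) :
    ∃ s : EdgeSpace, ∀ j, s j = if k ≤ j then (conductance j)⁻¹ else 0 := by
  refine exists_discrete_eq conductance_pos ((hasSum_inv_conductance k).summable.congr fun j => ?_)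
  split_ifs
  · have := (conductance_pos j).ne'
    field_simp
  · simp

/-- The vector representing the functional `g ↦ ∑_{j ≥ k} g j` on the edge space. -/
def tailVector (k : ℕ+) : EdgeSpace := (exists_tailVector k).choose

theorem tailVector_apply (k j : ℕ+) :
    tailVector k j = if k ≤ j then (conductance j)⁻¹ else 0 :=
  (exists_tailVector k).choose_spec j

theorem hasSum_tailVector (k : ℕ+) (g : EdgeSpace) :
    HasSum (fun j => if k ≤ j then g j else 0) (inner ℝ (tailVector k) g) := by
  refine (hasSum_inner_discreteMeasure conductance_pos (tailVector k) g).congr_fun fun j => ?_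
  rw [tailVector_apply]
  split_ifs
  · rw [mul_inv_cancel_left₀ (conductance_pos j).ne']
  · simp

/-- Only edges beyond both `k` and `j` contribute, each its resistance. These numbers are the Green
function of the trace form. -/
theorem inner_tailVector (k j : ℕ+) :
    inner ℝ (tailVector k) (tailVector j) = ((max k j : ℕ+) : ℝ)⁻¹ := by
  refine (hasSum_tailVector k (tailVector j)).unique
    ((hasSum_inv_conductance (max k j)).congr_fun fun i => ?_)
  rw [tailVector_apply]
  by_cases h1 : k ≤ i <;> by_cases h2 : j ≤ i <;> simp [h1, h2]

theorem norm_tailVector_sq (k : ℕ+) : ‖tailVector k‖ ^ 2 = (k : ℝ)⁻¹ := by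
  rw [← real_inner_self_eq_norm_sq, inner_tailVector, max_self]

variable {a : ℕ+ → ℝ}

/-- The trace of the three-dimensional Bessel form on the positive integers. -/
def traceForm (a : ℕ+ → ℝ) (f : Lp ℝ 2 (discreteMeasure a)) : ℝ≥0∞ :=
  open Classical in
  if Tendsto (fun k => f k) atTop (𝓝 0) then
    ∑' k, ENNReal.ofReal (conductance k * (f (k + 1) - f k) ^ 2)
  else ∞

theorem traceForm_of_tendsto {f : Lp ℝ 2 (discreteMeasure a)}
    (hf : Tendsto (fun k => f k) atTop (𝓝 0)) :
    traceForm a f = ∑' k, ENNReal.ofReal (conductance k * (f (k + 1) - f k) ^ 2) :=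
  if_pos hf

theorem tendsto_of_traceForm_ne_top {f : Lp ℝ 2 (discreteMeasure a)} (hf : traceForm a f ≠ ∞) :
    Tendsto (fun k => f k) atTop (𝓝 0) := by
  by_contra h
  exact hf (if_neg h)

/-- The graph of the discrete gradient on functions of finite energy that vanish at infinity. -/
def gradGraph (ha : ∀ k, 0 < a k) :
    Submodule ℝ (WithLp 2 (Lp ℝ 2 (discreteMeasure a) × EdgeSpace)) where
  carrier := {x | ∀ k, x.fst k = -inner ℝ (tailVector k) x.snd}
  zero_mem' := fun k => by
    change (0 : Lp ℝ 2 (discreteMeasure a)) k = _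
    rw [discrete_zero_apply ha]
    simp
  add_mem' := by
    intro x y hx hy k
    rw [WithLp.add_fst, discrete_add_apply ha, hx k, hy k, WithLp.add_snd, inner_add_right]
    ring
  smul_mem' := by
    intro r x hx k
    rw [WithLp.smul_fst, discrete_smul_apply ha, hx k, WithLp.smul_snd, inner_smul_right]
    ring

variable {ha : ∀ k, 0 < a k}

theorem mem_gradGraph {x : WithLp 2 (Lp ℝ 2 (discreteMeasure a) × EdgeSpace)} :
    x ∈ gradGraph ha ↔ ∀ k, x.fst k = -inner ℝ (tailVector k) x.snd :=
  Iff.rfl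

/-- Cauchy–Schwarz against the tail vector, whose squared norm is `1 / k`. -/
theorem gradGraph_sq_le {x : WithLp 2 (Lp ℝ 2 (discreteMeasure a) × EdgeSpace)}
    (hx : x ∈ gradGraph ha) (k : ℕ+) : x.fst k ^ 2 ≤ ‖x.snd‖ ^ 2 * (k : ℝ)⁻¹ := by
  rw [mem_gradGraph.1 hx k, neg_sq, ← norm_tailVector_sq, ← mul_pow, mul_comm]
  exact sq_le_sq' (by linarith [neg_abs_le (inner ℝ (tailVector k) x.snd),
    abs_real_inner_le_norm (tailVector k) x.snd]) (real_inner_le_norm _ _)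

/-- Writing `f k = -∑_{j ≥ k} g j` encodes at once that `g` is the gradient of `f` and that `f`
vanishes at infinity. In the tail form the graph is an intersection of kernels of bounded
functionals, hence visibly closed. -/
theorem mem_gradGraph_iff {x : WithLp 2 (Lp ℝ 2 (discreteMeasure a) × EdgeSpace)} :
    x ∈ gradGraph ha ↔
      Tendsto (fun k => x.fst k) atTop (𝓝 0) ∧ ∀ k, x.snd k = x.fst (k + 1) - x.fst k := by
  constructor
  · intro hx
    refine ⟨?_, fun k => ?_⟩
    · have h1 : Tendsto (fun k : ℕ+ => ‖x.snd‖ ^ 2 * (k : ℝ)⁻¹) atTop (𝓝 0) := by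
        simpa using tendsto_inv_pnat.const_mul (‖x.snd‖ ^ 2)
      have h2 := squeeze_zero (fun k => sq_nonneg _) (gradGraph_sq_le hx) h1
      have h3 := h2.sqrt
      simp only [Real.sqrt_sq_eq_abs, Real.sqrt_zero] at h3
      exact (tendsto_zero_iff_abs_tendsto_zero _).2 h3
    · rw [mem_gradGraph.1 hx k, mem_gradGraph.1 hx (k + 1)]
      have h1 := (hasSum_tailVector k x.snd).sub (hasSum_tailVector (k + 1) x.snd)
      have h2 := h1.unique (hasSum_single k fun j hj => ?_)
      · rw [if_pos le_rfl, if_neg (by simp)] at h2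
        linarith
      · rcases lt_or_gt_of_ne hj with h | h
        · rw [if_neg h.not_ge, if_neg (by simpa using (h.trans (PNat.lt_add_right k 1)).not_ge),
            sub_zero]
        · rw [if_pos h.le, if_pos (PNat.add_one_le_iff.2 h), sub_self]
  · rintro ⟨h1, h2⟩ k
    have h3 := hasSum_tailVector k x.snd
    simp_rw [h2] at h3
    rw [← (hasSum_telescope h1 k h3.summable).unique h3, neg_neg]

theorem traceForm_eq_of_mem {x : WithLp 2 (Lp ℝ 2 (discreteMeasure a) × EdgeSpace)}
    (hx : x ∈ gradGraph ha) : traceForm a x.fst = ENNReal.ofReal (‖x.snd‖ ^ 2) := by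
  obtain ⟨h1, h2⟩ := mem_gradGraph_iff.1 hx
  have h3 := hasSum_norm_sq_discreteMeasure conductance_pos x.snd
  rw [traceForm_of_tendsto h1, ← h3.tsum_eq, ENNReal.ofReal_tsum_of_nonneg _ h3.summable]
  · simp_rw [h2]
  · exact fun k => mul_nonneg (conductance_pos k).le (sq_nonneg _)

theorem exists_mem_gradGraph (ha : ∀ k, 0 < a k) {u : Lp ℝ 2 (discreteMeasure a)}
    (hu : traceForm a u ≠ ∞) : ∃ x ∈ gradGraph ha, x.fst = u := by
  have h1 := tendsto_of_traceForm_ne_top hu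
  rw [traceForm_of_tendsto h1] at hu
  have h2 : Summable fun k => conductance k * (u (k + 1) - u k) ^ 2 :=
    (ENNReal.summable_toReal hu).congr fun k =>
      ENNReal.toReal_ofReal (mul_nonneg (conductance_pos k).le (sq_nonneg _))
  obtain ⟨g, hg⟩ := exists_discrete_eq conductance_pos h2
  exact ⟨WithLp.toLp 2 (u, g), mem_gradGraph_iff.2 ⟨h1, hg⟩, rfl⟩

theorem isFormGraph_gradGraph (ha : ∀ k, 0 < a k) : IsFormGraph (traceForm a) (gradGraph ha) where
  isClosed := by
    have hfst : Continuous fun x : WithLp 2 (Lp ℝ 2 (discreteMeasure a) × EdgeSpace) => x.fst :=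
      continuous_fst.comp (WithLp.prod_continuous_ofLp 2 _ _)
    have hsnd : Continuous fun x : WithLp 2 (Lp ℝ 2 (discreteMeasure a) × EdgeSpace) => x.snd :=
      continuous_snd.comp (WithLp.prod_continuous_ofLp 2 _ _)
    have : (gradGraph ha : Set (WithLp 2 (Lp ℝ 2 (discreteMeasure a) × EdgeSpace))) =
        ⋂ k, {x | x.fst k = -inner ℝ (tailVector k) x.snd} := by
      ext x
      simp [mem_gradGraph]
    rw [this]
    refine isClosed_iInter fun k => ?_
    obtain ⟨e, he⟩ := exists_eval ha k
    simp_rw [← he]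
    exact isClosed_eq (e.continuous.comp hfst) (continuous_const.inner hsnd).neg
  eq_norm_sq := fun x hx => traceForm_eq_of_mem hx
  exists_mem := fun u hu => exists_mem_gradGraph ha hu

theorem sq_le_of_traceForm_le (ha : ∀ k, 0 < a k) {f : Lp ℝ 2 (discreteMeasure a)} {C : ℝ}
    (hC : 0 ≤ C) (hf : traceForm a f ≤ ENNReal.ofReal C) (k : ℕ+) : f k ^ 2 ≤ C * (k : ℝ)⁻¹ := by
  obtain ⟨x, hx, rfl⟩ := exists_mem_gradGraph ha (ne_top_of_le_ne_top ENNReal.ofReal_ne_top hf)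
  rw [traceForm_eq_of_mem hx, ENNReal.ofReal_le_ofReal_iff hC] at hf
  exact (gradGraph_sq_le hx k).trans (mul_le_mul_of_nonneg_right hf (by positivity))

/-- Normal contractions operate on the trace form. -/
theorem traceForm_contraction {φ : ℝ → ℝ} (h0 : φ 0 = 0) (hφ : ∀ x y, |φ x - φ y| ≤ |x - y|)
    {u v : Lp ℝ 2 (discreteMeasure a)} (huv : ∀ k, v k = φ (u k)) :
    traceForm a v ≤ traceForm a u := by
  by_cases hu : traceForm a u = ∞
  · exact hu ▸ le_top
  have h1 := tendsto_of_traceForm_ne_top hu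
  have h2 : Tendsto (fun k => v k) atTop (𝓝 0) := by
    refine squeeze_zero_norm (fun k => ?_) ((tendsto_zero_iff_abs_tendsto_zero _).1 h1)
    simpa [huv, h0] using hφ (u k) 0
  rw [traceForm_of_tendsto h1, traceForm_of_tendsto h2]
  refine ENNReal.tsum_le_tsum fun k => ENNReal.ofReal_le_ofReal ?_
  refine mul_le_mul_of_nonneg_left ?_ (conductance_pos k).le
  rw [huv, huv]
  exact sq_le_sq.2 (hφ _ _)

/-- The indicator function of `{1, …, n}`. -/
theorem exists_indicator (ha : ∀ k, 0 < a k) (n : ℕ+) :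
    ∃ f : Lp ℝ 2 (discreteMeasure a), ∀ k, f k = if k ≤ n then 1 else 0 :=
  exists_discrete_eq_of_finite ha (Finset.Iic n) fun k hk => if_neg (by simpa using hk)

/-- The gradient of the indicator of `{1, …, n}` lives on the single edge `{n, n + 1}`. Pairing its
image under the operator with `v` thus reads off the flux of `v` through that edge. -/
theorem exists_indicator_mem_formOperator (ha : ∀ k, 0 < a k) (n : ℕ+)
    {u : Lp ℝ 2 (discreteMeasure a)} (hu : ∀ k, u k = if k ≤ n then 1 else 0) :
    ∃ f, (u, f) ∈ formOperator (gradGraph ha) ∧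
      ∀ v, inner ℝ f v = conductance n * (v n - v (n + 1)) := by
  obtain ⟨g, hg⟩ := exists_discrete_eq_of_finite conductance_pos
    (f := fun k => if k = n then -1 else 0) {n} fun k hk => if_neg (by simpa using hk)
  obtain ⟨f, hf⟩ := exists_discrete_eq_of_finite ha
    (f := fun k => if k = n then conductance n / a n else
      if k = n + 1 then -(conductance n / a (n + 1)) else 0) {n, n + 1} fun k hk => by
    simp only [Finset.mem_insert, Finset.mem_singleton, not_or] at hk
    simp [hk.1, hk.2]
  have hne : n + 1 ≠ n := (PNat.lt_add_right n 1).ne'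
  have hfv : ∀ v, inner ℝ f v = conductance n * (v n - v (n + 1)) := by
    intro v
    refine (hasSum_inner_discreteMeasure ha f v).unique ?_
    have h1 : ∀ k ∉ ({n, n + 1} : Finset ℕ+), a k * (f k * v k) = 0 := fun k hk => by
      simp only [Finset.mem_insert, Finset.mem_singleton, not_or] at hk
      simp [hf, hk.1, hk.2]
    have h2 : HasSum _ _ := hasSum_sum_of_ne_finset_zero h1
    convert h2 using 1
    rw [Finset.sum_pair hne.symm, hf, hf, if_pos rfl, if_neg hne, if_pos rfl]
    have := (ha n).ne'
    have := (ha (n + 1)).ne'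
    field_simp
    ring
  refine ⟨f, mem_formOperator.2 ⟨WithLp.toLp 2 (u, g), mem_gradGraph_iff.2 ⟨?_, fun k => ?_⟩, rfl,
    fun y hy => ?_⟩, hfv⟩
  · refine tendsto_const_nhds.congr' ?_
    filter_upwards [eventually_gt_atTop n] with k hk
    simp [hu, hk.not_ge]
  · simp only [WithLp.toLp_fst, WithLp.toLp_snd, hg, hu, PNat.add_one_le_iff]
    rcases lt_trichotomy k n with h | rfl | h
    · simp [h, h.le, h.ne]
    · simp
    · simp [h.not_ge, h.ne', h.le]
  · rw [hfv]
    refine (hasSum_inner_discreteMeasure conductance_pos g y.snd).unique ?_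
    convert hasSum_single n fun k hk => ?_ using 1
    · rw [hg, if_pos rfl, (mem_gradGraph_iff.1 hy).2]
      ring
    · simp [hg, hk]

/-- For density of the operator domain: it contains the indicators of initial segments, whose
differences isolate each point. -/
theorem isNonnegSelfAdjoint_traceForm (ha : ∀ k, 0 < a k) :
    IsNonnegSelfAdjoint (formOperator (gradGraph ha)) := by
  refine (isFormGraph_gradGraph ha).isNonnegSelfAdjoint fun f hf => discrete_ext ha fun k => ?_
  rw [discrete_zero_apply ha]
  have h : ∀ n : ℕ+, HasSum (fun k => a k * (f k * if k ≤ n then 1 else 0)) 0 := by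
    intro n
    obtain ⟨u, hu⟩ := exists_indicator ha n
    obtain ⟨g, hg, -⟩ := exists_indicator_mem_formOperator ha n hu
    simpa only [hf _ hg, hu] using hasSum_inner_discreteMeasure ha f u
  have key : ∀ b : ℝ, HasSum (fun j => if j = k then a k * f k else 0) b → b = 0 → f k = 0 := by
    intro b hb hb0
    have := hb.unique (hasSum_ite_eq k (a k * f k))
    exact (mul_eq_zero.1 (this ▸ hb0)).resolve_left (ha k).ne'
  rcases em (k = 1) with rfl | hk
  · refine key 0 ((h 1).congr_fun fun j => ?_) rfl
    by_cases hj : j = 1 <;> simp [hj]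
  · obtain ⟨m, rfl⟩ := PNat.exists_eq_succ_of_ne_one hk
    refine key _ (((h (m + 1)).sub (h m)).congr_fun fun j => ?_) (sub_zero 0)
    rcases lt_trichotomy j (m + 1) with h1 | rfl | h1
    · simp [h1.le, h1.ne, PNat.lt_add_one_iff.1 h1]
    · simp
    · have : ¬ j ≤ m := ((PNat.lt_add_right m 1).trans h1).not_ge
      simp [h1.not_ge, h1.ne', this]

/-- The resolvents of the trace form are sub-Markovian. -/
theorem resolvent_mem_Icc (ha : ∀ k, 0 < a k) {c : ℝ} (hc : 0 < c)
    {f u : Lp ℝ 2 (discreteMeasure a)} (hf : ∀ k, f k ∈ Icc (0 : ℝ) 1)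
    (hu : (u, c • (f - u)) ∈ formOperator (gradGraph ha)) (k : ℕ+) : u k ∈ Icc (0 : ℝ) 1 := by
  set φ : ℝ → ℝ := fun x => max 0 (min x 1)
  have hφ : ∀ x y, |φ x - φ y| ≤ |x - y| := fun x y => by
    refine (abs_max_sub_max_le_max 0 (min x 1) 0 (min y 1)).trans ?_
    simpa using abs_min_sub_min_le_max x 1 y 1
  have hmem : ∀ x, φ x ∈ Icc (0 : ℝ) 1 := fun x =>
    ⟨le_max_left _ _, max_le zero_le_one (min_le_right _ _)⟩
  have hsum : Summable fun k => a k * φ (u k) ^ 2 := by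
    refine (hasSum_norm_sq_discreteMeasure ha u).summable.of_nonneg_of_le
      (fun k => mul_nonneg (ha k).le (sq_nonneg _)) fun k =>
      mul_le_mul_of_nonneg_left (sq_le_sq.2 ?_) (ha k).le
    simpa [φ] using hφ (u k) 0
  obtain ⟨v, hv⟩ := exists_discrete_eq ha hsum
  have h1 : traceForm a v ≤ traceForm a u := traceForm_contraction (by simp [φ]) hφ hv
  have h2 : ‖f - v‖ ≤ ‖f - u‖ := norm_sub_le_of_forall_abs_le ha fun k => by
    have : f k = φ (f k) := by
      simp [φ, (hf k).1, (hf k).2]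
    rw [hv, this]
    conv_rhs => rw [← this]
    exact hφ _ _
  -- Truncating `u` to `[0, 1]` does not increase the energy nor, as `f` is already `[0, 1]`-valued,
  -- the distance to `f`. So the truncation is the minimiser, which is `u`.
  rw [← (isFormGraph_gradGraph ha).eq_of_le hc hu h1 h2, hv]
  exact hmem _

end TraceForm

/-! ### Conservativeness -/

section Conservativeness

/-- The fundamental theorem of calculus along an orbit; right derivatives suffice. -/
theorem IsFormSemigroup.integral_eq {H : Type*} [NormedAddCommGroup H] [InnerProductSpace ℝ H]
    {E : H → ℝ≥0∞} {T : ℝ≥0 → H →L[ℝ] H} (hT : IsFormSemigroup E T) {u f : H}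
    (h : IsFormOperator E u f) (l : H →L[ℝ] ℝ) (t : ℝ≥0) :
    ∫ s in (0 : ℝ)..t, l (T s.toNNReal f) = l u - l (T t u) := by
  have h1 := intervalIntegral.integral_eq_sub_of_hasDeriv_right_of_le (a := 0) (b := (t : ℝ))
    (f := fun s : ℝ => l (T s.toNNReal u)) (f' := fun s : ℝ => -(l (T s.toNNReal f)))
    t.coe_nonneg (l.continuous.comp (hT.continuous_real u)).continuousOn
    (fun s hs => by
      have := l.hasFDerivAt.comp_hasDerivWithinAt s (hT.hasDerivWithinAt h hs.1.le)
      rwa [map_neg] at this)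
    ((l.continuous.comp (hT.continuous_real f)).neg.intervalIntegrable _ _)
  rw [intervalIntegral.integral_neg, Real.toNNReal_coe, Real.toNNReal_zero, hT.zero,
    ContinuousLinearMap.id_apply] at h1
  linarith

variable {a : ℕ+ → ℝ} {T : ℝ≥0 → Lp ℝ 2 (discreteMeasure a) →L[ℝ] Lp ℝ 2 (discreteMeasure a)}

theorem existsUnique_isFormSemigroup (ha : ∀ k, 0 < a k) :
    ∃! T : ℝ≥0 → Lp ℝ 2 (discreteMeasure a) →L[ℝ] Lp ℝ 2 (discreteMeasure a),
      IsFormSemigroup (traceForm a) T := by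
  have hA := isNonnegSelfAdjoint_traceForm ha
  have hE := (isFormGraph_gradGraph ha).isFormOperator_iff
  obtain ⟨T, hT, -⟩ := exists_isFormSemigroup hA hE
  exact ⟨T, hT, fun S hS => hS.unique hA hE hT⟩

/-- The semigroup of the trace form is sub-Markovian. -/
theorem semigroup_mem_Icc (ha : ∀ k, 0 < a k) (hT : IsFormSemigroup (traceForm a) T) (t : ℝ≥0)
    {f : Lp ℝ 2 (discreteMeasure a)} (hf : ∀ k, f k ∈ Icc (0 : ℝ) 1) (k : ℕ+) :
    T t f k ∈ Icc (0 : ℝ) 1 := by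
  have hA := isNonnegSelfAdjoint_traceForm ha
  have hE := (isFormGraph_gradGraph ha).isFormOperator_iff
  obtain ⟨S, hS, hS'⟩ := exists_isFormSemigroup hA hE
  obtain rfl := hT.unique hA hE hS
  obtain ⟨e, he⟩ := exists_eval ha k
  have hC : ∀ c : ℝ, 0 < c → ∀ f ∈ {f : Lp ℝ 2 (discreteMeasure a) | ∀ k, f k ∈ Icc (0 : ℝ) 1},
      ∀ u, (u, c • (f - u)) ∈ formOperator (gradGraph ha) → u ∈ {f | ∀ k, f k ∈ Icc (0 : ℝ) 1} :=
    fun c hc f hf u hu k => resolvent_mem_Icc ha hc hf hu k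
  have h1 := hS' t _ (-e) 0 hC (fun g hg => by simpa [he] using (hg k).1) f hf
  have h2 := hS' t _ e 1 hC (fun g hg => by simpa [he] using (hg k).2) f hf
  rw [he] at h2
  simp only [_root_.neg_apply, he] at h1
  exact ⟨by linarith, h2⟩

theorem semigroup_nonneg (ha : ∀ k, 0 < a k) (hT : IsFormSemigroup (traceForm a) T) (t : ℝ≥0)
    {f : Lp ℝ 2 (discreteMeasure a)} {C : ℝ} (hC : 0 < C) (hf : ∀ k, f k ∈ Icc 0 C) (k : ℕ+) :
    0 ≤ T t f k := by
  have h := (semigroup_mem_Icc ha hT t (f := C⁻¹ • f) (fun j => by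
    rw [discrete_smul_apply ha]
    refine ⟨mul_nonneg (inv_nonneg.2 hC.le) (hf j).1, ?_⟩
    rw [inv_mul_le_iff₀ hC, mul_one]
    exact (hf j).2) k).1
  rw [map_smul, discrete_smul_apply ha] at h
  exact nonneg_of_mul_nonneg_right h (inv_pos.2 hC)

/-- Here `1` is in `L²` and would be fixed by the semigroup, hence lie in the kernel of the
generator and in the form domain, all of whose elements vanish at infinity. -/
theorem not_isConservative_of_finite (ha : ∀ k, 0 < a k) (hμ : discreteMeasure a univ < ∞) :
    ¬ IsConservative (traceForm a) := by
  rintro ⟨T, hT, hfix⟩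
  have : IsFiniteMeasure (discreteMeasure a) := ⟨hμ⟩
  have hmem : MemLp (fun _ : ℕ+ => (1 : ℝ)) 2 (discreteMeasure a) := memLp_const 1
  set u := hmem.toLp (fun _ : ℕ+ => (1 : ℝ))
  have hu : ∀ k, u k = 1 := discrete_toLp_apply ha hmem
  have h1 : ∀ t : ℝ≥0, 0 < t → T t u = u := by
    intro t ht
    refine discrete_ext ha fun k => ?_
    have h2 := (ae_discreteMeasure_iff ha).1 (hfix t ht (fun _ => u)
      (fun _ => (discrete_nonneg_iff ha).2 fun k => by simp [hu]) monotone_const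
      (by simp [hu])) k
    rw [tendsto_nhds_unique tendsto_const_nhds h2, hu]
  have h3 : IsFormOperator (traceForm a) u 0 := by
    rw [← hT.generator]
    refine tendsto_const_nhds.congr' ?_
    filter_upwards [self_mem_nhdsWithin] with t ht
    rw [h1 t ht, sub_self, smul_zero]
  have h4 := tendsto_of_traceForm_ne_top h3.1
  simp only [hu] at h4
  exact one_ne_zero (tendsto_nhds_unique tendsto_const_nhds h4)

/-- A column of the Green function. Its gradient is `-tailVector j`, and it is square integrable
because `1 / max k j` is at most both `1` and `1 / k`. -/
theorem exists_green (ha : ∀ k, 0 < a k) (hs : Summable fun k : ℕ+ => a k / k) (j : ℕ+) :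
    ∃ u f : Lp ℝ 2 (discreteMeasure a), (u, f) ∈ formOperator (gradGraph ha) ∧
      (∀ k, u k = ((max k j : ℕ+) : ℝ)⁻¹) ∧ ∀ k, f k = if k = j then (a j)⁻¹ else 0 := by
  have hsum : Summable fun k => a k * (((max k j : ℕ+) : ℝ)⁻¹) ^ 2 := by
    refine hs.of_nonneg_of_le (fun k => mul_nonneg (ha k).le (sq_nonneg _)) fun k => ?_
    rw [div_eq_mul_inv]
    refine mul_le_mul_of_nonneg_left ?_ (ha k).le
    have h0 : (0 : ℝ) < k := by exact_mod_cast k.pos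
    have h1 : (1 : ℝ) ≤ (max k j : ℕ+) := by exact_mod_cast (max k j).pos
    have h2 : (k : ℝ) ≤ (max k j : ℕ+) := by exact_mod_cast le_max_left k j
    rw [sq]
    calc _ ≤ (1 : ℝ) * (k : ℝ)⁻¹ := mul_le_mul (inv_le_one_of_one_le₀ h1) (inv_anti₀ h0 h2)
          (by positivity) zero_le_one
      _ = _ := one_mul _
  obtain ⟨u, hu⟩ := exists_discrete_eq ha hsum
  obtain ⟨f, hf⟩ := exists_discrete_eq_of_finite ha (f := fun k => if k = j then (a j)⁻¹ else 0) {j}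
    fun k hk => if_neg (by simpa using hk)
  refine ⟨u, f, mem_formOperator.2 ⟨WithLp.toLp 2 (u, -tailVector j), mem_gradGraph.2 fun k => ?_,
    rfl, fun y hy => ?_⟩, hu, hf⟩
  · simp [hu, inner_tailVector]
  · rw [WithLp.toLp_snd, inner_neg_left, ← mem_gradGraph.1 hy j]
    refine HasSum.unique ?_ (hasSum_inner_discreteMeasure ha f y.fst)
    convert hasSum_single j fun k hk => ?_ using 1
    · rw [hf, if_pos rfl, ← mul_assoc, mul_inv_cancel₀ (ha j).ne', one_mul]
    · simp [hf, hk]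

theorem discrete_sum_apply (ha : ∀ k, 0 < a k) {ι : Type*} (s : Finset ι)
    (f : ι → Lp ℝ 2 (discreteMeasure a)) (k : ℕ+) : (∑ i ∈ s, f i) k = ∑ i ∈ s, f i k := by
  obtain ⟨e, he⟩ := exists_eval ha k
  simp_rw [← he]
  exact map_sum e f s

/-- The potential `w n` of the indicator of `{1, …, n}` is bounded by `C = ∑ a j / j` uniformly in
`n`. It dominates `∫₀ᵗ T s (χ n) ds`, which under conservativeness increases to `t`. -/
theorem not_isConservative_of_summable (ha : ∀ k, 0 < a k)
    (hs : Summable fun k : ℕ+ => a k / k) : ¬ IsConservative (traceForm a) := by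
  rintro ⟨T, hT, hfix⟩
  have hE := (isFormGraph_gradGraph ha).isFormOperator_iff
  choose u f huf hu hf using exists_green ha hs
  choose χ hχ using exists_indicator ha
  have h0 : ∀ k : ℕ+, 0 ≤ a k / k := fun k => div_nonneg (ha k).le (by positivity)
  set C := ∑' k : ℕ+, a k / k
  have hC : 0 ≤ C := tsum_nonneg h0
  set w : ℕ+ → Lp ℝ 2 (discreteMeasure a) := fun n => ∑ j ∈ Finset.Iic n, a j • u j
  have hw : ∀ n, IsFormOperator (traceForm a) (w n) (χ n) := by
    intro n
    have e : χ n = ∑ j ∈ Finset.Iic n, a j • f j := by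
      refine discrete_ext ha fun k => ?_
      simp only [discrete_sum_apply ha, discrete_smul_apply ha, hf, hχ, mul_ite, mul_zero]
      rw [Finset.sum_ite_eq]
      simp [(ha k).ne']
    rw [hE, e]
    have := Submodule.sum_mem (formOperator (gradGraph ha)) (t := Finset.Iic n)
      fun j _ => Submodule.smul_mem _ (a j) (huf j)
    convert this using 1
    ext <;> simp [w, Prod.fst_sum, Prod.snd_sum]
  have hwC : ∀ n k, w n k ∈ Icc 0 C := by
    intro n k
    simp only [w, discrete_sum_apply ha, discrete_smul_apply ha, hu]
    refine ⟨Finset.sum_nonneg fun j _ => mul_nonneg (ha j).le (by positivity), ?_⟩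
    refine le_trans (Finset.sum_le_sum fun j _ => ?_) (hs.sum_le_tsum (Finset.Iic n) fun j _ => h0 j)
    rw [div_eq_mul_inv]
    refine mul_le_mul_of_nonneg_left (inv_anti₀ (by exact_mod_cast j.pos) ?_) (ha j).le
    exact_mod_cast le_max_right k j
  obtain ⟨e, he⟩ := exists_eval ha 1
  -- Any time exceeding the uniform bound `C` of the potentials gives the contradiction.
  set t : ℝ≥0 := ⟨C + 1, by positivity⟩
  have hint : ∀ n, ∫ s in (0 : ℝ)..t, e (T s.toNNReal (χ n)) ≤ C := by
    intro n
    rw [hT.integral_eq (hw n) e t, he, he]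
    have h1 := semigroup_nonneg ha hT t (C := C + 1) (by positivity)
      (fun k => ⟨(hwC n k).1, (hwC n k).2.trans (by linarith)⟩) 1
    linarith [(hwC n 1).2]
  have hχ01 : ∀ n k, χ n k ∈ Icc (0 : ℝ) 1 := fun n k => by
    rw [hχ]
    split_ifs <;> simp
  have hlim : Tendsto (fun n : ℕ => ∫ s in (0 : ℝ)..t, e (T s.toNNReal (χ n.succPNat))) atTop
      (𝓝 (∫ _ in (0 : ℝ)..t, (1 : ℝ))) := by
    refine intervalIntegral.tendsto_integral_filter_of_dominated_convergence (fun _ => 1)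
      (Eventually.of_forall fun n => (e.continuous.comp (hT.continuous_real _)).aestronglyMeasurable)
      (Eventually.of_forall fun n => Eventually.of_forall fun s _ => ?_) (by simp)
      (Eventually.of_forall fun s hs => ?_)
    · have h1 := semigroup_mem_Icc ha hT s.toNNReal (hχ01 n.succPNat) 1
      rw [he, Real.norm_of_nonneg h1.1]
      exact h1.2
    · rw [uIoc_of_le t.coe_nonneg] at hs
      have h1 := hfix s.toNNReal (Real.toNNReal_pos.2 hs.1) (fun n => χ n.succPNat)
        (fun n => (discrete_nonneg_iff ha).2 fun k => (hχ01 _ k).1)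
        (fun n m hnm => (discrete_le_iff ha).2 fun k => by
          have hnm' : n.succPNat ≤ m.succPNat := Nat.succPNat_le_succPNat.2 hnm
          rw [hχ, hχ]
          split_ifs with h1 h2
          · exact le_rfl
          · exact absurd (h1.trans hnm') h2
          · exact zero_le_one
          · exact le_rfl)
        ((ae_discreteMeasure_iff ha).2 fun k => by
          refine tendsto_const_nhds.congr' ?_
          filter_upwards [eventually_ge_atTop (k : ℕ)] with n hn
          rw [hχ, if_pos]
          rw [← PNat.coe_le_coe, Nat.succPNat_coe]
          omega)
      simpa only [he] using (ae_discreteMeasure_iff ha).1 h1 1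
  have h2 := le_of_tendsto' hlim fun n => hint n.succPNat
  rw [intervalIntegral.integral_const, smul_eq_mul, mul_one, sub_zero] at h2
  have h3 : (t : ℝ) = C + 1 := rfl
  linarith

/-- A flux of at least `b` through every edge past `i` gives drops of at least `b (1 / k - 1 / (k +
1))`; telescope to infinity, where `v` is still nonnegative. -/
theorem div_le_of_forall_sub_le {v : ℕ+ → ℝ} {b : ℝ} {i : ℕ+} (h0 : ∀ k, 0 ≤ v k)
    (h : ∀ k, i ≤ k → b ≤ conductance k * (v k - v (k + 1))) {k : ℕ+} (hk : i ≤ k) :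
    b / k ≤ v k := by
  have key : ∀ N : ℕ, b * (k : ℝ)⁻¹ - b * ((k.natPred + N).succPNat : ℝ)⁻¹ ≤
      v k - v (k.natPred + N).succPNat := by
    intro N
    have h1 := sum_range_telescope (fun j => -v j) k N
    have h2 := sum_range_telescope (fun j => -(b * (j : ℝ)⁻¹)) k N
    have h3 : ∀ j : ℕ+, (if k ≤ j then -(b * ((j + 1 : ℕ+) : ℝ)⁻¹) - -(b * (j : ℝ)⁻¹) else 0) ≤
        if k ≤ j then -v (j + 1) - -v j else 0 := by
      intro j
      split_ifs with hkj
      · have h4 := h j (hk.trans hkj)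
        have h5 := inv_conductance j
        have e : -(b * ((j + 1 : ℕ+) : ℝ)⁻¹) - -(b * (j : ℝ)⁻¹) = (conductance j)⁻¹ * b := by
          rw [h5]
          ring
        rw [e, inv_mul_le_iff₀ (conductance_pos j)]
        linarith
      · exact le_rfl
    have h6 := Finset.sum_le_sum (s := Finset.range (k.natPred + N)) fun i _ => h3 i.succPNat
    rw [h1, h2] at h6
    linarith
  have h1 : Tendsto (fun N : ℕ => b * (k : ℝ)⁻¹ - b * ((k.natPred + N).succPNat : ℝ)⁻¹) atTop
      (𝓝 (b * (k : ℝ)⁻¹ - b * 0)) := by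
    have := (tendsto_pnat_iff.1 tendsto_inv_pnat).comp
      (tendsto_atTop_mono (fun N => Nat.le_add_left N k.natPred) tendsto_id)
    exact (this.const_mul b).const_sub _
  rw [mul_zero, sub_zero] at h1
  exact le_of_tendsto' h1 fun N => (key N).trans (by linarith [h0 (k.natPred + N).succPNat])

/-- Suppose a fraction `ε` of the mass starting at `i` is missing from every `{1, …, n}` at time
`t`. Then `v`, the time integral over `[0, t]` of the evolution of the point indicator at `i`,
carries a flux at least `a i * ε` through each edge past `i`. Hence `v k ≥ a i * ε / k` there, while
the total mass of `v` is at most `a i * t`, so `∑ a k / k` would converge. -/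
theorem exists_lt_semigroup_indicator (ha : ∀ k, 0 < a k) (hs : ¬ Summable fun k : ℕ+ => a k / k)
    (hT : IsFormSemigroup (traceForm a) T) {χ : ℕ+ → Lp ℝ 2 (discreteMeasure a)}
    (hχ : ∀ n k, χ n k = if k ≤ n then 1 else 0) (t : ℝ≥0) (i : ℕ+) {ε : ℝ} (hε : 0 < ε) :
    ∃ n, 1 - ε < T t (χ n) i := by
  by_contra! hcon
  have hE := (isFormGraph_gradGraph ha).isFormOperator_iff
  obtain ⟨h, hh⟩ := exists_discrete_eq_of_finite ha (f := fun k => if k = i then 1 else 0) {i}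
    fun k hk => if_neg (by simpa using hk)
  have hinner : ∀ g, inner ℝ h g = a i * g i := by
    intro g
    refine (hasSum_inner_discreteMeasure ha h g).unique ?_
    convert hasSum_single i fun k hk => ?_ using 1
    · simp [hh]
    · simp [hh, hk]
  have hh01 : ∀ k, h k ∈ Icc (0 : ℝ) 1 := fun k => by
    rw [hh]
    split_ifs <;> simp
  have hχ01 : ∀ n k, χ n k ∈ Icc (0 : ℝ) 1 := fun n k => by
    rw [hχ]
    split_ifs <;> simp
  choose e he using exists_eval ha
  have hcont : ∀ k, Continuous fun s : ℝ => T s.toNNReal h k := by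
    intro k
    simp_rw [← he]
    exact (e k).continuous.comp (hT.continuous_real h)
  set v : ℕ+ → ℝ := fun k => ∫ s in (0 : ℝ)..t, T s.toNNReal h k
  have hv0 : ∀ k, 0 ≤ v k := fun k =>
    intervalIntegral.integral_nonneg t.coe_nonneg fun s _ => (semigroup_mem_Icc ha hT _ hh01 k).1
  -- By symmetry of the semigroup the flux of `v` through `{k, k + 1}` is `⟨h, χ k - T t (χ k)⟩ = a
  -- i (1 - T t (χ k) i)`.
  have hflux : ∀ k, i ≤ k → a i * ε ≤ conductance k * (v k - v (k + 1)) := by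
    intro k hk
    obtain ⟨f, hf, hfv⟩ := exists_indicator_mem_formOperator ha k (hχ k)
    have h1 := hT.integral_eq ((hE _ _).2 hf) (innerSL ℝ h) t
    have h2 : ∀ s : ℝ, innerSL ℝ h (T s.toNNReal f) =
        conductance k * (T s.toNNReal h k - T s.toNNReal h (k + 1)) := fun s => by
      rw [innerSL_apply_apply, ← hT.symmetric, real_inner_comm, hfv]
    simp_rw [h2] at h1
    rw [intervalIntegral.integral_const_mul, intervalIntegral.integral_sub
      ((hcont _).intervalIntegrable _ _) ((hcont _).intervalIntegrable _ _)] at h1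
    change conductance k * (v k - v (k + 1)) = _ at h1
    rw [h1, innerSL_apply_apply, innerSL_apply_apply, hinner, hinner, hχ, if_pos hk, ← mul_sub]
    exact mul_le_mul_of_nonneg_left (by linarith [hcon k]) (ha i).le
  have hmass : ∀ n, ∑ k ∈ Finset.Iic n, a k * v k ≤ a i * t := by
    intro n
    have h1 : ∑ k ∈ Finset.Iic n, a k * v k =
        ∫ s in (0 : ℝ)..t, ∑ k ∈ Finset.Iic n, a k * T s.toNNReal h k := by
      rw [intervalIntegral.integral_finsetSum
        fun k _ => ((hcont k).const_mul (a k)).intervalIntegrable _ _]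
      simp_rw [intervalIntegral.integral_const_mul]
      rfl
    have h2 : ∀ s : ℝ, ∑ k ∈ Finset.Iic n, a k * T s.toNNReal h k ≤ a i := by
      intro s
      have h3 : inner ℝ (T s.toNNReal h) (χ n) = ∑ k ∈ Finset.Iic n, a k * T s.toNNReal h k := by
        refine (hasSum_inner_discreteMeasure ha _ _).unique ?_
        have h4 : ∀ k ∉ Finset.Iic n, a k * (T s.toNNReal h k * χ n k) = 0 := fun k hk => by
          rw [hχ, if_neg (by simpa using hk), mul_zero, mul_zero]
        have h5 : HasSum _ _ := hasSum_sum_of_ne_finset_zero h4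
        convert h5 using 1
        refine Finset.sum_congr rfl fun k hk => ?_
        rw [hχ, if_pos (by simpa using hk), mul_one]
      rw [← h3, hT.symmetric, hinner]
      exact mul_le_of_le_one_right (ha i).le (semigroup_mem_Icc ha hT _ (hχ01 n) i).2
    rw [h1]
    calc _ ≤ ∫ _ in (0 : ℝ)..t, a i := by
          refine intervalIntegral.integral_mono_on t.coe_nonneg ?_ (by simp) fun s _ => h2 s
          exact (continuous_finsetSum _ fun k _ => (hcont k).const_mul (a k)).intervalIntegrable _ _
      _ = a i * t := by simp [mul_comm]
  refine hs (summable_of_sum_le (c := ∑ k ∈ Finset.Iic i, a k / k + (a i * ε)⁻¹ * (a i * t))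
    (fun k => div_nonneg (ha k).le (by positivity)) fun u => ?_)
  have hb : 0 < a i * ε := mul_pos (ha i) hε
  obtain ⟨n, hn⟩ := (insert i u).exists_le
  have hsub : u ⊆ Finset.Iic n := fun k hk => Finset.mem_Iic.2 (hn k (Finset.mem_insert_of_mem hk))
  have hin : i ≤ n := hn i (Finset.mem_insert_self _ _)
  have hk0 : ∀ k : ℕ+, 0 ≤ a k / k := fun k => div_nonneg (ha k).le (by positivity)
  calc ∑ k ∈ u, a k / k ≤ ∑ k ∈ Finset.Iic n, a k / k :=
        Finset.sum_le_sum_of_subset_of_nonneg hsub fun k _ _ => hk0 k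
    _ ≤ ∑ k ∈ Finset.Iic n, ((if k ∈ Finset.Iic i then a k / k else 0) +
          (a i * ε)⁻¹ * (a k * v k)) := by
        refine Finset.sum_le_sum fun k _ => ?_
        have hvk : 0 ≤ (a i * ε)⁻¹ * (a k * v k) :=
          mul_nonneg (inv_pos.2 hb).le (mul_nonneg (ha k).le (hv0 k))
        split_ifs with hki
        · linarith
        · rw [Finset.mem_Iic, not_le] at hki
          have h1 := div_le_of_forall_sub_le hv0 hflux hki.le
          have h2 : (k : ℝ)⁻¹ ≤ (a i * ε)⁻¹ * v k := by
            rw [le_inv_mul_iff₀ hb]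
            simpa [div_eq_mul_inv] using h1
          have h3 := mul_le_mul_of_nonneg_left h2 (ha k).le
          rw [div_eq_mul_inv]
          linarith
    _ = ∑ k ∈ Finset.Iic i, a k / k + (a i * ε)⁻¹ * ∑ k ∈ Finset.Iic n, a k * v k := by
        rw [Finset.sum_add_distrib, ← Finset.mul_sum, Finset.sum_ite_mem,
          Finset.inter_eq_right.2 (Finset.Iic_subset_Iic.2 hin)]
    _ ≤ _ := by
        have := mul_le_mul_of_nonneg_left (hmass n) (inv_pos.2 hb).le
        linarith

/-- An arbitrary sequence increasing to `1` eventually exceeds `(1 - η) χ n`, as only finitely many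
points matter; positivity transfers the statement for indicators to it. -/
theorem isConservative_of_not_summable (ha : ∀ k, 0 < a k)
    (hs : ¬ Summable fun k : ℕ+ => a k / k) : IsConservative (traceForm a) := by
  obtain ⟨T, hT, -⟩ := existsUnique_isFormSemigroup ha
  refine ⟨T, hT, fun t _ f hf0 hfmono hf1 => ?_⟩
  rw [ae_discreteMeasure_iff ha] at hf1 ⊢
  simp_rw [discrete_nonneg_iff ha] at hf0
  choose χ hχ using exists_indicator ha
  have hf01 : ∀ j k, f j k ∈ Icc (0 : ℝ) 1 := fun j k =>
    ⟨hf0 j k, Monotone.ge_of_tendsto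
      (fun m n hmn => (discrete_le_iff ha).1 (hfmono hmn) k) (hf1 k) j⟩
  intro i
  rw [tendsto_order]
  refine ⟨fun b hb => ?_, fun b hb => Eventually.of_forall fun j =>
    (semigroup_mem_Icc ha hT t (hf01 j) i).2.trans_lt hb⟩
  -- Chosen so that `(1 - η)² > 1 - 2 η ≥ b`; the cap at `1` keeps the multiple `1 - η` of the
  -- indicator nonnegative.
  set η := min ((1 - b) / 2) 1
  have hη : 0 < η := lt_min (by linarith) one_pos
  have hη1 : η ≤ 1 := min_le_right _ _
  have hηb : b ≤ 1 - 2 * η := by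
    have : η ≤ (1 - b) / 2 := min_le_left _ _
    linarith
  obtain ⟨n, hn⟩ := exists_lt_semigroup_indicator ha hs hT hχ t i hη
  have hev : ∀ᶠ j in atTop, ∀ k ∈ Finset.Iic n, 1 - η < f j k := by
    rw [Filter.eventually_all_finset]
    exact fun k _ => (hf1 k).eventually (lt_mem_nhds (by linarith))
  filter_upwards [hev] with j hj
  have h1 := (semigroup_mem_Icc ha hT t (f := f j - (1 - η) • χ n) (fun k => by
    rw [discrete_sub_apply ha, discrete_smul_apply ha, hχ]
    split_ifs with hk
    · have := hj k (Finset.mem_Iic.2 hk)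
      exact ⟨by linarith, by linarith [(hf01 j k).2]⟩
    · simpa using hf01 j k) i).1
  rw [map_sub, map_smul, discrete_sub_apply ha, discrete_smul_apply ha] at h1
  nlinarith

theorem isConservative_iff (ha : ∀ k, 0 < a k) :
    IsConservative (traceForm a) ↔ ∑' k : ℕ+, ENNReal.ofReal (a k / (k : ℝ)) = ∞ := by
  have h0 : ∀ k : ℕ+, 0 ≤ a k / k := fun k => div_nonneg (ha k).le (by positivity)
  have h : Summable (fun k : ℕ+ => a k / k) ↔
      ∑' k : ℕ+, ENNReal.ofReal (a k / (k : ℝ)) ≠ ∞ := by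
    constructor
    · intro hs
      rw [← ENNReal.ofReal_tsum_of_nonneg h0 hs]
      exact ENNReal.ofReal_ne_top
    · intro hs
      exact (ENNReal.summable_toReal hs).congr fun k => ENNReal.toReal_ofReal (h0 k)
  refine ⟨fun hc => ?_, fun hs => isConservative_of_not_summable ha fun h' => h.1 h' hs⟩
  by_contra hne
  exact not_isConservative_of_summable ha (h.2 hne) hc

end Conservativeness

/-! ### The three-dimensional Bessel form -/

section Bessel

/-- Lebesgue measure on `(0, ∞)`. -/
abbrev halfLine : Measure ℝ := volume.restrict (Ioi 0)

theorem integrable_besselMeasure_iff {g : ℝ → ℝ} :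
    Integrable g (besselMeasure 3) ↔ Integrable (fun x => g x * x ^ 2) halfLine := by
  rw [besselMeasure, integrable_withDensity_iff_integrable_smul' (by fun_prop)
    (Eventually.of_forall fun _ => ENNReal.ofReal_lt_top)]
  have e : (fun x : ℝ => (ENNReal.ofReal (2 * x ^ (3 - 1))).toReal • g x) =
      fun x => 2 * (g x * x ^ 2) := by
    funext x
    rw [ENNReal.toReal_ofReal (mul_nonneg zero_le_two (sq_nonneg x)), smul_eq_mul]
    ring
  rw [e]
  exact integrable_const_mul_iff (by norm_num) _

theorem integral_besselMeasure (g : ℝ → ℝ) :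
    ∫ x, g x ∂besselMeasure 3 = 2 * ∫ x in Ioi 0, g x * x ^ 2 := by
  rw [besselMeasure, integral_withDensity_eq_integral_toReal_smul (by fun_prop)
    (Eventually.of_forall fun _ => ENNReal.ofReal_lt_top),
    ← integral_const_mul]
  refine integral_congr_ae (Eventually.of_forall fun x => ?_)
  simp only
  rw [ENNReal.toReal_ofReal (mul_nonneg zero_le_two (sq_nonneg x)), smul_eq_mul]
  ring

theorem continuousOn_Ioi_of_absolutelyContinuous {u : ℝ → ℝ}
    (hu : ∀ x y : ℝ, 0 < x → x ≤ y → AbsolutelyContinuousOnInterval u x y) :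
    ContinuousOn u (Ioi 0) := by
  intro x hx
  have hx' : 0 < x := hx
  have h := (hu (x / 2) (x + 1) (by positivity) (by linarith)).continuousOn
  rw [uIcc_of_le (by linarith)] at h
  exact (h.continuousAt (Icc_mem_nhds (by linarith) (by linarith))).continuousWithinAt

theorem ae_differentiableAt_halfLine {u : ℝ → ℝ}
    (hu : ∀ x y : ℝ, 0 < x → x ≤ y → AbsolutelyContinuousOnInterval u x y) :
    ∀ᵐ x ∂halfLine, DifferentiableAt ℝ u x := by
  rw [ae_restrict_iff' measurableSet_Ioi]
  have h : ∀ n : ℕ, ∀ᵐ x : ℝ, x ∈ uIcc (1 / (n + 1 : ℝ)) (n + 1) → DifferentiableAt ℝ u x :=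
    fun n => (hu _ _ (by positivity) (by
      rw [div_le_iff₀ (by positivity)]
      have : (0 : ℝ) ≤ n := by positivity
      nlinarith)).ae_differentiableAt
  filter_upwards [ae_all_iff.2 h] with x hx hx0
  obtain ⟨n, hn⟩ := exists_nat_gt x
  obtain ⟨m, hm⟩ := exists_nat_one_div_lt (show (0 : ℝ) < x from hx0)
  refine hx (max n m) (Icc_subset_uIcc ⟨hm.le.trans' ?_, hn.le.trans ?_⟩)
  · refine one_div_le_one_div_of_le (by positivity) ?_
    push_cast
    linarith [le_max_right (n : ℝ) m]
  · push_cast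
    linarith [le_max_left (n : ℝ) m]

/-- Absorbing the weight as a factor `x` makes both conditions membership in one unweighted `L²`, so
sums and products reduce to standard `L²` facts. -/
theorem mem_besselDomain_iff {u : ℝ → ℝ} :
    u ∈ besselDomain 3 ↔
      (∀ x y : ℝ, 0 < x → x ≤ y → AbsolutelyContinuousOnInterval u x y) ∧
      MemLp (fun x => deriv u x * x) 2 halfLine ∧ MemLp (fun x => u x * x) 2 halfLine := by
  refine and_congr_right fun hu => ?_
  have hm : AEStronglyMeasurable u halfLine :=
    (continuousOn_Ioi_of_absolutelyContinuous hu).aestronglyMeasurable measurableSet_Ioi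
  have h1 : AEStronglyMeasurable (fun x => deriv u x * x) halfLine :=
    ((measurable_deriv u).mul measurable_id).aestronglyMeasurable
  have h2 : AEStronglyMeasurable (fun x => u x * x) halfLine :=
    hm.mul measurable_id.aestronglyMeasurable
  have h3 : AEStronglyMeasurable u (besselMeasure 3) :=
    hm.mono_ac (withDensity_absolutelyContinuous _ _)
  rw [memLp_two_iff_integrable_sq h1, memLp_two_iff_integrable_sq h2,
    memLp_two_iff_integrable_sq h3, integrable_besselMeasure_iff]
  simp_rw [mul_pow]
  rfl

variable {u v w p : ℝ → ℝ}

theorem memLp_deriv_of_mem (hu : u ∈ besselDomain 3) :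
    MemLp (fun x => deriv u x * x) 2 halfLine := (mem_besselDomain_iff.1 hu).2.1

theorem memLp_of_mem (hu : u ∈ besselDomain 3) :
    MemLp (fun x => u x * x) 2 halfLine := (mem_besselDomain_iff.1 hu).2.2

theorem add_mem_besselDomain (hu : u ∈ besselDomain 3) (hv : v ∈ besselDomain 3) :
    u + v ∈ besselDomain 3 := by
  refine mem_besselDomain_iff.2 ⟨fun x y hx hxy => (hu.1 x y hx hxy).add (hv.1 x y hx hxy), ?_, ?_⟩
  · refine ((memLp_deriv_of_mem hu).add (memLp_deriv_of_mem hv)).ae_eq ?_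
    filter_upwards [ae_differentiableAt_halfLine hu.1, ae_differentiableAt_halfLine hv.1]
      with x h1 h2
    rw [deriv_add h1 h2]
    simp [add_mul]
  · convert (memLp_of_mem hu).add (memLp_of_mem hv) using 1
    funext x
    simp [add_mul]

theorem smul_mem_besselDomain (r : ℝ) (hu : u ∈ besselDomain 3) : r • u ∈ besselDomain 3 := by
  refine mem_besselDomain_iff.2 ⟨fun x y hx hxy => (hu.1 x y hx hxy).const_smul r, ?_, ?_⟩
  · convert (memLp_deriv_of_mem hu).const_smul r using 1
    funext x
    simp [mul_assoc, deriv_const_smul_field]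
  · convert (memLp_of_mem hu).const_smul r using 1
    funext x
    simp [mul_assoc]

theorem zero_mem_besselDomain : (0 : ℝ → ℝ) ∈ besselDomain 3 := by
  refine mem_besselDomain_iff.2 ⟨fun x y _ _ => ?_, by simp, by simp⟩
  exact (LipschitzWith.const (0 : ℝ)).lipschitzOnWith.absolutelyContinuousOnInterval

theorem integrable_energy (hu : u ∈ besselDomain 3) (hv : v ∈ besselDomain 3) :
    Integrable (fun x => deriv u x * deriv v x * x ^ 2) halfLine := by
  convert (memLp_deriv_of_mem hu).integrable_mul (memLp_deriv_of_mem hv) using 1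
  funext x
  simp only [Pi.mul_apply]
  ring

theorem integrable_mass (hu : u ∈ besselDomain 3) (hv : v ∈ besselDomain 3) :
    Integrable (fun x => u x * v x * x ^ 2) halfLine := by
  convert (memLp_of_mem hu).integrable_mul (memLp_of_mem hv) using 1
  funext x
  simp only [Pi.mul_apply]
  ring

theorem integrable_shift (lam : ℝ) (hu : u ∈ besselDomain 3) (hv : v ∈ besselDomain 3) :
    Integrable (fun x => deriv u x * deriv v x * x ^ 2 + 2 * lam * (u x * v x * x ^ 2))
      halfLine :=
  (integrable_energy hu hv).add ((integrable_mass hu hv).const_mul _)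

/-- The coefficient `2 * lam` comes from the density `2 x²` of `m`, while the energy carries the
weight `x²`. -/
theorem besselFormShift_eq (lam : ℝ) (hu : u ∈ besselDomain 3) (hv : v ∈ besselDomain 3) :
    besselFormShift 3 lam u v =
      ∫ x in Ioi 0, (deriv u x * deriv v x * x ^ 2 + 2 * lam * (u x * v x * x ^ 2)) := by
  rw [integral_add (integrable_energy hu hv) ((integrable_mass hu hv).const_mul _),
    integral_const_mul, besselFormShift, integral_besselMeasure, besselForm]
  norm_num
  ring

theorem besselFormShift_add_left (lam : ℝ) (hu : u ∈ besselDomain 3) (hv : v ∈ besselDomain 3)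
    (hw : w ∈ besselDomain 3) :
    besselFormShift 3 lam (u + v) w = besselFormShift 3 lam u w + besselFormShift 3 lam v w := by
  rw [besselFormShift_eq lam (add_mem_besselDomain hu hv) hw, besselFormShift_eq lam hu hw,
    besselFormShift_eq lam hv hw, ← integral_add
      (integrable_shift lam hu hw) (integrable_shift lam hv hw)]
  refine integral_congr_ae ?_
  filter_upwards [ae_differentiableAt_halfLine hu.1, ae_differentiableAt_halfLine hv.1] with x h1 h2
  rw [deriv_add h1 h2, Pi.add_apply]
  ring

theorem besselFormShift_smul_left (lam r : ℝ) (hu : u ∈ besselDomain 3)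
    (hw : w ∈ besselDomain 3) :
    besselFormShift 3 lam (r • u) w = r * besselFormShift 3 lam u w := by
  rw [besselFormShift_eq lam (smul_mem_besselDomain r hu) hw, besselFormShift_eq lam hu hw,
    ← integral_const_mul]
  refine integral_congr_ae (Eventually.of_forall fun x => ?_)
  simp only [deriv_const_smul_field, Pi.smul_apply, smul_eq_mul]
  ring

theorem besselFormShift_zero_left (lam : ℝ) : besselFormShift 3 lam 0 w = 0 := by
  simp [besselFormShift, besselForm]

theorem besselForm_le_shift {lam : ℝ} (hlam : 0 ≤ lam) (p : ℝ → ℝ) :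
    besselForm 3 p p ≤ besselFormShift 3 lam p p := by
  have : 0 ≤ ∫ x, p x * p x ∂besselMeasure 3 := integral_nonneg fun x => mul_self_nonneg _
  rw [besselFormShift]
  nlinarith

/-! ### Comparison of the Bessel energy with the discrete energy, edge by edge -/

theorem intervalIntegrable_of_halfLine {F : ℝ → ℝ} (hF : Integrable F halfLine) {x y : ℝ}
    (hx : 0 ≤ x) (hy : 0 ≤ y) : IntervalIntegrable F volume x y := by
  rw [intervalIntegrable_iff]
  refine IntegrableOn.mono_set hF fun z hz => ?_
  have h : min x y < z := hz.1
  exact (le_min hx hy).trans_lt h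

theorem sum_range_le_of_le_integral {F : ℝ → ℝ} (hF : Integrable F halfLine) (hF0 : ∀ x, 0 ≤ F x)
    {b : ℕ+ → ℝ} (hb : ∀ k : ℕ+, b k ≤ ∫ x in (k : ℝ)..(k + 1), F x) (N : ℕ) :
    ∑ i ∈ Finset.range N, b i.succPNat ≤ ∫ x in Ioi 0, F x := by
  have h1 : ∑ i ∈ Finset.range N, ∫ x in ((i + 1 : ℕ) : ℝ)..((i + 1 + 1 : ℕ) : ℝ), F x =
      ∫ x in ((0 + 1 : ℕ) : ℝ)..((N + 1 : ℕ) : ℝ), F x :=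
    intervalIntegral.sum_integral_adjacent_intervals (a := fun i => ((i + 1 : ℕ) : ℝ))
      fun k _ => intervalIntegrable_of_halfLine hF (by positivity) (by positivity)
  calc _ ≤ ∑ i ∈ Finset.range N, ∫ x in ((i + 1 : ℕ) : ℝ)..((i + 1 + 1 : ℕ) : ℝ), F x :=
        Finset.sum_le_sum fun i _ => by
          simpa using hb i.succPNat
    _ = ∫ x in ((0 + 1 : ℕ) : ℝ)..((N + 1 : ℕ) : ℝ), F x := h1
    _ ≤ _ := by
        rw [intervalIntegral.integral_of_le (by simp)]
        refine setIntegral_mono_set hF (Eventually.of_forall hF0) (LE.le.eventuallyLE ?_)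
        intro x hx
        have : ((0 + 1 : ℕ) : ℝ) < x := hx.1
        norm_num at this
        exact one_pos.trans this

theorem integral_inv_sq (k : ℕ+) : ∫ x in (k : ℝ)..(k + 1), (x ^ 2)⁻¹ = (conductance k)⁻¹ := by
  have hk : (0 : ℝ) < k := by exact_mod_cast k.pos
  have h : ∀ x ∈ uIcc (k : ℝ) (k + 1), HasDerivAt (fun x : ℝ => -x⁻¹) ((x ^ 2)⁻¹) x := by
    intro x hx
    rw [uIcc_of_le (by linarith)] at hx
    have := (hasDerivAt_inv (hk.trans_le hx.1).ne').fun_neg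
    rwa [neg_neg] at this
  rw [intervalIntegral.integral_eq_sub_of_hasDerivAt h, inv_conductance]
  · push_cast
    rfl
  · refine ContinuousOn.intervalIntegrable fun x hx => ?_
    rw [uIcc_of_le (by linarith)] at hx
    exact (ContinuousAt.inv₀ (f := fun x : ℝ => x ^ 2) (by fun_prop)
      (pow_pos (hk.trans_le hx.1) 2).ne').continuousWithinAt

/-- Cauchy–Schwarz for `p' x` and `1 / x` on `[k, k + 1]`, with `∫ x⁻²` the inverse conductance. -/
theorem conductance_mul_sq_le (hp : p ∈ besselDomain 3) (k : ℕ+) :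
    conductance k * (p ((k + 1 : ℕ+) : ℝ) - p k) ^ 2 ≤
      ∫ x in (k : ℝ)..(k + 1), deriv p x * deriv p x * x ^ 2 := by
  have hk : (0 : ℝ) < k := by exact_mod_cast k.pos
  have hkk : (k : ℝ) ≤ k + 1 := by linarith
  have hac := hp.1 k (k + 1) hk hkk
  have h1 := hac.integral_deriv_eq_sub
  have hint := intervalIntegrable_of_halfLine (integrable_energy hp hp) hk.le (hk.le.trans hkk)
  have hinv : IntervalIntegrable (fun x : ℝ => (x ^ 2)⁻¹) volume k (k + 1) := by
    refine ContinuousOn.intervalIntegrable fun x hx => ?_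
    rw [uIcc_of_le hkk] at hx
    exact (ContinuousAt.inv₀ (f := fun x : ℝ => x ^ 2) (by fun_prop)
      (pow_pos (hk.trans_le hx.1) 2).ne').continuousWithinAt
  have e : ((k + 1 : ℕ+) : ℝ) = k + 1 := by push_cast; rfl
  rw [e]
  set δ := p (k + 1) - p k
  -- The constant flux of the harmonic interpolant; it makes the integral of `(p' x - s / x)²` the
  -- exact Cauchy–Schwarz defect.
  set s := conductance k * δ
  have h2 : 0 ≤ ∫ x in (k : ℝ)..(k + 1),
      (deriv p x * deriv p x * x ^ 2 - 2 * s * deriv p x + s ^ 2 * (x ^ 2)⁻¹) := by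
    refine intervalIntegral.integral_nonneg hkk fun x hx => ?_
    have hx0 : x ≠ 0 := (hk.trans_le hx.1).ne'
    have : deriv p x * deriv p x * x ^ 2 - 2 * s * deriv p x + s ^ 2 * (x ^ 2)⁻¹ =
        (deriv p x * x - s * x⁻¹) ^ 2 := by
      field_simp
      ring
    rw [this]
    exact sq_nonneg _
  rw [intervalIntegral.integral_add (hint.sub (hac.intervalIntegrable_deriv.const_mul _))
    (hinv.const_mul _), intervalIntegral.integral_sub hint
    (hac.intervalIntegrable_deriv.const_mul _), intervalIntegral.integral_const_mul,
    intervalIntegral.integral_const_mul, integral_inv_sq, h1] at h2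
  have h3 : s ^ 2 * (conductance k)⁻¹ = conductance k * δ ^ 2 := by
    have := (conductance_pos k).ne'
    simp only [s]
    field_simp
  rw [h3] at h2
  have h4 : 2 * s * δ = 2 * (conductance k * δ ^ 2) := by
    simp only [s]
    ring
  rw [h4] at h2
  linarith

/-- A Sobolev estimate on an interval of length one: bound `|p k|` by `|p x|` plus the variation of
`p`, average over `x`, and square. The weights are harmless since `x ≥ 1`. -/
theorem sq_le_integral_Icc (hp : p ∈ besselDomain 3) (k : ℕ+) :
    p k ^ 2 ≤ ∫ x in (k : ℝ)..(k + 1), (|p x * x| + |deriv p x * x|) ^ 2 := by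
  have hk1 : (1 : ℝ) ≤ k := by exact_mod_cast k.pos
  have hk : (0 : ℝ) < k := by linarith
  have hkk : (k : ℝ) ≤ k + 1 := by linarith
  have hac := hp.1 k (k + 1) hk hkk
  have hL2 : MemLp (fun x => |p x * x| + |deriv p x * x|) 2 halfLine :=
    (memLp_of_mem hp).abs.add (memLp_deriv_of_mem hp).abs
  have hsq : IntervalIntegrable (fun x => (|p x * x| + |deriv p x * x|) ^ 2) volume k (k + 1) :=
    intervalIntegrable_of_halfLine hL2.integrable_sq hk.le (hk.le.trans hkk)
  have hd := hac.intervalIntegrable_deriv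
  have hcont : ContinuousOn (fun x => |p x * x|) (uIcc (k : ℝ) (k + 1)) :=
    (hac.continuousOn.mul continuousOn_id).abs
  have hd' : IntervalIntegrable (fun x => |deriv p x * x|) volume k (k + 1) :=
    (hd.mul_continuousOn continuousOn_id).abs
  have hh : IntervalIntegrable (fun x => |p x * x| + |deriv p x * x|) volume k (k + 1) :=
    hcont.intervalIntegrable.add hd'
  set M := ∫ x in (k : ℝ)..(k + 1), |deriv p x * x|
  have h1 : ∀ x ∈ Icc (k : ℝ) (k + 1), |p k| ≤ |p x * x| + M := by
    intro x hx
    have h2 := (hp.1 k x hk hx.1).integral_deriv_eq_sub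
    have h3 : |p x - p k| ≤ M := by
      rw [← h2]
      refine (intervalIntegral.abs_integral_le_integral_abs hx.1).trans ?_
      refine (intervalIntegral.integral_mono_on (g := fun y => |deriv p y * y|) hx.1
        (hp.1 k x hk hx.1).intervalIntegrable_deriv.abs
        (hd'.mono_set ?_) fun y hy => ?_).trans ?_
      · rw [uIcc_of_le hx.1, uIcc_of_le hkk]
        exact Icc_subset_Icc_right hx.2
      · rw [abs_mul]
        exact le_mul_of_one_le_right (abs_nonneg _)
          ((hk1.trans hy.1).trans (le_abs_self y))
      · exact intervalIntegral.integral_mono_interval le_rfl hx.1 hx.2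
          (Eventually.of_forall fun _ => abs_nonneg _) hd'
    have h4 : |p x| ≤ |p x * x| := by
      rw [abs_mul]
      exact le_mul_of_one_le_right (abs_nonneg _) ((hk1.trans hx.1).trans (le_abs_self x))
    have h5 := abs_sub_abs_le_abs_sub (p k) (p x)
    rw [abs_sub_comm] at h5
    linarith
  have h2 : |p k| ≤ ∫ x in (k : ℝ)..(k + 1), (|p x * x| + |deriv p x * x|) := by
    have h3 := intervalIntegral.integral_mono_on (μ := volume) (f := fun _ => |p k|)
      (g := fun x => |p x * x| + M) hkk intervalIntegrable_const
      (hcont.intervalIntegrable.add intervalIntegrable_const) h1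
    rw [intervalIntegral.integral_const, intervalIntegral.integral_add hcont.intervalIntegrable
      intervalIntegrable_const, intervalIntegral.integral_const] at h3
    rw [intervalIntegral.integral_add hcont.intervalIntegrable hd']
    rw [add_sub_cancel_left, one_smul, one_smul] at h3
    exact h3
  -- Jensen's inequality on a unit interval, from the integral of a square.
  have h3 : 0 ≤ ∫ x in (k : ℝ)..(k + 1), ((|p x * x| + |deriv p x * x|) ^ 2 -
      2 * |p k| * (|p x * x| + |deriv p x * x|) + |p k| ^ 2) := by
    refine intervalIntegral.integral_nonneg hkk fun x _ => ?_
    have := sq_nonneg (|p x * x| + |deriv p x * x| - |p k|)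
    linarith
  rw [intervalIntegral.integral_add (hsq.sub (hh.const_mul _)) intervalIntegrable_const,
    intervalIntegral.integral_sub hsq (hh.const_mul _), intervalIntegral.integral_const_mul,
    intervalIntegral.integral_const, add_sub_cancel_left, one_smul] at h3
  rw [← sq_abs]
  nlinarith [mul_le_mul_of_nonneg_left h2 (abs_nonneg (p k))]

/-- The Sobolev estimates add up to square summability of `p` on the integers. This is the source of
the condition at infinity in the trace form. -/
theorem tendsto_apply_pnat (hp : p ∈ besselDomain 3) :
    Tendsto (fun k : ℕ+ => p k) atTop (𝓝 0) := by
  have hL2 : MemLp (fun x => |p x * x| + |deriv p x * x|) 2 halfLine :=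
    (memLp_of_mem hp).abs.add (memLp_deriv_of_mem hp).abs
  have h1 := sum_range_le_of_le_integral hL2.integrable_sq (fun x => sq_nonneg _)
    (sq_le_integral_Icc hp)
  have h2 := (summable_of_sum_range_le (fun n => sq_nonneg _) h1).tendsto_atTop_zero
  rw [tendsto_pnat_iff]
  have h3 := h2.sqrt
  simp only [Real.sqrt_sq_eq_abs, Real.sqrt_zero] at h3
  exact (tendsto_zero_iff_abs_tendsto_zero _).2 h3

theorem tsum_conductance_le (hp : p ∈ besselDomain 3) :
    ∑' k : ℕ+, ENNReal.ofReal (conductance k * (p ((k + 1 : ℕ+) : ℝ) - p k) ^ 2) ≤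
      ENNReal.ofReal (besselForm 3 p p) := by
  have h1 := sum_range_le_of_le_integral (integrable_energy hp hp)
    (fun x => mul_nonneg (mul_self_nonneg _) (sq_nonneg x)) (conductance_mul_sq_le hp)
  rw [← Equiv.pnatEquivNat.symm.tsum_eq]
  refine ENNReal.tsum_le_of_sum_range_le fun N => ?_
  have h0 : ∀ k : ℕ+, 0 ≤ conductance k * (p ((k + 1 : ℕ+) : ℝ) - p k) ^ 2 := fun k =>
    mul_nonneg (conductance_pos k).le (sq_nonneg _)
  rw [← ENNReal.ofReal_sum_of_nonneg fun i _ => h0 _]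
  exact ENNReal.ofReal_le_ofReal (h1 N)

/-- The projection has the same values at the integers as `u`, so the edgewise bounds and the decay
apply to it directly; the mass term is only dropped. -/
theorem traceForm_le_traceApprox {a : ℕ+ → ℝ} (ha : ∀ k, 0 < a k) {lam : ℝ} (hlam : 0 ≤ lam)
    (f : Lp ℝ 2 (discreteMeasure a)) :
    traceForm a f ≤ traceApprox 3 (discreteMeasure a) lam f := by
  refine le_iInf fun u => le_iInf fun p => le_iInf fun hu => le_iInf fun hp => ?_
  obtain ⟨-, hmem, rfl⟩ := hu
  have hpk : ∀ k : ℕ+, hmem.toLp _ k = p k := fun k => by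
    rw [discrete_toLp_apply ha]
    exact sub_eq_zero.1 (hp.2.2.2 k)
  rw [traceForm_of_tendsto (by simpa only [hpk] using tendsto_apply_pnat hp.1)]
  simp_rw [hpk]
  exact (tsum_conductance_le hp.1).trans (ENNReal.ofReal_le_ofReal (besselForm_le_shift hlam p))

end Bessel

/-! ### Solutions of the resolvent equation interpolating data on the integers -/

section Interpolation

variable {w : ℝ → ℝ} {κ : ℝ}

/-- With `u = v / x` one has `u x = v` and `u' x = v' - u`. All are bounded near `0` because `v` is
Lipschitz with `v 0 = 0`, and vanish beyond `R`. -/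
theorem mul_inv_mem_besselDomain {v : ℝ → ℝ} {L : ℝ≥0} (hv : LipschitzWith L v) (h0 : v 0 = 0)
    {R : ℝ} (hR : ∀ x, R < x → v x = 0) : (fun x => v x * x⁻¹) ∈ besselDomain 3 := by
  set u : ℝ → ℝ := fun x => v x * x⁻¹
  have hvx : ∀ x, 0 < x → |v x| ≤ L * x := fun x hx => by
    have := hv.norm_sub_le x 0
    rwa [h0, sub_zero, sub_zero, Real.norm_eq_abs, Real.norm_of_nonneg hx.le] at this
  have hu : ∀ x, 0 < x → |u x| ≤ L := fun x hx => by
    simp only [u]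
    rw [abs_mul, abs_inv, abs_of_pos hx, ← div_eq_mul_inv, div_le_iff₀ hx]
    exact hvx x hx
  have hac : ∀ x y : ℝ, 0 < x → x ≤ y → AbsolutelyContinuousOnInterval u x y := by
    intro x y hx hxy
    refine AbsolutelyContinuousOnInterval.fun_mul
      hv.lipschitzOnWith.absolutelyContinuousOnInterval
      (ContDiffOn.absolutelyContinuousOnInterval fun z hz => ?_)
    rw [uIcc_of_le hxy] at hz
    exact (contDiffAt_inv ℝ (hx.trans_le hz.1).ne').contDiffWithinAt
  have hder : ∀ x, 0 < x → |deriv u x * x| ≤ 2 * L := by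
    intro x hx
    -- Where `u` is not differentiable, `deriv` has the default value `0` and the bound is trivial.
    by_cases hd : DifferentiableAt ℝ u x
    · have h1 : HasDerivAt (fun y => u y * y) (deriv u x * x + u x * 1) x :=
        hd.hasDerivAt.mul (hasDerivAt_id x)
      have h2 : v =ᶠ[𝓝 x] fun y => u y * y := by
        filter_upwards [lt_mem_nhds hx] with y hy
        simp only [u]
        rw [inv_mul_cancel_right₀ hy.ne']
      have h3 := norm_deriv_le_of_lipschitz (x₀ := x) hv
      rw [(h1.congr_of_eventuallyEq h2).deriv, Real.norm_eq_abs, mul_one] at h3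
      have h4 := abs_sub (deriv u x * x + u x) (u x)
      rw [add_sub_cancel_right] at h4
      linarith [hu x hx]
    · rw [deriv_zero_of_not_differentiableAt hd, zero_mul, abs_zero]
      positivity
  have hzero : ∀ x, R < x → u x = 0 := fun x hx => by simp [u, hR x hx]
  have hderzero : ∀ x, R < x → deriv u x = 0 := fun x hx => by
    have : u =ᶠ[𝓝 x] fun _ => 0 := by
      filter_upwards [lt_mem_nhds hx] with y hy using hzero y hy
    rw [this.deriv_eq, deriv_const]
  have key : ∀ (g : ℝ → ℝ) (C : ℝ), AEStronglyMeasurable g halfLine → (∀ x, R < x → g x = 0) →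
      (∀ x, 0 < x → x ≤ R → |g x| ≤ C) → MemLp g 2 halfLine := by
    intro g C hg hg0 hgC
    have h1 : MemLp ((Iic R).indicator fun _ => C) 2 halfLine := by
      refine memLp_indicator_const 2 measurableSet_Iic C (Or.inr ?_)
      rw [Measure.restrict_apply measurableSet_Iic]
      refine ne_top_of_le_ne_top (b := volume (Icc 0 R)) (by simp) (measure_mono ?_)
      exact fun x hx => ⟨le_of_lt hx.2, hx.1⟩
    refine h1.mono hg ?_
    filter_upwards [ae_restrict_mem measurableSet_Ioi] with x hx
    by_cases hxR : x ≤ R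
    · rw [indicator_of_mem (by exact hxR), Real.norm_eq_abs, Real.norm_eq_abs]
      exact (hgC x hx hxR).trans (le_abs_self C)
    · rw [hg0 x (not_le.1 hxR), norm_zero]
      exact norm_nonneg _
  refine mem_besselDomain_iff.2 ⟨hac, key _ (2 * L) ?_ ?_ ?_, key _ (L * R) ?_ ?_ ?_⟩
  · exact ((measurable_deriv u).mul measurable_id).aestronglyMeasurable
  · exact fun x hx => by rw [hderzero x hx, zero_mul]
  · exact fun x hx _ => hder x hx
  · exact ((continuousOn_Ioi_of_absolutelyContinuous hac).aestronglyMeasurable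
      measurableSet_Ioi).mul measurable_id.aestronglyMeasurable
  · exact fun x hx => by rw [hzero x hx, zero_mul]
  · intro x hx hxR
    rw [abs_mul, abs_of_pos hx]
    exact mul_le_mul (hu x hx) hxR hx.le L.coe_nonneg

/-- The solution of the equation `(x² h')' = κ² x² h` off the integers that equals `1` at `k` and
`0` at every other positive integer. -/
def hat (κ : ℝ) (k : ℕ+) (x : ℝ) : ℝ :=
  k / Real.sinh κ * Real.sinh (κ * max 0 (1 - |x - k|)) * x⁻¹

theorem hat_mem_besselDomain (hκ : 0 < κ) (k : ℕ+) : hat κ k ∈ besselDomain 3 := by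
  have hk : (1 : ℝ) ≤ k := by exact_mod_cast k.pos
  have h1 : LipschitzWith 1 fun x : ℝ => max 0 (1 - |x - k|) := by
    refine LipschitzWith.of_dist_le_mul fun x y => ?_
    rw [NNReal.coe_one, one_mul, Real.dist_eq, Real.dist_eq]
    refine (abs_max_sub_max_le_max 0 _ 0 _).trans ?_
    simp only [sub_self, abs_zero, sub_sub_sub_cancel_left]
    refine max_le (abs_nonneg _) ?_
    rw [abs_sub_comm x y]
    simpa using abs_abs_sub_abs_le_abs_sub (y - k) (x - k)
  obtain ⟨K, hK⟩ := (Real.contDiff_sinh (n := 1)).contDiffOn.exists_lipschitzOnWith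
    (s := Icc 0 κ) (by decide) (convex_Icc _ _) isCompact_Icc
  have h2 : LipschitzWith (‖κ‖₊ * 1) fun x : ℝ => κ * max 0 (1 - |x - k|) := by
    refine LipschitzWith.of_dist_le_mul fun x y => ?_
    have := h1.dist_le_mul x y
    rw [NNReal.coe_one, one_mul] at this
    rw [Real.dist_eq, ← mul_sub, abs_mul, ← Real.dist_eq]
    push_cast
    rw [mul_one, Real.norm_eq_abs]
    exact mul_le_mul_of_nonneg_left this (abs_nonneg κ)
  have hmem : ∀ x : ℝ, κ * max 0 (1 - |x - k|) ∈ Icc 0 κ := fun x => by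
    refine ⟨by positivity, mul_le_of_le_one_right hκ.le (max_le zero_le_one ?_)⟩
    linarith [abs_nonneg (x - k)]
  have h3 : LipschitzWith (K * (‖κ‖₊ * 1)) fun x : ℝ => Real.sinh (κ * max 0 (1 - |x - k|)) := by
    rw [← lipschitzOnWith_univ]
    exact hK.comp h2.lipschitzOnWith fun x _ => hmem x
  have h4 : LipschitzWith (‖(k : ℝ) / Real.sinh κ‖₊ * (K * (‖κ‖₊ * 1)))
      fun x : ℝ => k / Real.sinh κ * Real.sinh (κ * max 0 (1 - |x - k|)) := by
    refine LipschitzWith.of_dist_le_mul fun x y => ?_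
    rw [Real.dist_eq, ← mul_sub, abs_mul, ← Real.dist_eq, NNReal.coe_mul, mul_assoc]
    exact mul_le_mul_of_nonneg_left (h3.dist_le_mul x y) (abs_nonneg _)
  refine mul_inv_mem_besselDomain h4 ?_ (R := k + 1) fun x hx => ?_
  · rw [max_eq_left]
    · simp
    · rw [zero_sub, abs_neg, abs_of_nonneg (by linarith)]
      linarith
  · rw [max_eq_left]
    · simp
    · rw [abs_of_nonneg (by linarith)]
      linarith

theorem hat_eq_zero (κ : ℝ) (k : ℕ+) {x : ℝ} (hx : 1 ≤ |x - k|) : hat κ k x = 0 := by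
  rw [hat, max_eq_left (by linarith)]
  simp

theorem hat_self (hκ : 0 < κ) (k : ℕ+) : hat κ k k = 1 := by
  have hk : (k : ℝ) ≠ 0 := by exact_mod_cast k.pos.ne'
  have hs : Real.sinh κ ≠ 0 := (Real.sinh_pos_iff.2 hκ).ne'
  simp only [hat, sub_self, abs_zero, sub_zero, zero_le_one, sup_of_le_right, mul_one]
  field_simp

theorem hat_apply (hκ : 0 < κ) (k j : ℕ+) : hat κ k j = if j = k then 1 else 0 := by
  split_ifs with h
  · rw [h, hat_self hκ]
  · refine hat_eq_zero κ k ?_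
    have h1 : (j : ℤ) - k ≠ 0 := by
      rw [sub_ne_zero]
      exact_mod_cast fun h' => h (PNat.coe_injective h')
    exact_mod_cast Int.one_le_abs h1

/-- The flux `x² q'` of the solution `q = A sinh (τ (x - b)) / x`. -/
def flux (A τ b x : ℝ) : ℝ := A * (τ * x * Real.cosh (τ * (x - b)) - Real.sinh (τ * (x - b)))

/-- The derivative is `τ² x² q`, which is the equation `(x² q')' = τ² x² q`. -/
theorem hasDerivAt_flux (A τ b x : ℝ) :
    HasDerivAt (flux A τ b) (A * (τ ^ 2 * x * Real.sinh (τ * (x - b)))) x := by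
  have h1 : HasDerivAt (fun x => τ * (x - b)) τ x := by
    simpa using ((hasDerivAt_id x).sub_const b).const_mul τ
  have h2 : HasDerivAt (fun x => τ * x) τ x := by
    simpa using (hasDerivAt_id x).const_mul τ
  have h3 := ((h2.mul h1.cosh).sub h1.sinh).const_mul A
  have e : A * (τ ^ 2 * x * Real.sinh (τ * (x - b))) =
      A * (τ * Real.cosh (τ * (x - b)) + τ * x * (Real.sinh (τ * (x - b)) * τ) -
        Real.cosh (τ * (x - b)) * τ) := by ring
  rw [e]
  exact h3

theorem hasDerivAt_sinh_div (A τ b : ℝ) {x : ℝ} (hx : x ≠ 0) :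
    HasDerivAt (fun x => A * Real.sinh (τ * (x - b)) * x⁻¹) (flux A τ b x * (x ^ 2)⁻¹) x := by
  have h1 : HasDerivAt (fun x => τ * (x - b)) τ x := by
    simpa using ((hasDerivAt_id x).sub_const b).const_mul τ
  have h2 := (h1.sinh.const_mul A).mul (hasDerivAt_inv hx)
  have e : flux A τ b x * (x ^ 2)⁻¹ = A * (Real.cosh (τ * (x - b)) * τ) * x⁻¹ +
      A * Real.sinh (τ * (x - b)) * -(x ^ 2)⁻¹ := by
    rw [flux]
    field_simp
    ring
  rw [e]
  exact h2

/-- Integration by parts on an interval where `h` solves the equation. -/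
theorem integral_piece {h : ℝ → ℝ} {A τ b α β : ℝ} (hα : 0 < α) (hαβ : α ≤ β)
    (hh : ∀ x ∈ Ioo α β, h x = A * Real.sinh (τ * (x - b)) * x⁻¹)
    (hw : AbsolutelyContinuousOnInterval w α β) :
    ∫ x in α..β, (deriv h x * deriv w x * x ^ 2 + τ ^ 2 * (h x * w x * x ^ 2)) =
      flux A τ b β * w β - flux A τ b α * w α := by
  have hφ : AbsolutelyContinuousOnInterval (flux A τ b) α β := by
    refine ContDiffOn.absolutelyContinuousOnInterval (ContDiff.contDiffOn ?_)
    unfold flux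
    fun_prop
  rw [← hφ.integral_deriv_mul_eq_sub hw]
  refine intervalIntegral.integral_congr_ae ?_
  have hβ : ∀ᵐ x : ℝ, x ≠ β := by simp [ae_iff, measure_singleton]
  filter_upwards [hβ] with x hxβ hx
  rw [uIoc_of_le hαβ] at hx
  have hx' : x ∈ Ioo α β := ⟨hx.1, lt_of_le_of_ne hx.2 hxβ⟩
  have hx0 : x ≠ 0 := (hα.trans hx.1).ne'
  have h1 : h =ᶠ[𝓝 x] fun x => A * Real.sinh (τ * (x - b)) * x⁻¹ := by
    filter_upwards [isOpen_Ioo.mem_nhds hx'] with y hy using hh y hy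
  rw [h1.deriv_eq, (hasDerivAt_sinh_div A τ b hx0).deriv, (hasDerivAt_flux A τ b x).deriv,
    hh x hx']
  field_simp
  ring

/-- There is no boundary term at `0`: finite energy keeps `ε |w ε|` bounded, and the flux vanishes
at `0` together with its derivative. -/
theorem tendsto_flux_mul (A τ : ℝ) (hw : w ∈ besselDomain 3) :
    Tendsto (fun ε => flux A τ 0 ε * w ε) (𝓝[>] 0) (𝓝 0) := by
  have hderiv : IntervalIntegrable (fun x => |deriv w x * x|) volume 0 1 := by
    rw [intervalIntegrable_iff_integrableOn_Ioc_of_le zero_le_one]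
    have h1 : MemLp (fun x => |deriv w x * x|) 2 (volume.restrict (Ioc 0 1)) :=
      (memLp_deriv_of_mem hw).abs.mono_measure (Measure.restrict_mono Ioc_subset_Ioi_self le_rfl)
    exact h1.integrable (by norm_num)
  set M := ∫ x in (0 : ℝ)..1, |deriv w x * x|
  have hbound : ∀ ε ∈ Ioo (0 : ℝ) 1, |w ε| * ε ≤ |w 1| + M := by
    intro ε hε
    have hac := hw.1 ε 1 hε.1 hε.2.le
    have h1 := hac.integral_deriv_eq_sub
    have h2 : |w 1 - w ε| * ε ≤ M := by
      rw [← h1, mul_comm]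
      calc _ ≤ ε * ∫ x in ε..1, |deriv w x| := by
            gcongr
            · exact hε.1.le
            · exact intervalIntegral.abs_integral_le_integral_abs hε.2.le
        _ = ∫ x in ε..1, ε * |deriv w x| := (intervalIntegral.integral_const_mul _ _).symm
        _ ≤ ∫ x in ε..1, |deriv w x * x| := by
            refine intervalIntegral.integral_mono_on hε.2.le
              (hac.intervalIntegrable_deriv.abs.const_mul _) (hderiv.mono_set ?_) fun x hx => ?_
            · rw [uIcc_of_le hε.2.le, uIcc_of_le zero_le_one]
              exact Icc_subset_Icc_left hε.1.le
            · rw [abs_mul, mul_comm, abs_of_pos (hε.1.trans_le hx.1)]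
              exact mul_le_mul_of_nonneg_left hx.1 (abs_nonneg _)
        _ ≤ M := intervalIntegral.integral_mono_interval hε.1.le hε.2.le le_rfl
            (Eventually.of_forall fun _ => abs_nonneg _) hderiv
    have h3 : |w ε| ≤ |w 1| + |w 1 - w ε| := by
      have := abs_sub_abs_le_abs_sub (w ε) (w 1)
      rw [abs_sub_comm] at this
      linarith
    have h4 : |w 1| * ε ≤ |w 1| := mul_le_of_le_one_right (abs_nonneg _) hε.2.le
    calc |w ε| * ε ≤ (|w 1| + |w 1 - w ε|) * ε := mul_le_mul_of_nonneg_right h3 hε.1.le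
      _ ≤ _ := by rw [add_mul]; linarith
  have hflux : Tendsto (fun ε => |ε⁻¹ * flux A τ 0 ε| * (|w 1| + M)) (𝓝[>] 0) (𝓝 0) := by
    have h1 := (hasDerivAt_flux A τ 0 0).tendsto_slope_zero_right
    have h2 : flux A τ 0 0 = 0 := by simp [flux]
    simp only [zero_add, h2, sub_zero, mul_zero, zero_mul, smul_eq_mul] at h1
    simpa using h1.abs.mul_const (|w 1| + M)
  refine squeeze_zero_norm' ?_ hflux
  filter_upwards [Ioo_mem_nhdsGT (zero_lt_one' ℝ)] with ε hε
  have e : ‖flux A τ 0 ε * w ε‖ = |ε⁻¹ * flux A τ 0 ε| * (|w ε| * ε) := by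
    rw [Real.norm_eq_abs, abs_mul, abs_mul, abs_inv, abs_of_pos hε.1]
    have := hε.1.ne'
    field_simp
  rw [e]
  exact mul_le_mul_of_nonneg_left (hbound ε hε) (abs_nonneg _)

/-- For `k = 1` the interval reaches the singular endpoint `0`, and integration by parts is done on
`[ε, 1]` before letting `ε → 0`. -/
theorem integral_left_piece {h : ℝ → ℝ} {A τ : ℝ} (k : ℕ+) (hdom : h ∈ besselDomain 3)
    (hh : ∀ x ∈ Ioo ((k : ℝ) - 1) k, h x = A * Real.sinh (τ * (x - (k - 1))) * x⁻¹)
    (hw : w ∈ besselDomain 3) :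
    ∫ x in ((k : ℝ) - 1)..k, (deriv h x * deriv w x * x ^ 2 + τ ^ 2 * (h x * w x * x ^ 2)) =
      flux A τ (k - 1) k * w k - flux A τ (k - 1) (k - 1) * w (k - 1) := by
  rcases eq_or_lt_of_le (show (1 : ℝ) ≤ k by exact_mod_cast k.pos) with hk | hk
  · rw [← hk, sub_self] at hh ⊢
    have hI := integrable_shift (τ ^ 2 / 2) hdom hw
    rw [mul_div_cancel₀ _ two_ne_zero] at hI
    have h0 : flux A τ 0 0 = 0 := by simp [flux]
    have h1 : ∀ᶠ ε in 𝓝[>] (0 : ℝ),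
        flux A τ 0 1 * w 1 - flux A τ 0 ε * w ε =
          ∫ x in ε..1, (deriv h x * deriv w x * x ^ 2 + τ ^ 2 * (h x * w x * x ^ 2)) := by
      filter_upwards [Ioo_mem_nhdsGT (zero_lt_one' ℝ)] with ε hε
      exact (integral_piece hε.1 hε.2.le (fun x hx => hh x ⟨hε.1.trans hx.1, hx.2⟩)
        (hw.1 ε 1 hε.1 hε.2.le)).symm
    have h2 := ((tendsto_flux_mul A τ hw).const_sub (flux A τ 0 1 * w 1)).congr' h1
    have h3 : ContinuousWithinAt
        (fun ε => ∫ x in ε..1, (deriv h x * deriv w x * x ^ 2 + τ ^ 2 * (h x * w x * x ^ 2)))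
        (Icc 0 1) 0 := by
      have := intervalIntegral.continuousOn_primitive_interval_left (μ := volume) (a := 0)
        (b := (1 : ℝ)) (f := fun x => deriv h x * deriv w x * x ^ 2 + τ ^ 2 * (h x * w x * x ^ 2))
        (by
          rw [uIcc_of_le zero_le_one, integrableOn_Icc_iff_integrableOn_Ioc]
          exact IntegrableOn.mono_set hI Ioc_subset_Ioi_self)
      rw [uIcc_of_le zero_le_one] at this
      exact this 0 ⟨le_rfl, zero_le_one⟩
    have h4 : Tendsto
        (fun ε => ∫ x in ε..1, (deriv h x * deriv w x * x ^ 2 + τ ^ 2 * (h x * w x * x ^ 2)))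
        (𝓝[>] 0)
        (𝓝 (∫ x in (0 : ℝ)..1, (deriv h x * deriv w x * x ^ 2 + τ ^ 2 * (h x * w x * x ^ 2)))) := by
      refine h3.tendsto.mono_left ?_
      rw [← nhdsWithin_Ioo_eq_nhdsGT (zero_lt_one' ℝ)]
      exact nhdsWithin_mono 0 Ioo_subset_Icc_self
    rw [tendsto_nhds_unique h4 h2, h0, zero_mul]
  · exact integral_piece (by linarith) (by linarith) hh
      (hw.1 _ _ (by linarith) (by linarith))

/-- The form `E_lam`, with `2 lam = κ²`, paired with an interpolating solution. -/
theorem besselFormShift_hat (hκ : 0 < κ) (k : ℕ+) (hw : w ∈ besselDomain 3) :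
    besselFormShift 3 (κ ^ 2 / 2) (hat κ k) w =
      κ / Real.sinh κ * (2 * k ^ 2 * Real.cosh κ * w k - k * (k - 1) * w (k - 1) -
        k * (k + 1) * w (k + 1)) := by
  have hdom := hat_mem_besselDomain hκ k
  have hk : (1 : ℝ) ≤ k := by exact_mod_cast k.pos
  have hI := integrable_shift (κ ^ 2 / 2) hdom hw
  rw [besselFormShift_eq _ hdom hw]
  rw [mul_div_cancel₀ _ two_ne_zero] at hI ⊢
  set G := fun x => deriv (hat κ k) x * deriv w x * x ^ 2 + κ ^ 2 * (hat κ k x * w x * x ^ 2)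
  have h1 : ∫ x in Ioi 0, G x = ∫ x in Ioc ((k : ℝ) - 1) (k + 1), G x := by
    refine setIntegral_eq_of_subset_of_ae_sdiff_eq_zero measurableSet_Ioi.nullMeasurableSet
      (fun x hx => lt_of_le_of_lt (by linarith) hx.1) ?_
    have hne : ∀ᵐ x : ℝ, x ≠ (k : ℝ) - 1 := by simp [ae_iff, measure_singleton]
    filter_upwards [hne] with x hx hx'
    have hx1 : 1 < |x - k| := by
      rw [lt_abs]
      by_contra! hc
      exact hx'.2 ⟨lt_of_le_of_ne (by linarith) hx.symm, by linarith⟩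
    have h2 : hat κ k =ᶠ[𝓝 x] fun _ => 0 := by
      have : Continuous fun y : ℝ => |y - k| := by fun_prop
      filter_upwards [this.continuousAt.eventually (lt_mem_nhds hx1)] with y hy
        using hat_eq_zero κ k (le_of_lt hy)
    simp only [G]
    rw [h2.deriv_eq, h2.eq_of_nhds, deriv_const]
    ring
  rw [h1, ← intervalIntegral.integral_of_le (by linarith),
    ← intervalIntegral.integral_add_adjacent_intervals (b := (k : ℝ))
      (intervalIntegrable_of_halfLine hI (by linarith) (by linarith))
      (intervalIntegrable_of_halfLine hI (by linarith) (by linarith))]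
  -- The coefficient of `w (k - 1)` contains the factor `k - 1`; for `k = 1` the meaningless value
  -- `w 0` thus drops out.
  have hleft := integral_left_piece (A := k / Real.sinh κ) (τ := κ) k hdom (fun x hx => by
    rw [hat, abs_of_neg (by linarith [hx.2]), max_eq_right (by linarith [hx.1])]
    ring_nf) hw
  have hright := integral_piece (h := hat κ k) (A := -(k / Real.sinh κ)) (τ := κ) (b := k + 1)
    (α := k) (β := k + 1) (by linarith) (by linarith) (fun x hx => by
    rw [hat, abs_of_pos (by linarith [hx.1]), max_eq_right (by linarith [hx.2])]
    have : κ * (1 - (x - k)) = -(κ * (x - (k + 1))) := by ring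
    rw [this, Real.sinh_neg]
    ring) (hw.1 _ _ (by linarith) (by linarith))
  rw [hleft, hright]
  simp only [flux, sub_self, mul_zero, Real.cosh_zero, Real.sinh_zero, sub_sub_cancel, mul_one,
    sub_zero, sub_add_cancel_left, mul_neg, Real.cosh_neg, Real.sinh_neg]
  ring

end Interpolation

/-! ### Mosco convergence -/

section Mosco

/-- A recovery sequence for `E'` converges strongly, hence weakly, and is tested in the lower bound
for `E`. Used in both directions it gives uniqueness. -/
theorem IsMoscoLimit.le {H : Type*} [NormedAddCommGroup H] [InnerProductSpace ℝ H]
    {F : ℝ → H → ℝ≥0∞} {E E' : H → ℝ≥0∞} (h : IsMoscoLimit F E) (h' : IsMoscoLimit F E') :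
    E ≤ E' := by
  intro y
  have hl : Tendsto (fun i : ℕ => 1 / ((i : ℝ) + 1)) atTop (𝓝[>] 0) :=
    tendsto_nhdsWithin_iff.2 ⟨tendsto_one_div_add_atTop_nhds_zero_nat,
      Eventually.of_forall fun i => by simp only [mem_Ioi]; positivity⟩
  obtain ⟨x, hx, hx'⟩ := h'.recovery _ y hl
  exact ((h.liminf_le _ x y hl fun z => hx.inner tendsto_const_nhds).trans
    (liminf_le_limsup)).trans hx'

variable {a : ℕ+ → ℝ}

/-- The trace form is weakly lower semicontinuous. -/
theorem traceForm_le_liminf (ha : ∀ k, 0 < a k) {x : ℕ → Lp ℝ 2 (discreteMeasure a)}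
    {y : Lp ℝ 2 (discreteMeasure a)}
    (h : ∀ z, Tendsto (fun i => inner ℝ (x i) z) atTop (𝓝 (inner ℝ y z))) :
    traceForm a y ≤ liminf (fun i => traceForm a (x i)) atTop := by
  by_contra! hcon
  obtain ⟨C, hC1, hC2⟩ := ENNReal.lt_iff_exists_nnreal_btwn.1 hcon
  have hfreq := frequently_lt_of_liminf_lt (by isBoundedDefault) hC1
  have hC : (C : ℝ≥0∞) = ENNReal.ofReal C := (ENNReal.ofReal_coe_nnreal).symm
  have hlim := tendsto_discrete_apply ha h
  -- Pointwise convergence would not preserve vanishing at infinity; the bound `C / k`, uniform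
  -- along infinitely many indices, does.
  have h1 : ∀ k : ℕ+, y k ^ 2 ≤ C * (k : ℝ)⁻¹ := fun k =>
    le_of_tendsto_of_frequently ((hlim k).pow 2)
      (hfreq.mono fun i hi => sq_le_of_traceForm_le ha C.coe_nonneg (hC ▸ hi.le) k)
  have h2 : Tendsto (fun k => y k) atTop (𝓝 0) := by
    have h3 : Tendsto (fun k : ℕ+ => (C : ℝ) * (k : ℝ)⁻¹) atTop (𝓝 0) := by
      simpa using tendsto_inv_pnat.const_mul (C : ℝ)
    have h4 := (squeeze_zero (fun k => sq_nonneg _) h1 h3).sqrt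
    simp only [Real.sqrt_sq_eq_abs, Real.sqrt_zero] at h4
    exact (tendsto_zero_iff_abs_tendsto_zero _).2 h4
  refine hC2.not_ge ?_
  rw [traceForm_of_tendsto h2, ENNReal.tsum_eq_iSup_sum]
  refine iSup_le fun s => ?_
  have h3 : Tendsto
      (fun i => ∑ k ∈ s, ENNReal.ofReal (conductance k * (x i (k + 1) - x i k) ^ 2)) atTop
      (𝓝 (∑ k ∈ s, ENNReal.ofReal (conductance k * (y (k + 1) - y k) ^ 2))) :=
    tendsto_finsetSum _ fun k _ =>
      ENNReal.tendsto_ofReal ((((hlim (k + 1)).sub (hlim k)).pow 2).const_mul _)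
  refine le_of_tendsto_of_frequently h3 (hfreq.mono fun i hi => ?_)
  rw [traceForm_of_tendsto (tendsto_of_traceForm_ne_top (hi.trans_le le_top).ne)] at hi
  exact (ENNReal.sum_le_tsum s).trans hi.le

/-- A function on the positive integers, extended by `0` to the natural numbers. -/
def extendZero (f : ℕ+ → ℝ) : ℕ → ℝ
  | 0 => 0
  | i + 1 => f i.succPNat

/-- Summation by parts for the discrete operator. The boundary term at the left end is killed by the
factor `i` at `i = 0`. -/
theorem sum_range_energy (F : ℕ → ℝ) (N : ℕ) :
    ∑ i ∈ Finset.range N, F (i + 1) * (2 * (i + 1 : ℝ) ^ 2 * F (i + 1) - (i + 1) * i * F i -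
      (i + 1) * (i + 1 + 1) * F (i + 2)) =
      ∑ i ∈ Finset.range N, (i + 1 : ℝ) * (i + 1 + 1) * (F (i + 2) - F (i + 1)) ^ 2 -
        N * (N + 1) * F (N + 1) * (F (N + 1) - F N) := by
  induction N with
  | zero => simp
  | succ N ih =>
    rw [Finset.sum_range_succ, Finset.sum_range_succ, ih]
    push_cast
    ring

theorem traceForm_eq_sum {f : Lp ℝ 2 (discreteMeasure a)} {N : ℕ}
    (hf : ∀ i, N ≤ i → f i.succPNat = 0) :
    traceForm a f = ENNReal.ofReal (∑ i ∈ Finset.range N,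
      (i + 1 : ℝ) * (i + 1 + 1) * (extendZero f (i + 2) - extendZero f (i + 1)) ^ 2) := by
  have h1 : Tendsto (fun k => f k) atTop (𝓝 0) := by
    rw [tendsto_pnat_iff]
    refine tendsto_const_nhds.congr' ?_
    filter_upwards [eventually_ge_atTop N] with i hi using (hf i hi).symm
  rw [traceForm_of_tendsto h1, ← Equiv.pnatEquivNat.symm.tsum_eq, tsum_eq_sum (s := Finset.range N),
    ENNReal.ofReal_sum_of_nonneg fun i _ => by positivity]
  · refine Finset.sum_congr rfl fun i _ => ?_
    have e : Equiv.pnatEquivNat.symm i = i.succPNat := rfl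
    have e' : i.succPNat + 1 = (i + 1).succPNat := rfl
    rw [e, e', conductance, Nat.succPNat_coe, Nat.cast_succ]
    rfl
  · intro i hi
    have hi' : N ≤ i := by simpa using hi
    have e : Equiv.pnatEquivNat.symm i = i.succPNat := rfl
    have e' : i.succPNat + 1 = (i + 1).succPNat := rfl
    rw [e, e', hf i hi', hf (i + 1) (by omega)]
    simp

/-- The solution of the resolvent equation that interpolates `f` on `{1, …, N}`. -/
def interpolation (κ : ℝ) (f : ℕ+ → ℝ) (N : ℕ) : ℝ → ℝ :=
  ∑ i ∈ Finset.range N, f i.succPNat • hat κ i.succPNat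

variable {κ : ℝ} {f : ℕ+ → ℝ} {N : ℕ}

theorem sum_mem_besselDomain {ι : Type*} (s : Finset ι) {h : ι → ℝ → ℝ}
    (hh : ∀ i ∈ s, h i ∈ besselDomain 3) : ∑ i ∈ s, h i ∈ besselDomain 3 := by
  classical
  induction s using Finset.induction_on with
  | empty => exact zero_mem_besselDomain
  | insert i s hi ih =>
    rw [Finset.sum_insert hi]
    exact add_mem_besselDomain (hh i (Finset.mem_insert_self i s))
      (ih fun j hj => hh j (Finset.mem_insert_of_mem hj))

theorem besselFormShift_sum_left (lam : ℝ) {ι : Type*} (s : Finset ι) {h : ι → ℝ → ℝ}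
    (hh : ∀ i ∈ s, h i ∈ besselDomain 3) {w : ℝ → ℝ} (hw : w ∈ besselDomain 3) :
    besselFormShift 3 lam (∑ i ∈ s, h i) w = ∑ i ∈ s, besselFormShift 3 lam (h i) w := by
  classical
  induction s using Finset.induction_on with
  | empty => exact besselFormShift_zero_left lam
  | insert i s hi ih =>
    rw [Finset.sum_insert hi, Finset.sum_insert hi, besselFormShift_add_left lam
      (hh i (Finset.mem_insert_self i s))
      (sum_mem_besselDomain s fun j hj => hh j (Finset.mem_insert_of_mem hj)) hw,
      ih fun j hj => hh j (Finset.mem_insert_of_mem hj)]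

theorem interpolation_mem_besselDomain (hκ : 0 < κ) : interpolation κ f N ∈ besselDomain 3 :=
  sum_mem_besselDomain _ fun _ _ => smul_mem_besselDomain _ (hat_mem_besselDomain hκ _)

theorem interpolation_apply (hκ : 0 < κ) (hf : ∀ i, N ≤ i → f i.succPNat = 0) (k : ℕ+) :
    interpolation κ f N k = f k := by
  rw [interpolation, Finset.sum_apply]
  simp only [Pi.smul_apply, hat_apply hκ, smul_eq_mul, mul_ite, mul_one, mul_zero]
  obtain ⟨j, rfl⟩ : ∃ j : ℕ, k = j.succPNat := ⟨k.natPred, (PNat.succPNat_natPred k).symm⟩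
  simp only [Nat.succPNat_inj, Finset.sum_ite_eq, Finset.mem_range]
  split_ifs with h
  · rfl
  · exact (hf j (not_lt.1 h)).symm

theorem besselFormShift_interpolation (hκ : 0 < κ) {w : ℝ → ℝ} (hw : w ∈ besselDomain 3) :
    besselFormShift 3 (κ ^ 2 / 2) (interpolation κ f N) w =
      κ / Real.sinh κ * ∑ i ∈ Finset.range N, f i.succPNat *
        (2 * (i + 1 : ℝ) ^ 2 * Real.cosh κ * w ((i + 1 : ℕ) : ℝ) - (i + 1) * i * w i -
          (i + 1) * (i + 1 + 1) * w ((i + 2 : ℕ) : ℝ)) := by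
  rw [interpolation, besselFormShift_sum_left _ _
    (fun i _ => smul_mem_besselDomain _ (hat_mem_besselDomain hκ _)) hw, Finset.mul_sum]
  refine Finset.sum_congr rfl fun i _ => ?_
  rw [besselFormShift_smul_left _ _ (hat_mem_besselDomain hκ _) hw, besselFormShift_hat hκ _ hw]
  have e : ((i.succPNat : ℕ) : ℝ) = i + 1 := by simp
  have e2 : ((i + 2 : ℕ) : ℝ) = i + 1 + 1 := by
    push_cast
    ring
  have e1 : ((i + 1 : ℕ) : ℝ) = i + 1 := by simp
  rw [e, e1, e2, add_sub_cancel_right]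
  ring

/-- The pairing involves `w` only at nonnegative integers, with coefficient zero at `0`. So the
interpolation is orthogonal to the kernel of `J`. -/
theorem besselFormShift_interpolation_eq_zero (hκ : 0 < κ) {w : ℝ → ℝ}
    (hw : w ∈ kerRestriction 3) :
    besselFormShift 3 (κ ^ 2 / 2) (interpolation κ f N) w = 0 := by
  have h0 : ∀ i : ℕ, w ((i + 1 : ℕ) : ℝ) = 0 := fun i => hw.2 i.succPNat
  rw [besselFormShift_interpolation hκ hw.1, Finset.sum_eq_zero, mul_zero]
  intro i _
  have h1 : (i : ℝ) * w i = 0 := by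
    cases i with
    | zero => simp
    | succ i => rw [h0, mul_zero]
  rw [h0, h0 (i + 1), mul_assoc _ (i : ℝ), h1]
  ring

theorem besselFormShift_interpolation_self (hκ : 0 < κ) (hf : ∀ i, N ≤ i → f i.succPNat = 0) :
    besselFormShift 3 (κ ^ 2 / 2) (interpolation κ f N) (interpolation κ f N) =
      κ / Real.sinh κ * ∑ i ∈ Finset.range N, extendZero f (i + 1) *
        (2 * (i + 1 : ℝ) ^ 2 * Real.cosh κ * extendZero f (i + 1) - (i + 1) * i * extendZero f i -
          (i + 1) * (i + 1 + 1) * extendZero f (i + 2)) := by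
  have h0 : ∀ i : ℕ, interpolation κ f N ((i + 1 : ℕ) : ℝ) = extendZero f (i + 1) := fun i =>
    interpolation_apply hκ hf i.succPNat
  rw [besselFormShift_interpolation hκ (interpolation_mem_besselDomain hκ)]
  congr 1
  refine Finset.sum_congr rfl fun i _ => ?_
  have h1 : (i : ℝ) * interpolation κ f N i = i * extendZero f i := by
    cases i with
    | zero => simp
    | succ i => rw [h0]
  rw [h0, h0 (i + 1), mul_assoc _ (i : ℝ), h1]
  change extendZero f (i + 1) * _ = _
  ring

/-- The interpolation is its own projection, so it serves as both `u` and `p` in the infimum. -/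
theorem traceApprox_le (ha : ∀ k, 0 < a k) (hκ : 0 < κ) (f : Lp ℝ 2 (discreteMeasure a))
    (hf : ∀ i, N ≤ i → f i.succPNat = 0) :
    traceApprox 3 (discreteMeasure a) (κ ^ 2 / 2) f ≤
      ENNReal.ofReal (besselFormShift 3 (κ ^ 2 / 2) (interpolation κ f N)
        (interpolation κ f N)) := by
  have hp := interpolation_mem_besselDomain hκ (f := f) (N := N)
  have hpk := interpolation_apply hκ hf
  have hmem : MemLp (fun k : ℕ+ => interpolation κ f N k) 2 (discreteMeasure a) := by
    simp_rw [hpk]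
    exact Lp.memLp f
  refine iInf_le_of_le (interpolation κ f N) (iInf_le_of_le (interpolation κ f N)
    (iInf_le_of_le ⟨hp, hmem, discrete_ext ha fun k => ?_⟩ (iInf_le_of_le ⟨hp, fun w hw =>
      besselFormShift_interpolation_eq_zero hκ hw, ?_⟩ le_rfl)))
  · rw [discrete_toLp_apply ha, hpk]
  · rw [sub_self]
    exact ⟨zero_mem_besselDomain, fun k => rfl⟩

theorem tendsto_div_sinh : Tendsto (fun κ : ℝ => κ / Real.sinh κ) (𝓝[>] 0) (𝓝 1) := by
  have h := ((Real.hasDerivAt_sinh 0).tendsto_slope_zero_right).inv₀ (by simp)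
  simpa [div_eq_mul_inv, mul_comm] using h

/-- As `κ → 0`, both `κ / sinh κ` and `cosh κ` tend to `1`, and the energy of the interpolation
tends to the summed-by-parts discrete energy; the boundary term at `N` vanishes with `f`. -/
theorem eventually_traceApprox_lt (ha : ∀ k, 0 < a k) (f : Lp ℝ 2 (discreteMeasure a))
    (hf : ∀ i, N ≤ i → f i.succPNat = 0) {C : ℝ≥0∞} (hC : traceForm a f < C) :
    ∀ᶠ lam in 𝓝[>] (0 : ℝ), traceApprox 3 (discreteMeasure a) lam f < C := by
  have h1 : Tendsto (fun κ : ℝ => ENNReal.ofReal (κ / Real.sinh κ * ∑ i ∈ Finset.range N,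
      extendZero f (i + 1) * (2 * (i + 1 : ℝ) ^ 2 * Real.cosh κ * extendZero f (i + 1) -
        (i + 1) * i * extendZero f i - (i + 1) * (i + 1 + 1) * extendZero f (i + 2)))) (𝓝[>] 0)
      (𝓝 (traceForm a f)) := by
    have h2 : Tendsto (fun κ : ℝ => ∑ i ∈ Finset.range N,
        extendZero f (i + 1) * (2 * (i + 1 : ℝ) ^ 2 * Real.cosh κ * extendZero f (i + 1) -
          (i + 1) * i * extendZero f i - (i + 1) * (i + 1 + 1) * extendZero f (i + 2))) (𝓝[>] 0)
        (𝓝 (∑ i ∈ Finset.range N,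
          extendZero f (i + 1) * (2 * (i + 1 : ℝ) ^ 2 * Real.cosh 0 * extendZero f (i + 1) -
            (i + 1) * i * extendZero f i - (i + 1) * (i + 1 + 1) * extendZero f (i + 2)))) := by
      refine Tendsto.mono_left (Continuous.tendsto ?_ 0) nhdsWithin_le_nhds
      fun_prop
    have h3 := tendsto_div_sinh.mul h2
    simp only [Real.cosh_zero, mul_one] at h3
    have hN : extendZero f (N + 1) = 0 := hf N le_rfl
    rw [one_mul, sum_range_energy, hN] at h3
    rw [traceForm_eq_sum hf]
    refine ENNReal.tendsto_ofReal ?_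
    simpa using h3
  -- The substitution `κ = √(2 lam)` matches `lam` with `κ² / 2`.
  have h4 : Tendsto (fun lam : ℝ => √(2 * lam)) (𝓝[>] 0) (𝓝[>] 0) := by
    refine tendsto_nhdsWithin_iff.2 ⟨?_, ?_⟩
    · have : Continuous fun lam : ℝ => √(2 * lam) := by fun_prop
      simpa using (this.tendsto 0).mono_left (nhdsWithin_le_nhds (s := Ioi 0))
    · filter_upwards [self_mem_nhdsWithin] with lam hlam
      have : (0 : ℝ) < lam := hlam
      exact Real.sqrt_pos.2 (by positivity)
  filter_upwards [(h1.comp h4).eventually (gt_mem_nhds hC), self_mem_nhdsWithin] with lam h hlam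
  have hlam' : (0 : ℝ) < lam := hlam
  have hκ : 0 < √(2 * lam) := Real.sqrt_pos.2 (by positivity)
  have h5 := traceApprox_le ha hκ f hf
  rw [besselFormShift_interpolation_self hκ hf, Real.sq_sqrt (by positivity),
    mul_div_cancel_left₀ _ two_ne_zero] at h5
  exact h5.trans_lt h

/-- Functions of finite energy are approximated by finitely supported ones. -/
theorem exists_finite_support_approx (ha : ∀ k, 0 < a k) {y : Lp ℝ 2 (discreteMeasure a)}
    (hy : traceForm a y ≠ ∞) :
    ∃ z : ℕ → Lp ℝ 2 (discreteMeasure a), Tendsto z atTop (𝓝 y) ∧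
      (∀ n, traceForm a (z n) ≤ traceForm a y) ∧
      ∀ n, ∃ N : ℕ, ∀ i : ℕ, N ≤ i → z n i.succPNat = 0 := by
  have hy0 := tendsto_of_traceForm_ne_top hy
  -- Soft thresholding: a normal contraction that kills values in `[-ε, ε]`, hence gives finite
  -- support since `y` vanishes at infinity, and moves each value by at most `ε`.
  set φ : ℝ → ℝ → ℝ := fun ε x => x - max (-ε) (min x ε)
  have hφ0 : ∀ ε, 0 ≤ ε → φ ε 0 = 0 := fun ε hε => by simp [φ, hε]
  have hφ : ∀ ε x y, 0 ≤ ε → |φ ε x - φ ε y| ≤ |x - y| := by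
    intro ε x y hε
    simp only [φ]
    grind
  have hφε : ∀ ε x, 0 ≤ ε → |x - φ ε x| ≤ ε := by
    intro ε x hε
    simp only [φ]
    grind
  have hφx : ∀ ε x, 0 ≤ ε → |x - φ ε x| ≤ |x| := by
    intro ε x hε
    simp only [φ]
    grind
  have hφz : ∀ ε x, |x| ≤ ε → φ ε x = 0 := by
    intro ε x hx
    simp only [φ]
    grind
  have hε : ∀ n : ℕ, (0 : ℝ) < 1 / (n + 1) := fun n => by positivity
  have hys := (hasSum_norm_sq_discreteMeasure ha y).summable
  have hsum : ∀ n : ℕ, Summable fun k => a k * φ (1 / (n + 1)) (y k) ^ 2 := fun n => by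
    refine hys.of_nonneg_of_le (fun k => mul_nonneg (ha k).le (sq_nonneg _)) fun k =>
      mul_le_mul_of_nonneg_left (sq_le_sq.2 ?_) (ha k).le
    have h := hφ (1 / (n + 1)) (y k) 0 (hε n).le
    rwa [hφ0 _ (hε n).le, sub_zero, sub_zero] at h
  choose z hz using fun n => exists_discrete_eq ha (hsum n)
  refine ⟨z, ?_, fun n => traceForm_contraction (hφ0 _ (hε n).le)
    (fun x y => hφ _ x y (hε n).le) (hz n), fun n => ?_⟩
  · have h1 : ∀ n, ‖y - z n‖ ^ 2 = ∑' k, a k * (y k - z n k) ^ 2 := fun n => by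
      rw [← (hasSum_norm_sq_discreteMeasure ha (y - z n)).tsum_eq]
      simp_rw [discrete_sub_apply ha]
    have h2 : Tendsto (fun n => ∑' k, a k * (y k - z n k) ^ 2) atTop (𝓝 (∑' _ : ℕ+, (0 : ℝ))) := by
      refine tendsto_tsum_of_dominated_convergence hys (fun k => ?_)
        (Eventually.of_forall fun n k => ?_)
      · have h3 : Tendsto (fun n => y k - z n k) atTop (𝓝 0) := by
          refine squeeze_zero_norm (fun n => ?_) tendsto_one_div_add_atTop_nhds_zero_nat
          rw [hz, Real.norm_eq_abs]
          exact hφε _ _ (hε n).le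
        simpa using (h3.pow 2).const_mul (a k)
      · rw [Real.norm_of_nonneg (mul_nonneg (ha k).le (sq_nonneg _)), hz]
        exact mul_le_mul_of_nonneg_left (sq_le_sq.2 (hφx _ _ (hε n).le)) (ha k).le
    rw [tsum_zero] at h2
    have h3 := (h2.congr fun n => (h1 n).symm).sqrt
    simp only [Real.sqrt_sq (norm_nonneg _), Real.sqrt_zero] at h3
    rw [tendsto_iff_norm_sub_tendsto_zero]
    simpa only [norm_sub_rev] using h3
  · have h1 := ((tendsto_zero_iff_abs_tendsto_zero _).1 (tendsto_pnat_iff.1 hy0)).eventually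
      (ge_mem_nhds (hε n))
    obtain ⟨N, hN⟩ := eventually_atTop.1 h1
    exact ⟨N, fun i hi => by rw [hz]; exact hφz _ _ (hN i hi)⟩

theorem isTraceForm_traceForm (ha : ∀ k, 0 < a k) :
    IsTraceForm 3 (discreteMeasure a) (traceForm a) where
  liminf_le := by
    intro l x y hl hx
    refine (traceForm_le_liminf ha hx).trans (liminf_le_liminf ?_)
    have h1 : ∀ᶠ i in atTop, l i ∈ Ioi (0 : ℝ) := hl.eventually self_mem_nhdsWithin
    filter_upwards [h1] with i hi
    exact traceForm_le_traceApprox ha (le_of_lt hi) _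
  recovery := by
    intro l y hl
    by_cases hy : traceForm a y = ∞
    · exact ⟨fun _ => y, tendsto_const_nhds, hy ▸ le_top⟩
    obtain ⟨z, hzy, hzE, hz0⟩ := exists_finite_support_approx ha hy
    set ε : ℕ → ℝ≥0∞ := fun n => ((n : ℝ≥0∞) + 1)⁻¹
    have hε0 : ∀ n, ε n ≠ 0 := fun n => by simp [ε]
    set P : ℕ → ℕ → Prop := fun i n =>
      traceApprox 3 (discreteMeasure a) (l i) (z n) < traceForm a y + ε n
    have hP : ∀ n, ∀ᶠ i in atTop, P i n := by
      intro n
      obtain ⟨N, hN⟩ := hz0 n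
      exact hl.eventually (eventually_traceApprox_lt ha (z n) hN
        ((hzE n).trans_lt (ENNReal.lt_add_right hy (hε0 n))))
    classical
    -- Diagonal choice: the best approximant `n ≤ i` already within `ε n` of the energy at the
    -- parameter `l i`.
    set m : ℕ → ℕ := fun i => Nat.findGreatest (P i) i
    have hm : Tendsto m atTop atTop := by
      rw [tendsto_atTop]
      intro n
      filter_upwards [hP n, eventually_ge_atTop n] with i hi hni
        using Nat.le_findGreatest hni hi
    have hε : Tendsto ε atTop (𝓝 0) := by
      have := (tendsto_add_atTop_iff_nat 1).2 ENNReal.tendsto_inv_nat_nhds_zero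
      simpa [ε] using this
    refine ⟨fun i => z (m i), hzy.comp hm, ?_⟩
    have h1 : Tendsto (fun i => traceForm a y + ε (m i)) atTop (𝓝 (traceForm a y + 0)) :=
      (hε.comp hm).const_add _
    rw [add_zero] at h1
    refine (limsup_le_limsup ?_).trans h1.limsup_eq.le
    -- `findGreatest` defaults to `0` if no index works; once `P i 0` holds, the chosen index does
    -- satisfy `P i`.
    filter_upwards [hP 0] with i hi
    exact (Nat.findGreatest_spec (Nat.zero_le i) hi : P i (m i)).le

end Mosco

theorem isTraceForm_iff {a : ℕ+ → ℝ} (ha : ∀ k, 0 < a k)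
    (E : Lp ℝ 2 (discreteMeasure a) → ℝ≥0∞) :
    IsTraceForm 3 (discreteMeasure a) E ↔ E = traceForm a :=
  ⟨fun h => le_antisymm (IsMoscoLimit.le h (isTraceForm_traceForm ha))
    (IsMoscoLimit.le (isTraceForm_traceForm ha) h), fun h => h ▸ isTraceForm_traceForm ha⟩

end BesselTrace

end

theorem mainTheorem1 (a : ℕ+ → ℝ) (ha : ∀ k, 0 < a k) :
    ∃ E : Lp ℝ 2 (BesselTrace.discreteMeasure a) → ℝ≥0∞,
      (∀ E', BesselTrace.IsTraceForm 3 (BesselTrace.discreteMeasure a) E' ↔ E' = E) ∧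
      (∃! T : ℝ≥0 → Lp ℝ 2 (BesselTrace.discreteMeasure a) →L[ℝ]
          Lp ℝ 2 (BesselTrace.discreteMeasure a), BesselTrace.IsFormSemigroup E T) ∧
      (BesselTrace.discreteMeasure a univ < ∞ → ¬ BesselTrace.IsConservative E) ∧
      (BesselTrace.discreteMeasure a univ = ∞ →
        (BesselTrace.IsConservative E ↔ ∑' k : ℕ+, ENNReal.ofReal (a k / (k : ℝ)) = ∞)) := by
  refine ⟨BesselTrace.traceForm a, BesselTrace.isTraceForm_iff ha,
    BesselTrace.existsUnique_isFormSemigroup ha, BesselTrace.not_isConservative_of_finite ha,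
    fun _ => BesselTrace.isConservative_iff ha⟩
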